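/- Let $(M,\omega,\mathbb T)$ be a compact symplectic toric manifold of real dimension $2m$: $(M,\omega)$ is a compact connected symplectic manifold, and the $m$-dimensional torus $\mathbb T=\mathbb R^m/\mathbb Z^m$, with Lie algebra $\mathfrak t$, acts on it smoothly, effectively and in a Hamiltonian way, with $\mathbb T$-invariant moment map $\mu:M\to\mathfrak t^*$, $\iota_{\xi^\sharp}\omega=-d\mu^{\xi}$ for $\xi\in\mathfrak t$, where $\xi^\sharp$ is the infinitesimal action of $\xi$ and $\mu^\xi=\langle\mu,\xi\rangle$. Let $\Delta=\mu(M)$, let $\mathring\Delta$ be its interior and $\mathring M=\mu^{-1}(\mathring\Delta)$. Fix a basis $(\xi_1,\dots,\xi_m)$ of $\mathfrak t$, put $K_j=\xi_j^\sharp$ and $\mu^j=\mu^{\xi_j}$, let $x^1,\dots,x^m$ be the linear coordinates on $\mathfrak t^*$ given by the dual basis, and let $\mathcal K$ be the span of the $K_j$. Definitions. For an almost complex structure $J$, let $J^{*_\omega}$ be its symplectic adjoint, $\omega(J\cdot,\cdot)=\omega(\cdot,J^{*_\omega}\cdot)$. $J$ is $\omega$-tamed if $\omega(v,Jv)>0$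 for all $v\neq0$, and an almost complex structure is integrable if its Nijenhuis tensor $N_J(X,Y)=[JX,JY]-J[JX,Y]-J[X,JY]-[X,Y]$ vanishes. For $U=M$ or $U=\mathring M$, $DGAK^{\mathbb T}_\omega(U)$ is the set of smooth, $\mathbb T$-invariant, $\omega$-tamed almost complex structures $J$ on $U$ with $J^{*_\omega}\mathcal K=J\mathcal K$ on $\mathring M$, and $DGK^{\mathbb T}_\omega(U)$ is the set of those $J\in DGAK^{\mathbb T}_\omega(U)$ for which both $J$ and $J^{*_\omega}$ are integrable (i.e. which are integrable as generalized Kähler structures). Admissible coordinates $(\mu^j,t^j)$ on $\mathring M$ are those induced by some $J\in DGK^{\mathbb T}_\omega(M)$: around each point of $\mathring M$ there are local $J$-holomorphic coordinates $(u^j,t^j)$ with $\partial/\partial u^j=-JK_j$, $\partial/\partial t^j=K_j$, and the functions $u^j$ are replaced by the $\mu^j$; the coordinate fields $\partial/\partial\mu^j$, $\partial/\partial t^j=K_j$ and the forms $d\mu^j,dt^j$ are globally defined on $\mathring M$. Theorem. Fix admissible coordinates $(\mu^j,t^j)$. (a) Let $\mathring J\in DGAK^{\mathbb T}_\omega(\mathring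 M)$ be of the anti-diagonal form $$\mathring J=\sum_{i,j=1}^m\Psi_{ij}\,\frac{\partial}{\partial t^i}\otimes d\mu^j-\sum_{i,j=1}^m(\Psi^{-1})_{ij}\,\frac{\partial}{\partial\mu^i}\otimes dt^j\qquad(*)$$ with $\Psi\in C^\infty(\mathring M,\mathbb R^{m\times m})$, and write $\Psi_{ij,k}=\partial\Psi_{ij}/\partial\mu^k$. Then $\mathring J$ is integrable if and only if $\Psi_{ij,k}=\Psi_{ik,j}$ on $\mathring M$ for all $i,j,k$; $\mathring J^{*_\omega}$ is integrable if and only if $\Psi_{ji,k}=\Psi_{ki,j}$ on $\mathring M$ for all $i,j,k$; and both are integrable if and only if there are a function $\tau\in C^\infty(\mathring\Delta)$ that is strictly convex, in the sense that its Hessian $\mathrm{Hess}(\tau)=(\partial^2\tau/\partial x^i\partial x^j)$ is positive definite at every point of $\mathring\Delta$, and a constant antisymmetric matrix $C$ such that $\Psi=\mathrm{Hess}(\tau)\circ\mu+C$ on $\mathring M$. (b) Conversely, for every $\tau\in C^\infty(\mathring\Delta)$ that is strictly convex in this sense and every antisymmetric matrix $C\in\mathbb R^{m\times m}$, formula $(*)$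 with $\Psi=\mathrm{Hess}(\tau)\circ\mu+C$ defines an element of $DGK^{\mathbb T}_\omega(\mathring M)$. -/

import Mathlib

open scoped Manifold ContDiff Topology
open Bundle Set

noncomputable section

namespace ToricGK

/-- The torus `𝕋 = ℝᵐ / ℤᵐ`. -/
abbrev Torus (m : ℕ) : Type := Fin m → UnitAddCircle

/-- The Lie algebra `𝔱 = ℝᵐ` of the torus. -/
abbrev LieAlg (m : ℕ) : Type := Fin m → ℝ

/-- The dual `𝔱*` of the Lie algebra. -/
abbrev DualLieAlg (m : ℕ) : Type := StrongDual ℝ (LieAlg m)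

/-- The exponential map `𝔱 → 𝕋`, i.e. the quotient map `ℝᵐ → ℝᵐ / ℤᵐ`. -/
def torusExp {m : ℕ} (ξ : LieAlg m) : Torus m := fun i => (ξ i : UnitAddCircle)

/-- The model vector space of a manifold of real dimension `2m`. -/
abbrev Model (m : ℕ) : Type := EuclideanSpace ℝ (Fin (2 * m))

section Fields

variable {m : ℕ} {M : Type*} [TopologicalSpace M] [ChartedSpace (Model m) M]

/-- A vector field on `M` (no smoothness required). -/
abbrev VField (m : ℕ) (M : Type*) [TopologicalSpace M] [ChartedSpace (Model m) M] : Type _ :=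
  ∀ x : M, TangentSpace (𝓡 (2 * m)) x

/-- A field of endomorphisms of the tangent spaces of `M`. -/
abbrev EndField (m : ℕ) (M : Type*) [TopologicalSpace M] [ChartedSpace (Model m) M] : Type _ :=
  ∀ x : M, TangentSpace (𝓡 (2 * m)) x →L[ℝ] TangentSpace (𝓡 (2 * m)) x

/-- A field of linear forms on the tangent spaces of `M`. -/
abbrev CovField (m : ℕ) (M : Type*) [TopologicalSpace M] [ChartedSpace (Model m) M] : Type _ :=
  ∀ x : M, TangentSpace (𝓡 (2 * m)) x →L[ℝ] ℝ

/-- A field of bilinear forms on the tangent spaces of `M`. -/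
abbrev BilinField (m : ℕ) (M : Type*) [TopologicalSpace M] [ChartedSpace (Model m) M] : Type _ :=
  ∀ x : M, TangentSpace (𝓡 (2 * m)) x →L[ℝ] TangentSpace (𝓡 (2 * m)) x →L[ℝ] ℝ

/-- The differential `df` of a real function. -/
def dfun (f : M → ℝ) : CovField m M := fun x => mfderiv (𝓡 (2 * m)) 𝓘(ℝ, ℝ) f x

variable [IsManifold (𝓡 (2 * m)) ∞ M]

/-- Smoothness, near the point `x`, of a vector field. -/
def SmoothVFieldAt (X : VField m M) (x : M) : Prop :=
  ContMDiffAt (𝓡 (2 * m)) (𝓡 (2 * m)).tangent ∞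
    (fun y => (X y : TangentBundle (𝓡 (2 * m)) M)) x

/-- Smoothness, on the set `U`, of a field of endomorphisms. -/
def SmoothEndOn (J : EndField m M) (U : Set M) : Prop :=
  ContMDiffOn (𝓡 (2 * m)) ((𝓡 (2 * m)).prod 𝓘(ℝ, Model m →L[ℝ] Model m)) ∞
    (fun y => TotalSpace.mk' (Model m →L[ℝ] Model m)
      (E := fun z : M => TangentSpace (𝓡 (2 * m)) z →L[ℝ] TangentSpace (𝓡 (2 * m)) z) y (J y)) U

/-- Smoothness of a field of bilinear forms. -/
def SmoothBilin (Ω : BilinField m M) : Prop :=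
  ContMDiff (𝓡 (2 * m)) ((𝓡 (2 * m)).prod 𝓘(ℝ, Model m →L[ℝ] Model m →L[ℝ] ℝ)) ∞
    (fun y => TotalSpace.mk' (Model m →L[ℝ] Model m →L[ℝ] ℝ)
      (E := fun z : M => TangentSpace (𝓡 (2 * m)) z →L[ℝ] TangentSpace (𝓡 (2 * m)) z →L[ℝ] ℝ)
      y (Ω y))

/-- `dΩ = 0` for a 2-form `Ω`, through the invariant formula
`dΩ(X,Y,Z) = X Ω(Y,Z) + Y Ω(Z,X) + Z Ω(X,Y) - Ω([X,Y],Z) - Ω([Y,Z],X) - Ω([Z,X],Y)`,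
evaluated on vector fields that are smooth near the point. -/
def IsClosedTwoForm (Ω : BilinField m M) : Prop :=
  ∀ (x : M) (X Y Z : VField m M),
    SmoothVFieldAt X x → SmoothVFieldAt Y x → SmoothVFieldAt Z x →
      dfun (fun y => Ω y (Y y) (Z y)) x (X x) + dfun (fun y => Ω y (Z y) (X y)) x (Y x)
        + dfun (fun y => Ω y (X y) (Y y)) x (Z x)
        - Ω x (VectorField.mlieBracket (𝓡 (2 * m)) X Y x) (Z x)
        - Ω x (VectorField.mlieBracket (𝓡 (2 * m)) Y Z x) (X x)
        - Ω x (VectorField.mlieBracket (𝓡 (2 * m)) Z X x) (Y x) = 0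

/-- A symplectic form: a smooth, antisymmetric, nondegenerate and closed field of bilinear forms. -/
structure IsSymplecticForm (Ω : BilinField m M) : Prop where
  smooth : SmoothBilin Ω
  antisymm : ∀ x v w, Ω x v w = - Ω x w v
  nondegenerate : ∀ x v, (∀ w, Ω x v w = 0) → v = 0
  closed : IsClosedTwoForm Ω

/-- The symplectic adjoint `J^{*Ω}`, i.e. `Ω(J^{*Ω} v, w) = Ω(v, J w)`. -/
def sympAdj (Ω : BilinField m M) (J : EndField m M) : EndField m M := fun x =>
  (Ω x).inverse ∘L ContinuousLinearMap.precomp ℝ (J x) ∘L Ω x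

/-- The Nijenhuis expression
`N_J(X,Y) = [JX,JY] - J[JX,Y] - J[X,JY] - [X,Y]`. -/
def nijenhuis (J : EndField m M) (X Y : VField m M) : VField m M := fun x =>
  VectorField.mlieBracket (𝓡 (2 * m)) (fun y => J y (X y)) (fun y => J y (Y y)) x
    - J x (VectorField.mlieBracket (𝓡 (2 * m)) (fun y => J y (X y)) Y x)
    - J x (VectorField.mlieBracket (𝓡 (2 * m)) X (fun y => J y (Y y)) x)
    - VectorField.mlieBracket (𝓡 (2 * m)) X Y x

/-- Integrability of an almost complex structure on the open set `U`: the Nijenhuis tensor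
vanishes on `U`. -/
def IntegrableOn (J : EndField m M) (U : Set M) : Prop :=
  ∀ x ∈ U, ∀ X Y : VField m M, SmoothVFieldAt X x → SmoothVFieldAt Y x → nijenhuis J X Y x = 0

end Fields

section Toric

variable {m : ℕ} {M : Type*} [TopologicalSpace M] [ChartedSpace (Model m) M]
  [AddAction (Torus m) M]

/-- The infinitesimal action `ξ^♯` of `ξ ∈ 𝔱`: the velocity at `s = 0` of `s ↦ exp(sξ)·x`. -/
def fundField (ξ : LieAlg m) : VField m M := fun x =>
  (mfderiv 𝓘(ℝ, ℝ) (𝓡 (2 * m)) (fun s : ℝ => torusExp (s • ξ) +ᵥ x) 0 : ℝ →L[ℝ] Model m) 1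

/-- The differential at `x` of the diffeomorphism given by `g ∈ 𝕋`. -/
def actDeriv (g : Torus m) (x : M) :
    TangentSpace (𝓡 (2 * m)) x →L[ℝ] TangentSpace (𝓡 (2 * m)) (g +ᵥ x) :=
  mfderiv (𝓡 (2 * m)) (𝓡 (2 * m)) (fun y : M => g +ᵥ y) x

/-- The span `𝒦` of the infinitesimal action at `x`. -/
def orbitSpan (x : M) : Submodule ℝ (TangentSpace (𝓡 (2 * m)) x) :=
  Submodule.span ℝ (Set.range fun ξ : LieAlg m => fundField ξ x)

variable [IsManifold (𝓡 (2 * m)) ∞ M]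

/-- `Ω` and `μ` turn the `2m`-dimensional manifold `M` with an action of the `m`-dimensional torus
into a symplectic toric manifold: the action is smooth, effective and preserves the symplectic
form `Ω`, and `μ` is a moment map for it (with the convention `ι_{ξ^♯} Ω = - dμ^ξ`).
As `ℝᵐ → ℝᵐ/ℤᵐ` is a local diffeomorphism, smoothness of the action is stated on `ℝᵐ × M`. -/
structure IsSymplecticToric (Ω : BilinField m M) (μ : M → DualLieAlg m) : Prop where
  symplectic : IsSymplecticForm Ω
  smooth_action : ContMDiff (𝓘(ℝ, LieAlg m).prod (𝓡 (2 * m))) (𝓡 (2 * m)) ∞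
    (fun p : LieAlg m × M => torusExp p.1 +ᵥ p.2)
  effective : ∀ g : Torus m, (∀ x : M, g +ᵥ x = x) → g = 0
  invariant_form : ∀ (g : Torus m) (x : M) v w,
    Ω (g +ᵥ x) (actDeriv g x v) (actDeriv g x w) = Ω x v w
  smooth_moment : ContMDiff (𝓡 (2 * m)) 𝓘(ℝ, DualLieAlg m) ∞ μ
  invariant_moment : ∀ (g : Torus m) (x : M), μ (g +ᵥ x) = μ x
  hamiltonian : ∀ (ξ : LieAlg m) (x : M) v,
    Ω x (fundField ξ x) v = - dfun (fun y => μ y ξ) x v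

/-- The interior of the moment polytope `Δ = μ(M)`. -/
def polyInt (μ : M → DualLieAlg m) : Set (DualLieAlg m) := interior (Set.range μ)

/-- The open subset `M° = μ⁻¹(Δ°)` of `M`. -/
def openPart (μ : M → DualLieAlg m) : Set M := μ ⁻¹' polyInt μ

/-- The class `DGAK` on the open `𝕋`-invariant set `U`: smooth `𝕋`-invariant `Ω`-tamed almost
complex structures `J` on `U` with `J^{*Ω} 𝒦 = J 𝒦` along `U ∩ M°`. -/
structure IsDGAK (Ω : BilinField m M) (μ : M → DualLieAlg m) (U : Set M) (J : EndField m M) :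
    Prop where
  smooth : SmoothEndOn J U
  sq_eq_neg : ∀ x ∈ U, ∀ v, J x (J x v) = - v
  tamed : ∀ x ∈ U, ∀ v, v ≠ 0 → 0 < Ω x v (J x v)
  invariant : ∀ (g : Torus m), ∀ x ∈ U, ∀ v,
    actDeriv g x (J x v) = J (g +ᵥ x) (actDeriv g x v)
  map_orbitSpan : ∀ x ∈ U ∩ openPart μ,
    (orbitSpan x).map (sympAdj Ω J x).toLinearMap = (orbitSpan x).map (J x).toLinearMap

/-- The class `DGK` on `U`: the elements of `DGAK` that are integrable as generalized Kähler
structures, i.e. for which both `J` and `J^{*Ω}` are integrable. -/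
structure IsDGK (Ω : BilinField m M) (μ : M → DualLieAlg m) (U : Set M) (J : EndField m M) :
    Prop extends IsDGAK Ω μ U J where
  integrable : IntegrableOn J U
  integrable_adj : IntegrableOn (sympAdj Ω J) U

/-- `(uʲ, tʲ)` are coordinates on the open set `V ⊆ M°` with
`∂/∂uʲ = - J K_j` and `∂/∂tʲ = K_j`, where `K_j = ξ_j^♯`; in particular they are `J`-holomorphic. -/
structure IsHolCoord (μ : M → DualLieAlg m) (ξ : Module.Basis (Fin m) ℝ (LieAlg m))
    (J : EndField m M) (V : Set M) (u t : Fin m → M → ℝ) : Prop where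
  isOpen : IsOpen V
  subset : V ⊆ openPart μ
  smooth_u : ∀ i, ContMDiffOn (𝓡 (2 * m)) 𝓘(ℝ, ℝ) ∞ (u i) V
  smooth_t : ∀ i, ContMDiffOn (𝓡 (2 * m)) 𝓘(ℝ, ℝ) ∞ (t i) V
  injOn : Set.InjOn (fun x => ((fun i => u i x, fun i => t i x) : (Fin m → ℝ) × (Fin m → ℝ))) V
  du_JK : ∀ x ∈ V, ∀ i j, dfun (u i) x (- J x (fundField (ξ j) x)) = if i = j then 1 else 0
  du_K : ∀ x ∈ V, ∀ i j, dfun (u i) x (fundField (ξ j) x) = 0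
  dt_JK : ∀ x ∈ V, ∀ i j, dfun (t i) x (- J x (fundField (ξ j) x)) = 0
  dt_K : ∀ x ∈ V, ∀ i j, dfun (t i) x (fundField (ξ j) x) = if i = j then 1 else 0

/-- The 1-form `dμʲ`, where `μʲ = μ^{ξ_j}`. -/
def dmu (μ : M → DualLieAlg m) (ξ : Module.Basis (Fin m) ℝ (LieAlg m)) (j : Fin m) : CovField m M :=
  dfun (fun y => μ y (ξ j))

/-- `X j` and `θ j` are the fields `∂/∂μʲ` and `dtʲ`, on `M°`, of the system of local coordinates
`(μʲ, tʲ)` induced by `J`: around every point of `M°` there are `J`-holomorphic coordinates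
`(uʲ, tʲ)` with `∂/∂uʲ = - J K_j` and `∂/∂tʲ = K_j`, such that `θ j = dtʲ`, and `X j` is the
coordinate field `∂/∂μʲ` of the coordinates `(μʲ, tʲ)`. The coordinate fields `∂/∂tʲ` of the
latter are the `K_j`. -/
def IsInducedCoord (μ : M → DualLieAlg m) (ξ : Module.Basis (Fin m) ℝ (LieAlg m))
    (J : EndField m M) (X : Fin m → VField m M) (θ : Fin m → CovField m M) : Prop :=
  ∀ p ∈ openPart μ, ∃ (V : Set M) (u t : Fin m → M → ℝ), p ∈ V ∧ IsHolCoord μ ξ J V u t ∧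
    ∀ x ∈ V, (∀ i, θ i x = dfun (t i) x) ∧
      ∀ i j, dmu μ ξ i x (X j x) = (if i = j then 1 else 0) ∧ dfun (t i) x (X j x) = 0

/-- The coordinate fields `X = ∂/∂μ` and the 1-forms `θ = dt` come from admissible
coordinates: coordinates `(μʲ, tʲ)` induced by an element of `DGK` on the whole of `M`. -/
def IsAdmissibleCoord (Ω : BilinField m M) (μ : M → DualLieAlg m)
    (ξ : Module.Basis (Fin m) ℝ (LieAlg m))
    (X : Fin m → VField m M) (θ : Fin m → CovField m M) : Prop :=
  ∃ J : EndField m M, IsDGK Ω μ Set.univ J ∧ IsInducedCoord μ ξ J X θ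

/-- The anti-diagonal field of endomorphisms
`∑ Ψ_{ij} ∂/∂tⁱ ⊗ dμʲ - ∑ (Ψ⁻¹)_{ij} ∂/∂μⁱ ⊗ dtʲ`. -/
def antiDiag (μ : M → DualLieAlg m) (ξ : Module.Basis (Fin m) ℝ (LieAlg m))
    (X : Fin m → VField m M) (θ : Fin m → CovField m M)
    (Ψ : M → Matrix (Fin m) (Fin m) ℝ) : EndField m M := fun x =>
  (∑ i, ∑ j, Ψ x i j • (dmu μ ξ j x).smulRight (fundField (ξ i) x))
    - ∑ i, ∑ j, (Ψ x)⁻¹ i j • (θ j x).smulRight (X i x)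

end Toric

/-- The vectors of `𝔱*` dual to the basis `ξ` of `𝔱`. -/
def dualVec {m : ℕ} (ξ : Module.Basis (Fin m) ℝ (LieAlg m)) (i : Fin m) : DualLieAlg m :=
  LinearMap.toContinuousLinearMap (ξ.coord i)

/-- The Hessian of `τ` in the linear coordinates of `𝔱*` given by the basis dual to `ξ`. -/
def hess {m : ℕ} (ξ : Module.Basis (Fin m) ℝ (LieAlg m)) (τ : DualLieAlg m → ℝ)
    (y : DualLieAlg m) : Matrix (Fin m) (Fin m) ℝ := fun i j =>
  fderiv ℝ (fun z => fderiv ℝ τ z (dualVec ξ j)) y (dualVec ξ i)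

end ToricGK

end

/-! On `M°` everything is read in the frame `∂/∂μʲ`, `K_j` and the coframe `dμʲ`, `dtʲ`. Let `J₀` be
the structure inducing the coordinates. The orbits are isotropic because `μ` is invariant, and `J₀𝒦`
is isotropic because `J₀^{*Ω}𝒦 = J₀𝒦`. Hence `Ω = ∑ dμⁱ ∧ dtⁱ` (`omega_eq`), and the adjoint of the
anti-diagonal structure with matrix `Ψ` is the one with matrix `-Ψᵀ` (`sympAdj_eq`). Integrability
of the adjoint is thus the row criterion applied to the transpose.

Suppose `Ψ = P ∘ μ`. Then `dtⁱ ∘ J = ∑ Ψ_ij dμʲ`. If the rows of `P` are closed, they have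
primitives `H_i` on `Δ°`. The functions `tⁱ` and `H_i ∘ μ` are then `J`-conjugate, so their
differentials, which span the cotangent spaces, kill the Nijenhuis tensor. Conversely, the
`dμ`-components of `N_J(∂/∂μʲ, ∂/∂μᵏ)` are `-Ψ⁻¹` applied to the curls of the rows
(`nijenhuis_X_X`). If both rows and columns are closed, the antisymmetric part of `P` is constant
and the symmetric part is a Hessian (`exists_hess_add_const`). Taming is positivity of `vᵀΨv`, to
which the antisymmetric part contributes nothing. The same formulas read backwards give (b).

Two global facts remain: `Ψ` factors smoothly through `μ`, and `Δ°` is convex, so that closed forms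
are exact. Both come from the flows of the fields `-J₀ a^♯`. These flows are complete, commute with
the torus and preserve `M°`. On `M°` the coordinates `(u, t)` show that they add up to an action of
`𝔱` (`gradExp_gradExp`), and with the torus they act transitively on `M°`. Along one flow orbit, `μ`
becomes a map `𝔱 → 𝔱*` whose derivative is positive definite, though not necessarily symmetric,
since `J₀` is only tamed. Such a map is injective, so fibres of `μ` over `Δ°` are torus orbits. Its
range, which is `Δ°`, is convex by Minty's regularization argument
(`convex_range_of_hasStrictFDerivAt_pos`).

Transitivity needs `M°` to be connected. A nontrivial torsion element of the torus has, at a fixed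
point, a differential that commutes with `J₀` and is not the identity, so its fixed points have real
codimension at least two. There are countably many torsion elements, so the points fixed by none of
them form a dense connected set. At such points the infinitesimal action is injective, hence `dμ` is
onto, and they lie in `M°`. -/

noncomputable section

namespace ToricGK

/-! ### Maps with positive definite derivative: injectivity and convex range. -/

section MonotoneMaps

variable {E : Type*} [NormedAddCommGroup E] [InnerProductSpace ℝ E]

/-- A differentiable map whose derivative is everywhere (not necessarily symmetric) positive
definite is strictly monotone. -/
theorem inner_sub_pos_of_hasFDerivAt_pos {f : E → E} {f' : E → E →L[ℝ] E}
    (hf : ∀ a, HasFDerivAt f (f' a) a) (hpos : ∀ a h, h ≠ 0 → 0 < inner ℝ (f' a h) h)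
    {a b : E} (hab : a ≠ b) : 0 < inner ℝ (f b - f a) (b - a) := by
  have hd : ∀ r : ℝ, HasDerivAt (fun r : ℝ => inner ℝ (f (a + r • (b - a))) (b - a))
      (inner ℝ (f' (a + r • (b - a)) (b - a)) (b - a)) r := by
    intro r
    have h1 : HasDerivAt (fun r : ℝ => a + r • (b - a)) (b - a) r := by
      simpa using ((hasDerivAt_id r).smul_const (b - a)).const_add a
    have h2 := (hf (a + r • (b - a))).comp_hasDerivAt r h1
    simpa using h2.inner ℝ (hasDerivAt_const r (b - a))
  have hm : StrictMono (fun r : ℝ => inner ℝ (f (a + r • (b - a))) (b - a)) := by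
    apply strictMono_of_deriv_pos
    intro r
    rw [(hd r).deriv]
    exact hpos _ _ (sub_ne_zero.mpr hab.symm)
  have := hm zero_lt_one
  simp only [zero_smul, add_zero, one_smul, add_sub_cancel] at this
  rw [inner_sub_left]
  linarith

theorem injective_of_hasFDerivAt_pos {f : E → E} {f' : E → E →L[ℝ] E}
    (hf : ∀ a, HasFDerivAt f (f' a) a) (hpos : ∀ a h, h ≠ 0 → 0 < inner ℝ (f' a h) h) :
    Function.Injective f := by
  intro a b hab
  by_contra hne
  have := inner_sub_pos_of_hasFDerivAt_pos hf hpos hne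
  simp [hab] at this

variable [FiniteDimensional ℝ E]

theorem range_eq_top_of_inner_pos {L : E →L[ℝ] E} (hL : ∀ h, h ≠ 0 → 0 < inner ℝ (L h) h) :
    L.range = ⊤ := by
  have hinj : Function.Injective L.toLinearMap := by
    rw [← LinearMap.ker_eq_bot, LinearMap.ker_eq_bot']
    intro h hh
    by_contra hne
    have := hL h hne
    rw [show L h = 0 from hh] at this
    simp at this
  exact LinearMap.range_eq_top.mpr (LinearMap.injective_iff_surjective.mp hinj)

theorem isOpenMap_of_hasStrictFDerivAt_pos {f : E → E} {f' : E → E →L[ℝ] E}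
    (hf : ∀ a, HasStrictFDerivAt f (f' a) a) (hpos : ∀ a h, h ≠ 0 → 0 < inner ℝ (f' a h) h) :
    IsOpenMap f := by
  rw [isOpenMap_iff_nhds_le]
  intro a
  have : CompleteSpace E := FiniteDimensional.complete ℝ E
  rw [(hf a).map_nhds_eq_of_surj (range_eq_top_of_inner_pos (hpos a))]

/-- Adding `ε` times the identity to a monotone map makes it expand distances by a factor at least
`ε`. It is then proper, so its range is closed; the range is also open by the inverse function
theorem, and `E` is connected. -/
theorem surjective_add_smul_of_hasStrictFDerivAt_pos {f : E → E} {f' : E → E →L[ℝ] E}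
    (hf : ∀ a, HasStrictFDerivAt f (f' a) a) (hpos : ∀ a h, h ≠ 0 → 0 < inner ℝ (f' a h) h)
    {ε : ℝ} (hε : 0 < ε) : Function.Surjective (fun a => f a + ε • a) := by
  have hg : ∀ a, HasStrictFDerivAt (fun a => f a + ε • a) (f' a + ε • ContinuousLinearMap.id ℝ E) a :=
    fun a => (hf a).add ((hasStrictFDerivAt_id a).const_smul ε)
  have hgpos : ∀ a h, h ≠ 0 → 0 < inner ℝ ((f' a + ε • ContinuousLinearMap.id ℝ E) h) h := by
    intro a h hh
    have h1 := hpos a h hh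
    have h2 : 0 < ε * inner ℝ h h := mul_pos hε (real_inner_self_pos.mpr hh)
    simp only [add_apply, smul_apply,
      ContinuousLinearMap.id_apply, inner_add_left, real_inner_smul_left]
    linarith
  have hopen := (isOpenMap_of_hasStrictFDerivAt_pos hg hgpos).isOpen_range
  have hanti : AntilipschitzWith (Real.toNNReal ε⁻¹) (fun a => f a + ε • a) := by
    apply AntilipschitzWith.of_le_mul_dist
    intro a b
    rw [Real.coe_toNNReal _ (inv_nonneg.mpr hε.le), dist_eq_norm, dist_eq_norm,
      inv_mul_eq_div, le_div_iff₀ hε]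
    rcases eq_or_ne a b with rfl | hab
    · simp
    have h1 := inner_sub_pos_of_hasFDerivAt_pos (fun a => (hf a).hasFDerivAt) hpos hab.symm
    have h2 := real_inner_le_norm (f a + ε • a - (f b + ε • b)) (a - b)
    have h3 : f a + ε • a - (f b + ε • b) = (f a - f b) + ε • (a - b) := by
      rw [smul_sub]; abel
    rw [h3, inner_add_left, real_inner_smul_left, real_inner_self_eq_norm_sq] at h2
    have h4 : 0 < ‖a - b‖ := norm_pos_iff.mpr (sub_ne_zero.mpr hab)
    rw [h3]
    nlinarith
  have hcont : Continuous (fun a => f a + ε • a) :=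
    continuous_iff_continuousAt.mpr fun a => (hg a).hasFDerivAt.continuousAt
  have : ProperSpace E := FiniteDimensional.proper ℝ E
  have hclosed : IsClosed (range (fun a => f a + ε • a)) := by
    refine (isProperMap_iff_tendsto_cocompact.mpr ⟨hcont, ?_⟩).isClosedMap.isClosed_range
    have := hanti.tendsto_cobounded
    rwa [Metric.cobounded_eq_cocompact] at this
  exact range_eq_univ.mp (IsClopen.eq_univ ⟨hclosed, hopen⟩ (range_nonempty _))

/-- The range of a strictly monotone map with positive definite derivative is convex. -/
theorem convex_range_of_hasStrictFDerivAt_pos {f : E → E} {f' : E → E →L[ℝ] E}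
    (hf : ∀ a, HasStrictFDerivAt f (f' a) a) (hpos : ∀ a h, h ≠ 0 → 0 < inner ℝ (f' a h) h) :
    Convex ℝ (range f) := by
  have hopen := (isOpenMap_of_hasStrictFDerivAt_pos hf hpos).isOpen_range
  have : CompleteSpace E := FiniteDimensional.complete ℝ E
  have : ProperSpace E := FiniteDimensional.proper ℝ E
  suffices h : convexHull ℝ (range f) ⊆ range f by
    rw [← h.antisymm (subset_convexHull ℝ _)]
    exact convex_convexHull ℝ _
  intro p hp
  have hmono : ∀ a b, 0 ≤ inner ℝ (f b - f a) (b - a) := by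
    intro a b
    rcases eq_or_ne a b with rfl | hab
    · simp
    · exact (inner_sub_pos_of_hasFDerivAt_pos (fun a => (hf a).hasFDerivAt) hpos hab).le
  -- Minty regularization: the value `p` is attained by `f + id/(n+1)` at `s n`. Once the `s n` are
  -- bounded, any limit point of them is a preimage of `p` under `f`.
  choose s hs using fun n : ℕ =>
    surjective_add_smul_of_hasStrictFDerivAt_pos hf hpos (ε := 1 / ((n : ℝ) + 1))
      (by positivity) p
  -- The points `q` for which `⟨p - q, s n⟩` is bounded below in `n` form a convex set. It will be
  -- seen to contain the range, hence its convex hull.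
  have hconv : Convex ℝ {q : E | ∃ c : ℝ, ∀ n, -c ≤ inner ℝ (p - q) (s n)} := by
    rintro q₁ ⟨c₁, h₁⟩ q₂ ⟨c₂, h₂⟩ t₁ t₂ ht₁ ht₂ ht
    refine ⟨t₁ * c₁ + t₂ * c₂, fun n => ?_⟩
    have : p - (t₁ • q₁ + t₂ • q₂) = t₁ • (p - q₁) + t₂ • (p - q₂) := by
      have : p = t₁ • p + t₂ • p := by rw [← add_smul, ht, one_smul]
      nth_rewrite 1 [this]
      simp only [smul_sub]; abel
    rw [this, inner_add_left, real_inner_smul_left, real_inner_smul_left]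
    nlinarith [mul_le_mul_of_nonneg_left (h₁ n) ht₁, mul_le_mul_of_nonneg_left (h₂ n) ht₂]
  have hrange : range f ⊆ {q : E | ∃ c : ℝ, ∀ n, -c ≤ inner ℝ (p - q) (s n)} := by
    rintro _ ⟨a, rfl⟩
    -- Monotonicity between `a` and `s n` bounds the product below by `⟨p - f a, a⟩ + ε (‖s n‖² - ⟨s
    -- n, a⟩)`; the bracket is at least `-‖a‖²`, and `ε ≤ 1`.
    refine ⟨|inner ℝ (p - f a) a| + ‖a‖ ^ 2, fun n => ?_⟩
    have h1 := hmono a (s n)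
    have h2 : f (s n) = p - (1 / ((n : ℝ) + 1)) • s n := eq_sub_of_add_eq (hs n)
    set ε : ℝ := 1 / ((n : ℝ) + 1) with hεdef
    have hε0 : 0 < ε := by positivity
    have hε1 : ε ≤ 1 := by
      rw [hεdef, div_le_one (by positivity)]
      have : (0 : ℝ) ≤ n := Nat.cast_nonneg n
      linarith
    have h3 : f (s n) - f a = (p - f a) - ε • s n := by rw [h2]; abel
    rw [h3, inner_sub_left, inner_sub_right (p - f a), real_inner_smul_left, inner_sub_right,
      real_inner_self_eq_norm_sq] at h1
    have h4 : inner ℝ (s n) a ≤ ‖s n‖ * ‖a‖ := real_inner_le_norm _ _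
    have h5 := neg_abs_le (inner ℝ (p - f a) a)
    have h6 : -‖a‖ ^ 2 ≤ ‖s n‖ ^ 2 - inner ℝ (s n) a := by
      nlinarith [sq_nonneg (‖s n‖ - ‖a‖), sq_nonneg ‖s n‖, sq_nonneg (‖a‖), sq_nonneg (‖s n‖ + ‖a‖),
        norm_nonneg (s n), norm_nonneg a]
    nlinarith [mul_le_mul_of_nonneg_left h6 hε0.le, sq_nonneg ‖a‖]
  -- The hull of an open set is open, so it contains `p - r v` for some `r > 0`. This bounds `⟨v, s
  -- n⟩` below for every `v`; applied to `v` and `-v`, it allows the uniform boundedness principle.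
  have hlow : ∀ v : E, ∃ c : ℝ, ∀ n, -c ≤ inner ℝ v (s n) := by
    intro v
    have hnhds : convexHull ℝ (range f) ∈ 𝓝 p := (hopen.convexHull).mem_nhds hp
    have hcont : Filter.Tendsto (fun r : ℝ => p - r • v) (𝓝[>] 0) (𝓝 p) := by
      have : Continuous (fun r : ℝ => p - r • v) := by fun_prop
      simpa using (this.tendsto 0).mono_left nhdsWithin_le_nhds
    obtain ⟨r, hr, hr0⟩ := ((hcont.eventually hnhds).and self_mem_nhdsWithin).exists
    obtain ⟨c, hc⟩ := convexHull_min hrange hconv hr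
    have hr0 : 0 < r := hr0
    refine ⟨c / r, fun n => ?_⟩
    have := hc n
    rw [sub_sub_cancel, real_inner_smul_left] at this
    rw [← neg_div, div_le_iff₀ hr0]
    linarith
  have hbdd : ∀ v : E, ∃ c : ℝ, ∀ n, ‖innerSL ℝ (s n) v‖ ≤ c := by
    intro v
    obtain ⟨c₁, h₁⟩ := hlow v
    obtain ⟨c₂, h₂⟩ := hlow (-v)
    refine ⟨max c₁ c₂, fun n => ?_⟩
    have h3 := h₁ n
    have h4 := h₂ n
    rw [inner_neg_left] at h4
    rw [innerSL_apply_apply, Real.norm_eq_abs, real_inner_comm, abs_le]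
    exact ⟨by linarith [le_max_left c₁ c₂], by linarith [le_max_right c₁ c₂]⟩
  obtain ⟨C, hC⟩ := banach_steinhaus hbdd
  have hsC : ∀ n, s n ∈ Metric.closedBall (0 : E) C := by
    intro n
    have := hC n
    rw [innerSL_apply_norm] at this
    simpa using this
  obtain ⟨a, -, φ, hφ, hlim⟩ := (isCompact_closedBall (0 : E) C).tendsto_subseq hsC
  refine ⟨a, ?_⟩
  have h1 : Filter.Tendsto (fun n => f (s (φ n)) + (1 / ((φ n : ℝ) + 1)) • s (φ n)) Filter.atTop
      (𝓝 (f a + (0 : ℝ) • a)) := by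
    refine (((hf a).hasFDerivAt.continuousAt.tendsto).comp hlim).add (Filter.Tendsto.smul ?_ hlim)
    exact tendsto_one_div_add_atTop_nhds_zero_nat.comp hφ.tendsto_atTop
  have h2 : (fun n => f (s (φ n)) + (1 / ((φ n : ℝ) + 1)) • s (φ n)) = fun _ => p :=
    funext fun n => hs (φ n)
  rw [h2, zero_smul, add_zero] at h1
  exact (tendsto_nhds_unique h1 tendsto_const_nhds)

end MonotoneMaps
end ToricGK
open scoped Manifold ContDiff Topology
open Bundle Set
namespace ToricGK
-- Sets of codimension two do not disconnect.
section ThinSets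

variable {E : Type*} [NormedAddCommGroup E] [NormedSpace ℝ E]

/-- The union of the lines through `a` and the points of `Z`. -/
def coneOver (a : E) (Z : Set E) : Set E := {c | ∃ r : ℝ, ∃ y ∈ Z, c = a + r • (y - a)}

/-- A set all of whose cones have Hausdorff codimension at least one: roughly, a set of
codimension at least two. -/
def IsThin (Z : Set E) : Prop := ∀ a, dimH (coneOver a Z) ≤ (Module.finrank ℝ E - 1 : ℕ)

theorem coneOver_mono (a : E) {Z Z' : Set E} (h : Z ⊆ Z') : coneOver a Z ⊆ coneOver a Z' := by
  rintro c ⟨r, y, hy, rfl⟩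
  exact ⟨r, y, h hy, rfl⟩

theorem IsThin.mono {Z Z' : Set E} (h : IsThin Z') (hZ : Z ⊆ Z') : IsThin Z :=
  fun a => (dimH_mono (coneOver_mono a hZ)).trans (h a)

theorem isThin_biUnion {ι : Type*} {s : Set ι} (hs : s.Countable) {Z : ι → Set E}
    (h : ∀ i ∈ s, IsThin (Z i)) : IsThin (⋃ i ∈ s, Z i) := by
  intro a
  have : coneOver a (⋃ i ∈ s, Z i) ⊆ ⋃ i ∈ s, coneOver a (Z i) := by
    rintro c ⟨r, y, hy, rfl⟩
    simp only [mem_iUnion] at hy ⊢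
    obtain ⟨i, hi, hy⟩ := hy
    exact ⟨i, hi, r, y, hy, rfl⟩
  refine (dimH_mono this).trans ?_
  rw [dimH_bUnion hs]
  exact iSup₂_le fun i hi => h i hi a

/-- Thinness is a local property. -/
theorem isThin_of_forall_nhds [SecondCountableTopology E] {Z : Set E}
    (h : ∀ z ∈ Z, ∃ N ∈ 𝓝 z, IsThin (N ∩ Z)) : IsThin Z := by
  choose! N hN hthin using h
  obtain ⟨t, htZ, htc, hcov⟩ := TopologicalSpace.countable_cover_nhdsWithin
    (s := Z) (f := fun z => N z ∩ Z)
    fun z hz => Filter.inter_mem (mem_nhdsWithin_of_mem_nhds (hN z hz)) self_mem_nhdsWithin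
  exact (isThin_biUnion htc fun z hz => hthin z (htZ hz)).mono hcov

variable [FiniteDimensional ℝ E]

/-- The zero set of a submersion to the plane is thin. -/
theorem exists_nhds_isThin_of_hasStrictFDerivAt {f : E → ℝ × ℝ} {f' : E →L[ℝ] ℝ × ℝ} {z : E}
    (hf : HasStrictFDerivAt f f' z) (hf' : f'.range = ⊤) (hz : f z = 0) :
    ∃ N ∈ 𝓝 z, IsThin {y | y ∈ N ∧ f y = 0} := by
  have : CompleteSpace E := FiniteDimensional.complete ℝ E
  set φ : f'.ker → E := hf.implicitFunction f f' hf' (f z) with hφ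
  obtain ⟨K, S, hS, hlip⟩ := (hf.to_implicitFunction hf').exists_lipschitzOnWith
  set e := hf.implicitToOpenPartialHomeomorph f f' hf' with he
  have he2 : Filter.Tendsto (fun y => (e y).2) (𝓝 z) (𝓝 0) := by
    have h1 : ContinuousAt e z := e.continuousAt (hf.mem_implicitToOpenPartialHomeomorph_source hf')
    have h2 : e z = (f z, 0) := hf.implicitToOpenPartialHomeomorph_self hf'
    have h3 := (continuous_snd.tendsto _).comp h1.tendsto
    rwa [h2] at h3
  have hev : ∀ᶠ y in 𝓝 z, hf.implicitFunction f f' hf' (f y) (e y).2 = y ∧ (e y).2 ∈ S :=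
    (hf.eq_implicitFunction hf').and (he2.eventually hS)
  refine ⟨_, hev, fun a => ?_⟩
  -- With `n = dim E`, the zero set is locally the image of the `(n-2)`-dimensional kernel of `f'`
  -- under a Lipschitz map. The cone parameter adds one dimension, so the cone lies in the image of
  -- `ℝ × ker f'`, of dimension `n - 1`, under maps that do not raise Hausdorff dimension.
  have hsub : coneOver a {y | y ∈ {y | hf.implicitFunction f f' hf' (f y) (e y).2 = y ∧
      (e y).2 ∈ S} ∧ f y = 0} ⊆ (fun p : ℝ × E => a + p.1 • (p.2 - a)) ''
        ((fun q : ℝ × f'.ker => (q.1, φ q.2)) '' (univ ×ˢ S)) := by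
    rintro c ⟨r, y, ⟨⟨hy1, hy2⟩, hy3⟩, rfl⟩
    refine ⟨(r, y), ⟨(r, (e y).2), ⟨mem_univ _, hy2⟩, ?_⟩, rfl⟩
    simp only [hφ, hz, Prod.mk.injEq, true_and]
    rwa [hy3] at hy1
  have h1 : ContDiffOn ℝ 1 (fun p : ℝ × E => a + p.1 • (p.2 - a)) univ := by
    apply ContDiff.contDiffOn; fun_prop
  have h2 : LipschitzOnWith (max 1 K) (fun q : ℝ × f'.ker => (q.1, φ q.2)) (univ ×ˢ S) := by
    apply LipschitzOnWith.prodMk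
    · exact LipschitzWith.prod_fst.lipschitzOnWith
    · have := hlip.comp (f := (Prod.snd : ℝ × f'.ker → f'.ker)) (s := univ ×ˢ S)
        LipschitzWith.prod_snd.lipschitzOnWith (fun q hq => hq.2)
      rwa [mul_one] at this
  refine (dimH_mono hsub).trans <| (h1.dimH_image_le convex_univ (subset_univ _)).trans <|
    h2.dimH_image_le.trans <| (dimH_mono (subset_univ _)).trans ?_
  rw [Real.dimH_univ_eq_finrank, Nat.cast_le]
  have h3 := f'.toLinearMap.finrank_range_add_finrank_ker
  rw [show f'.toLinearMap.range = ⊤ from hf', finrank_top] at h3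
  rw [Module.finrank_prod, Module.finrank_self] at *
  change 1 + Module.finrank ℝ f'.toLinearMap.ker ≤ _
  omega

theorem IsThin.dense_compl {Z : Set E} (hZ : IsThin Z) (hE : 0 < Module.finrank ℝ E) :
    Dense Zᶜ := by
  refine (dense_compl_of_dimH_lt_finrank (s := coneOver 0 Z) ?_).mono ?_
  · refine (hZ 0).trans_lt ?_
    exact_mod_cast Nat.sub_lt hE one_pos
  · intro c hc hcZ
    exact hc ⟨1, c, hcZ, by simp⟩

/-- A segment from `a ∉ Z` to a point outside the cone over `Z` with vertex `a` cannot meet `Z`. The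
cones with vertices `a` and `b` have dense complement together, so `B` contains a point outside
both, through which `a` and `b` are joined. -/
theorem IsThin.isPreconnected_diff {Z B : Set E} (hZ : IsThin Z) (hE : 0 < Module.finrank ℝ E)
    (hB : IsOpen B) (hBc : Convex ℝ B) : IsPreconnected (B \ Z) := by
  -- The subtraction in `IsThin` is truncated; positive dimension makes the bound strict.
  have hlt : ((Module.finrank ℝ E - 1 : ℕ) : ENNReal) < (Module.finrank ℝ E : ℕ) := by
    exact_mod_cast Nat.sub_lt hE one_pos
  have hseg : ∀ a ∈ B \ Z, ∀ c ∈ B, c ∉ coneOver a Z → segment ℝ a c ⊆ B \ Z := by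
    intro a ha c hc hca y hy
    refine ⟨hBc.segment_subset ha.1 hc hy, fun hyZ => hca ?_⟩
    rw [segment_eq_image'] at hy
    obtain ⟨r, hr, rfl⟩ := hy
    rcases eq_or_ne r 0 with rfl | hr0
    · simp only [zero_smul, add_zero] at hyZ
      exact absurd hyZ ha.2
    · refine ⟨r⁻¹, _, hyZ, ?_⟩
      rw [add_sub_cancel_left, smul_smul, inv_mul_cancel₀ hr0, one_smul, add_sub_cancel]
  refine isPreconnected_of_forall_pair fun a ha b hb => ?_
  have hd : Dense (coneOver a Z ∪ coneOver b Z)ᶜ := by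
    apply dense_compl_of_dimH_lt_finrank
    rw [dimH_union]
    exact (max_le (hZ a) (hZ b)).trans_lt hlt
  obtain ⟨c, hcB, hc⟩ := hd.inter_open_nonempty B hB ⟨a, ha.1⟩
  simp only [mem_compl_iff, mem_union, not_or] at hc
  refine ⟨segment ℝ a c ∪ segment ℝ b c, union_subset (hseg a ha c hcB hc.1)
    (hseg b hb c hcB hc.2), Or.inl (left_mem_segment ℝ a c), Or.inr (left_mem_segment ℝ b c), ?_⟩
  exact IsPreconnected.union c (right_mem_segment ℝ a c) (right_mem_segment ℝ b c)
    (convex_segment a c).isPreconnected (convex_segment b c).isPreconnected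

end ThinSets
end ToricGK
open scoped Manifold ContDiff Topology
open Bundle Set
namespace ToricGK
-- Closed forms on convex sets: primitives and Hessians.
section Primitives

variable {m : ℕ}

/-- The linear coordinate `y ↦ ⟨y, ξ⟩` on `𝔱*`. -/
noncomputable def evalAt (ξ : LieAlg m) : DualLieAlg m →L[ℝ] ℝ := ContinuousLinearMap.apply ℝ ℝ ξ

@[simp] theorem evalAt_apply (ξ : LieAlg m) (y : DualLieAlg m) : evalAt ξ y = y ξ := rfl

@[simp] theorem dualVec_apply_basis (ξ : Module.Basis (Fin m) ℝ (LieAlg m)) (i j : Fin m) :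
    dualVec ξ i (ξ j) = if i = j then 1 else 0 := by
  simp [dualVec, Finsupp.single_apply, eq_comm]

theorem sum_apply_smul_dualVec (ξ : Module.Basis (Fin m) ℝ (LieAlg m)) (y : DualLieAlg m) :
    ∑ i, y (ξ i) • dualVec ξ i = y := by
  ext1 v
  conv_rhs => rw [← ξ.sum_repr v, map_sum]
  simp [dualVec, mul_comm]

section

variable {ι D : Type*} [Fintype ι] [NormedAddCommGroup D] [NormedSpace ℝ D]
  {e : ι → D} {ε : ι → D →L[ℝ] ℝ}

/-- A smooth closed 1-form on an open convex set has a smooth primitive. -/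
theorem exists_primitive (he : ∀ v, ∑ i, ε i v • e i = v) {V : Set D}
    (hV : IsOpen V) (hVc : Convex ℝ V) {p : ι → D → ℝ}
    (hp : ∀ j, ContDiffOn ℝ ∞ (p j) V)
    (hsymm : ∀ y ∈ V, ∀ j k, fderiv ℝ (p j) y (e k) = fderiv ℝ (p k) y (e j)) :
    ∃ f : D → ℝ, ContDiffOn ℝ ∞ f V ∧
      ∀ y ∈ V, HasFDerivAt f (∑ j, p j y • ε j) y := by
  have hω : ContDiffOn ℝ ∞ (fun y => ∑ j, p j y • ε j) V :=
    ContDiffOn.sum fun j _ => (hp j).smul contDiffOn_const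
  have hpd : ∀ j, ∀ y ∈ V, HasFDerivAt (p j) (fderiv ℝ (p j) y) y := fun j y hy =>
    (((hp j).differentiableOn (by simp)).differentiableAt (hV.mem_nhds hy)).hasFDerivAt
  have hder : ∀ y ∈ V, fderiv ℝ (fun y => ∑ j, p j y • ε j) y
      = ∑ j, (fderiv ℝ (p j) y).smulRight (ε j) := by
    intro y hy
    apply HasFDerivAt.fderiv
    exact HasFDerivAt.fun_sum fun j _ => (hpd j y hy).smul_const (ε j)
  obtain ⟨f, hf⟩ := hVc.exists_forall_hasFDerivAt_of_fderiv_symmetric hV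
    (hω.differentiableOn (by simp)) (by
      intro y hy v w
      rw [hder y hy]
      have key : ∀ v w : D,
          (∑ j, (fderiv ℝ (p j) y).smulRight (ε j)) v w
            = ∑ j, ∑ k, ε k v * ε j w * fderiv ℝ (p j) y (e k) := by
        intro v w
        simp only [sum_apply, ContinuousLinearMap.smulRight_apply, smul_apply,
          smul_eq_mul]
        refine Finset.sum_congr rfl fun j _ => ?_
        conv_lhs => rw [← he v, map_sum, Finset.sum_mul]
        refine Finset.sum_congr rfl fun k _ => ?_
        rw [map_smul, smul_eq_mul]
        ring
      rw [key, key, Finset.sum_comm]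
      refine Finset.sum_congr rfl fun j _ => Finset.sum_congr rfl fun k _ => ?_
      rw [hsymm y hy]
      ring)
  refine ⟨f, ?_, hf⟩
  rw [contDiffOn_infty_iff_fderiv_of_isOpen hV]
  refine ⟨fun y hy => (hf y hy).differentiableAt.differentiableWithinAt, ?_⟩
  exact hω.congr fun y hy => (hf y hy).fderiv

/-- A smooth matrix-valued function on an open convex set whose rows and columns are
closed 1-forms is the sum of a Hessian and a constant antisymmetric matrix. -/
theorem exists_second_deriv_add_const [DecidableEq ι] (he : ∀ v, ∑ i, ε i v • e i = v) {V : Set D}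
    (hε : ∀ i j, ε i (e j) = if i = j then 1 else 0)
    (hV : IsOpen V) (hVc : Convex ℝ V) {P : D → Matrix (ι) (ι) ℝ}
    (hP : ∀ i j, ContDiffOn ℝ ∞ (fun y => P y i j) V)
    (hrow : ∀ y ∈ V, ∀ i j k, fderiv ℝ (fun y => P y i j) y (e k)
      = fderiv ℝ (fun y => P y i k) y (e j))
    (hcol : ∀ y ∈ V, ∀ i j k, fderiv ℝ (fun y => P y j i) y (e k)
      = fderiv ℝ (fun y => P y k i) y (e j)) :
    ∃ (τ : D → ℝ) (C : Matrix (ι) (ι) ℝ), ContDiffOn ℝ ∞ τ V ∧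
      C.transpose = -C ∧ ∀ y ∈ V, ∀ i j, P y i j =
        fderiv ℝ (fun z => fderiv ℝ τ z (e j)) y (e i) + C i j := by
  rcases V.eq_empty_or_nonempty with rfl | ⟨y₀, hy₀⟩
  · exact ⟨0, 0, contDiffOn_const, by simp, by simp⟩
  have hPd : ∀ i j, ∀ y ∈ V, DifferentiableAt ℝ (fun y => P y i j) y := fun i j y hy =>
    ((hP i j).differentiableOn (by simp)).differentiableAt (hV.mem_nhds hy)
  -- Three exchanges (column, row, column) cycle the indices and come back with `i` and `j` swapped:
  -- the antisymmetric part has zero derivative.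
  have htot : ∀ y ∈ V, ∀ i j k, fderiv ℝ (fun y => P y i j) y (e k)
      = fderiv ℝ (fun y => P y j i) y (e k) := by
    intro y hy i j k
    rw [hcol y hy j i k, hrow y hy k j i, hcol y hy i k j]
  have hconst : ∀ i j, ∀ y ∈ V, P y i j - P y j i = P y₀ i j - P y₀ j i := by
    intro i j y hy
    refine hVc.is_const_of_fderivWithin_eq_zero (𝕜 := ℝ) (f := fun y => P y i j - P y j i)
      (fun y hy => ((hPd i j y hy).sub (hPd j i y hy)).differentiableWithinAt) ?_ hy hy₀
    intro y hy
    rw [fderivWithin_of_isOpen hV hy, fderiv_fun_sub (hPd i j y hy) (hPd j i y hy)]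
    ext1 v
    rw [← he v]
    simp [htot y hy i j]
  set C : Matrix (ι) (ι) ℝ := fun i j => (P y₀ i j - P y₀ j i) / 2 with hC
  have hSsymm : ∀ y ∈ V, ∀ i j, P y i j - C i j = P y j i - C j i := by
    intro y hy i j
    have := hconst i j y hy
    simp only [hC]
    linarith
  have hSd : ∀ i j, ∀ y, fderiv ℝ (fun y => P y i j - C i j) y = fderiv ℝ (fun y => P y i j) y :=
    fun i j y => fderiv_sub_const _
  -- Once `C` is removed, each row is a closed form with primitive `a i`. Symmetry of the matrix
  -- then says that `∑ a i • ε i` is closed too, and its primitive is `τ`.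
  choose a ha using fun i => exists_primitive he hV hVc (p := fun j y => P y i j - C i j)
    (fun j => (hP i j).sub contDiffOn_const) (by
      intro y hy j k
      rw [hSd, hSd, hrow y hy])
  have hsum : ∀ (c : ι → ℝ) k, (∑ j, c j • ε j) (e k) = c k := by
    intro c k
    simp [smul_apply, hε]
  obtain ⟨τ, hτ, hτ'⟩ := exists_primitive he hV hVc (p := a) (fun i => (ha i).1) (by
      intro y hy j k
      rw [((ha j).2 y hy).fderiv, ((ha k).2 y hy).fderiv, hsum, hsum, hSsymm y hy])
  refine ⟨τ, C, hτ, ?_, ?_⟩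
  · ext i j
    change (P y₀ j i - P y₀ i j) / 2 = -((P y₀ i j - P y₀ j i) / 2)
    ring
  · intro y hy i j
    have h1 : (fun z => fderiv ℝ τ z (e j)) =ᶠ[𝓝 y] a j := by
      filter_upwards [hV.mem_nhds hy] with z hz
      rw [(hτ' z hz).fderiv, hsum]
    rw [h1.fderiv_eq, ((ha j).2 y hy).fderiv, hsum, ← hSsymm y hy]
    ring

end

theorem exists_hess_add_const (ξ : Module.Basis (Fin m) ℝ (LieAlg m)) {V : Set (DualLieAlg m)}
    (hV : IsOpen V) (hVc : Convex ℝ V) {P : DualLieAlg m → Matrix (Fin m) (Fin m) ℝ}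
    (hP : ∀ i j, ContDiffOn ℝ ∞ (fun y => P y i j) V)
    (hrow : ∀ y ∈ V, ∀ i j k, fderiv ℝ (fun y => P y i j) y (dualVec ξ k)
      = fderiv ℝ (fun y => P y i k) y (dualVec ξ j))
    (hcol : ∀ y ∈ V, ∀ i j k, fderiv ℝ (fun y => P y j i) y (dualVec ξ k)
      = fderiv ℝ (fun y => P y k i) y (dualVec ξ j)) :
    ∃ (τ : DualLieAlg m → ℝ) (C : Matrix (Fin m) (Fin m) ℝ), ContDiffOn ℝ ∞ τ V ∧
      C.transpose = -C ∧ ∀ y ∈ V, P y = hess ξ τ y + C := by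
  obtain ⟨τ, C, h1, h2, h3⟩ := exists_second_deriv_add_const (e := dualVec ξ)
    (ε := fun i => evalAt (ξ i)) (sum_apply_smul_dualVec ξ)
    (fun i j => by simp [eq_comm]) hV hVc hP hrow hcol
  exact ⟨τ, C, h1, h2, fun y hy => Matrix.ext (h3 y hy)⟩

end Primitives

/-! ### The torus and its infinitesimal action. -/

section TorusBasics
variable {m : ℕ}

theorem torusExp_add (v w : LieAlg m) : torusExp (v + w) = torusExp v + torusExp w := by
  ext i; simp [torusExp]

@[simp] theorem torusExp_zero : torusExp (0 : LieAlg m) = 0 := by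
  ext i; simp [torusExp]

theorem torusExp_neg (v : LieAlg m) : torusExp (-v) = -torusExp v := by
  ext i; simp [torusExp]

theorem torusExp_surjective : Function.Surjective (torusExp (m := m)) := by
  intro g
  choose v hv using fun i => QuotientAddGroup.mk_surjective (g i)
  exact ⟨v, funext hv⟩

end TorusBasics

section Action

theorem tangentBundle_mk_congr {m : ℕ} {M : Type*} [TopologicalSpace M] [ChartedSpace (Model m) M]
    {x y : M} (h : x = y) {v w : Model m} (h' : v = w) :
    (TotalSpace.mk x v : TangentBundle (𝓡 (2 * m)) M) = TotalSpace.mk y w := by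
  subst h h'; rfl

variable {m : ℕ} {M : Type*} [TopologicalSpace M] [ChartedSpace (Model m) M]
  [AddAction (Torus m) M] [IsManifold (𝓡 (2 * m)) ∞ M]
  {Ω : BilinField m M} {μ : M → DualLieAlg m}

theorem IsSymplecticToric.contMDiff_orbit (hM : IsSymplecticToric Ω μ) (x : M) :
    ContMDiff 𝓘(ℝ, LieAlg m) (𝓡 (2 * m)) ∞ (fun w : LieAlg m => torusExp w +ᵥ x) :=
  hM.smooth_action.comp (contMDiff_id.prodMk contMDiff_const)

theorem IsSymplecticToric.contMDiff_vadd (hM : IsSymplecticToric Ω μ) (g : Torus m) :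
    ContMDiff (𝓡 (2 * m)) (𝓡 (2 * m)) ∞ (fun y : M => g +ᵥ y) := by
  obtain ⟨w, rfl⟩ := torusExp_surjective g
  exact hM.smooth_action.comp (contMDiff_const.prodMk contMDiff_id)

theorem IsSymplecticToric.hasMFDerivAt_vadd (hM : IsSymplecticToric Ω μ) (g : Torus m) (x : M) :
    HasMFDerivAt (𝓡 (2 * m)) (𝓡 (2 * m)) (fun y : M => g +ᵥ y) x (actDeriv g x) :=
  ((hM.contMDiff_vadd g).mdifferentiable (by simp) x).hasMFDerivAt

/-- The derivative at `0` of the orbit map `w ↦ exp(w)·x`. -/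
def orbitDeriv (x : M) : LieAlg m →L[ℝ] Model m :=
  mfderiv 𝓘(ℝ, LieAlg m) (𝓡 (2 * m)) (fun w : LieAlg m => torusExp w +ᵥ x) 0

theorem IsSymplecticToric.hasMFDerivAt_orbit_zero (hM : IsSymplecticToric Ω μ) (x : M) (ξ : LieAlg m) :
    HasMFDerivAt 𝓘(ℝ, ℝ) (𝓡 (2 * m)) (fun s : ℝ => torusExp (s • ξ) +ᵥ x) 0
      ((1 : ℝ →L[ℝ] ℝ).smulRight (orbitDeriv x ξ)) := by
  have h1 : ∀ w : LieAlg m, w = 0 → HasMFDerivAt 𝓘(ℝ, LieAlg m) (𝓡 (2 * m))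
      (fun w : LieAlg m => torusExp w +ᵥ x) w (orbitDeriv x) := by
    rintro _ rfl
    exact ((hM.contMDiff_orbit x).mdifferentiable (by simp) 0).hasMFDerivAt
  have h2 : HasMFDerivAt 𝓘(ℝ, ℝ) 𝓘(ℝ, LieAlg m) (fun s : ℝ => s • ξ) 0
      ((1 : ℝ →L[ℝ] ℝ).smulRight ξ) :=
    ((hasFDerivAt_id (𝕜 := ℝ) (0 : ℝ)).smul_const ξ).hasMFDerivAt
  refine ((h1 _ (zero_smul ℝ ξ)).comp (0 : ℝ) h2).congr_mfderiv ?_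
  ext1
  exact ((orbitDeriv x).map_smul _ _)

theorem IsSymplecticToric.fundField_eq (hM : IsSymplecticToric Ω μ) (ξ : LieAlg m) (x : M) :
    fundField ξ x = orbitDeriv x ξ := by
  rw [fundField, (hM.hasMFDerivAt_orbit_zero x ξ).mfderiv]
  exact one_smul ℝ _

/-- The field is the tangent map of the action `ℝᵐ × M → M` evaluated on the smooth section `y ↦ (ξ,
0)` over `(0, y)`. -/
theorem smoothVFieldAt_fundField (hM : IsSymplecticToric Ω μ) (ξ : LieAlg m) (x : M) :
    SmoothVFieldAt (fundField ξ : VField m M) x := by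
  let F₁ : M → TangentBundle 𝓘(ℝ, LieAlg m) (LieAlg m) × TangentBundle (𝓡 (2 * m)) M :=
    fun y => (TotalSpace.mk' (LieAlg m) (0 : LieAlg m) ξ, TotalSpace.mk' (Model m) y 0)
  have S₁ : ContMDiff (𝓡 (2 * m)) (𝓘(ℝ, LieAlg m).tangent.prod (𝓡 (2 * m)).tangent) ∞ F₁ :=
    contMDiff_const.prodMk (contMDiff_zeroSection _ _)
  have S₂ := (contMDiff_equivTangentBundleProd_symm (n := ∞) (I := 𝓘(ℝ, LieAlg m)) (M := LieAlg m)
    (I' := 𝓡 (2 * m)) (M' := M)).comp S₁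
  have S₃ := (ContMDiff.contMDiff_tangentMap hM.smooth_action (m := ∞) (by simp)).comp S₂
  rw [SmoothVFieldAt]
  convert S₃ x using 1
  funext y
  refine tangentBundle_mk_congr (by change y = torusExp 0 +ᵥ y; simp) ?_
  have h1 := mfderiv_prod_eq_add_apply (p := ((0 : LieAlg m), y)) (v := (ξ, (0 : Model m)))
    (hM.smooth_action.mdifferentiable (by simp) ((0 : LieAlg m), y))
  refine Eq.trans ?_ h1.symm
  refine Eq.trans (hM.fundField_eq ξ y) ?_
  refine Eq.trans ?_ (congrArg₂ (· + ·) rfl (map_zero _).symm)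
  exact (add_zero _).symm

theorem IsSymplecticToric.fundField_sum_smul (hM : IsSymplecticToric Ω μ) {ι : Type*} (s : Finset ι)
    (a : ι → ℝ) (ξ : ι → LieAlg m) (x : M) :
    (fundField (∑ i ∈ s, a i • ξ i) x : TangentSpace (𝓡 (2 * m)) x) = ∑ i ∈ s, a i • fundField (ξ i) x := by
  refine (hM.fundField_eq _ x).trans ?_
  refine (map_sum (orbitDeriv x) _ _).trans ?_
  refine Finset.sum_congr rfl fun i _ => ?_
  refine ((orbitDeriv x).map_smul _ _).trans ?_
  rw [hM.fundField_eq]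
  rfl

theorem hasMFDerivAt_fundField (hM : IsSymplecticToric Ω μ) (x : M) (ξ : LieAlg m) :
    HasMFDerivAt 𝓘(ℝ, ℝ) (𝓡 (2 * m)) (fun s : ℝ => torusExp (s • ξ) +ᵥ x) 0
      ((1 : ℝ →L[ℝ] ℝ).smulRight (fundField ξ x : Model m)) := by
  rw [hM.fundField_eq]
  exact hM.hasMFDerivAt_orbit_zero x ξ

theorem IsSymplecticToric.isMIntegralCurve_orbit (hM : IsSymplecticToric Ω μ) (x : M) (ξ : LieAlg m) :
    IsMIntegralCurve (fun s : ℝ => torusExp (s • ξ) +ᵥ x) (fundField ξ : VField m M) := by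
  intro s₀
  have h1 : ∀ r : ℝ, r = 0 → HasMFDerivAt 𝓘(ℝ, ℝ) (𝓡 (2 * m))
      (fun s : ℝ => torusExp (s • ξ) +ᵥ (torusExp (s₀ • ξ) +ᵥ x)) r
      ((1 : ℝ →L[ℝ] ℝ).smulRight (fundField ξ (torusExp (s₀ • ξ) +ᵥ x) : Model m)) := by
    rintro _ rfl
    exact hasMFDerivAt_fundField hM _ ξ
  have h2 : HasMFDerivAt 𝓘(ℝ, ℝ) 𝓘(ℝ, ℝ) (fun s : ℝ => s - s₀) s₀ (1 : ℝ →L[ℝ] ℝ) :=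
    ((hasFDerivAt_id (𝕜 := ℝ) s₀).sub_const s₀).hasMFDerivAt
  have h3 := HasMFDerivAt.comp (f := fun s : ℝ => s - s₀) s₀ (h1 _ (sub_self s₀)) h2
  have h4 : ((fun s : ℝ => torusExp (s • ξ) +ᵥ (torusExp (s₀ • ξ) +ᵥ x)) ∘ fun s : ℝ => s - s₀)
      = fun s : ℝ => torusExp (s • ξ) +ᵥ x := by
    funext s
    simp only [Function.comp]
    rw [vadd_vadd, ← torusExp_add, ← add_smul, sub_add_cancel]
  rw [h4] at h3
  exact h3

theorem IsSymplecticToric.actDeriv_fundField (hM : IsSymplecticToric Ω μ) (g : Torus m) (x : M)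
    (ξ : LieAlg m) : actDeriv g x (fundField ξ x) = fundField ξ (g +ᵥ x) := by
  have h0 : ∀ y : M, y = x → HasMFDerivAt (𝓡 (2 * m)) (𝓡 (2 * m)) (fun y : M => g +ᵥ y) y
      (actDeriv g x : Model m →L[ℝ] Model m) := by
    rintro _ rfl
    exact hM.hasMFDerivAt_vadd g _
  have h1 := (h0 _ (by simp)).comp (0 : ℝ) (hasMFDerivAt_fundField hM x ξ)
  have h2 : ((fun y : M => g +ᵥ y) ∘ fun s : ℝ => torusExp (s • ξ) +ᵥ x) =
      fun s : ℝ => torusExp (s • ξ) +ᵥ (g +ᵥ x) := by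
    funext s
    simp only [Function.comp]
    rw [vadd_vadd, vadd_vadd, add_comm]
  rw [h2] at h1
  have h3 := hasMFDerivAt_unique h1 (hasMFDerivAt_fundField hM (g +ᵥ x) ξ)
  have h4 := DFunLike.congr_fun h3 (1 : ℝ)
  have h5 : actDeriv g x ((1 : ℝ) • fundField ξ x) = (1 : ℝ) • fundField ξ (g +ᵥ x) := h4
  rwa [one_smul, one_smul] at h5

end Action

/-! ### Smooth vector fields and their brackets as derivations. -/

section Calculus

variable {m : ℕ} {M : Type*} [TopologicalSpace M] [ChartedSpace (Model m) M]

theorem hasMFDerivAt_dfun {f : M → ℝ} {x : M} (hf : MDifferentiableAt (𝓡 (2 * m)) 𝓘(ℝ, ℝ) f x) :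
    HasMFDerivAt (𝓡 (2 * m)) 𝓘(ℝ, ℝ) f x (dfun f x) := hf.hasMFDerivAt

theorem hasDerivAt_comp_curve {f : M → ℝ} {γ : ℝ → M} {t : ℝ} {v : TangentSpace (𝓡 (2 * m)) (γ t)}
    (hf : MDifferentiableAt (𝓡 (2 * m)) 𝓘(ℝ, ℝ) f (γ t))
    (hγ : HasMFDerivAt 𝓘(ℝ, ℝ) (𝓡 (2 * m)) γ t ((1 : ℝ →L[ℝ] ℝ).smulRight v)) :
    HasDerivAt (f ∘ γ) (dfun f (γ t) v) t := by
  have h0 : HasFDerivAt (f ∘ γ)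
      ((dfun f (γ t)).comp ((1 : ℝ →L[ℝ] ℝ).smulRight v) : ℝ →L[ℝ] ℝ) t :=
    hasMFDerivAt_iff_hasFDerivAt.1 (hf.hasMFDerivAt.comp t hγ)
  have h1 := h0.hasDerivAt
  have h2 : dfun f (γ t) ((1 : ℝ) • v) = dfun f (γ t) v := by rw [one_smul]
  rw [← h2]
  exact h1

variable [IsManifold (𝓡 (2 * m)) ∞ M]

theorem SmoothVFieldAt.mfderiv_apply {F : Type*} [NormedAddCommGroup F] [NormedSpace ℝ F]
    {X : VField m M} {x : M} (hX : SmoothVFieldAt X x) {f : M → F}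
    (hf : ContMDiffAt (𝓡 (2 * m)) 𝓘(ℝ, F) ∞ f x) :
    ContMDiffAt (𝓡 (2 * m)) 𝓘(ℝ, F) ∞
      (fun y => (mfderiv (𝓡 (2 * m)) 𝓘(ℝ, F) f y (X y) : F)) x := by
  have h1 := hf.mfderiv_const (m := ∞) (by simp)
  have h2 := ContMDiffAt.clm_apply_of_inCoordinates h1 hX hf
  rw [contMDiffAt_totalSpace] at h2
  refine h2.2.congr_of_eventuallyEq (Filter.Eventually.of_forall fun y => ?_)
  simp only [trivializationAt_model_space_apply]
  rfl

theorem smoothVFieldAt_iff {X : VField m M} {x : M} :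
    SmoothVFieldAt X x ↔ ContMDiffAt (𝓡 (2 * m)) 𝓘(ℝ, Model m) ∞
      (fun y => mfderiv (𝓡 (2 * m)) 𝓘(ℝ, Model m) (extChartAt (𝓡 (2 * m)) x) y (X y)) x := by
  refine (contMDiffAt_section x).trans (Filter.EventuallyEq.contMDiffAt_iff ?_)
  filter_upwards [(chartAt (Model m) x).open_source.mem_nhds (mem_chart_source _ x)] with y hy
  have := TangentBundle.continuousLinearMapAt_trivializationAt (I := 𝓡 (2 * m)) hy
  have h2 := DFunLike.congr_fun this (X y)
  refine Eq.trans ?_ h2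
  rw [Trivialization.continuousLinearMapAt_apply, Trivialization.linearMapAt_apply, if_pos]
  simpa using hy

theorem SmoothVFieldAt.dfun_apply {X : VField m M} {x : M} (hX : SmoothVFieldAt X x) {f : M → ℝ}
    (hf : ContMDiffAt (𝓡 (2 * m)) 𝓘(ℝ, ℝ) ∞ f x) :
    ContMDiffAt (𝓡 (2 * m)) 𝓘(ℝ, ℝ) ∞ (fun y => dfun f y (X y)) x :=
  hX.mfderiv_apply hf

theorem SmoothVFieldAt.add {X Y : VField m M} {x : M} (hX : SmoothVFieldAt X x)
    (hY : SmoothVFieldAt Y x) : SmoothVFieldAt (fun y => X y + Y y) x :=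
  ContMDiffAt.add_section hX hY

theorem SmoothVFieldAt.neg {X : VField m M} {x : M} (hX : SmoothVFieldAt X x) :
    SmoothVFieldAt (fun y => - X y) x :=
  ContMDiffAt.neg_section hX

theorem SmoothVFieldAt.smul {X : VField m M} {x : M} {f : M → ℝ}
    (hf : ContMDiffAt (𝓡 (2 * m)) 𝓘(ℝ, ℝ) ∞ f x)
    (hX : SmoothVFieldAt X x) : SmoothVFieldAt (fun y => f y • X y) x :=
  ContMDiffAt.smul_section hf hX

theorem SmoothVFieldAt.sum {ι : Type*} {s : Finset ι} {X : ι → VField m M} {x : M}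
    (hX : ∀ i ∈ s, SmoothVFieldAt (X i) x) : SmoothVFieldAt (fun y => ∑ i ∈ s, X i y) x :=
  ContMDiffAt.sum_section hX

theorem SmoothVFieldAt.mdifferentiableAt {X : VField m M} {x : M} (hX : SmoothVFieldAt X x) :
    MDifferentiableAt (𝓡 (2 * m)) (𝓡 (2 * m)).tangent
      (fun y => (X y : TangentBundle (𝓡 (2 * m)) M)) x :=
  ContMDiffAt.mdifferentiableAt hX (by simp)

theorem SmoothVFieldAt.congr {X Y : VField m M} {x : M} (hX : SmoothVFieldAt X x)
    (h : ∀ᶠ y in 𝓝 x, Y y = X y) : SmoothVFieldAt Y x := by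
  refine ContMDiffAt.congr_of_eventuallyEq hX ?_
  filter_upwards [h] with y hy
  rw [hy]

theorem SmoothVFieldAt.clm_apply {J : EndField m M} {U : Set M} (hJ : SmoothEndOn J U) {x : M}
    (hU : U ∈ 𝓝 x) {X : VField m M} (hX : SmoothVFieldAt X x) :
    SmoothVFieldAt (fun y => J y (X y)) x :=
  ContMDiffAt.clm_bundle_apply (hJ.contMDiffAt hU) hX

theorem isManifold_minSmoothness (n : ℕ) : IsManifold (𝓡 (2 * m)) (minSmoothness ℝ n) M := by
  rw [minSmoothness_of_isRCLikeNormedField]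
  exact IsManifold.of_le (n := ∞) (by exact_mod_cast le_top)

local notation "⟦" X "," Y "⟧" => VectorField.mlieBracket (𝓡 (2 * m)) X Y

theorem SmoothVFieldAt.mlieBracket {X Y : VField m M} {x : M} (hX : SmoothVFieldAt X x)
    (hY : SmoothVFieldAt Y x) : SmoothVFieldAt (⟦X, Y⟧) x := by
  have : IsManifold (𝓡 (2 * m)) (minSmoothness ℝ 2) M := isManifold_minSmoothness 2
  have : IsManifold (𝓡 (2 * m)) (((⊤ : ℕ∞) : WithTop ℕ∞) + 1) M := by
    change IsManifold (𝓡 (2 * m)) ∞ M; infer_instance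
  exact ContMDiffAt.mlieBracket_vectorField (m := ⊤) (n := ⊤) hX hY (by simp)

theorem mlieBracket_smul_right' {X Y : VField m M} {f : M → ℝ} {x : M}
    (hf : MDifferentiableAt (𝓡 (2 * m)) 𝓘(ℝ, ℝ) f x) (hY : SmoothVFieldAt Y x) :
    ⟦X, fun y => f y • Y y⟧ x = dfun f x (X x) • Y x + f x • ⟦X, Y⟧ x :=
  VectorField.mlieBracket_smul_right (V := X) hf hY.mdifferentiableAt

/-- The Lie bracket acts on functions as a commutator of derivations. -/
theorem dfun_mlieBracket {X Y : VField m M} {f : M → ℝ} {x : M}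
    (hf : ContMDiffAt (𝓡 (2 * m)) 𝓘(ℝ, ℝ) ∞ f x)
    (hX : SmoothVFieldAt X x) (hY : SmoothVFieldAt Y x) :
    dfun f x (⟦X, Y⟧ x) = dfun (fun y => dfun f y (Y y)) x (X x)
      - dfun (fun y => dfun f y (X y)) x (Y x) := by
  -- The Jacobi identity for `X`, `Y` and `f Z`, expanded by the Leibniz rule, reduces modulo that
  -- for `X`, `Y`, `Z` to the desired identity multiplied by `Z`. A field `Z` that does not vanish
  -- at `x` therefore suffices.
  have key : ∀ Z : VField m M, SmoothVFieldAt Z x → Z x ≠ 0 → dfun f x (⟦X, Y⟧ x)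
      = dfun (fun y => dfun f y (Y y)) x (X x) - dfun (fun y => dfun f y (X y)) x (Y x) := by
    intro Z hZ hZx
    have hfd := hf.mdifferentiableAt (by simp)
    have hfe : ∀ᶠ y in 𝓝 x, MDifferentiableAt (𝓡 (2 * m)) 𝓘(ℝ, ℝ) f y := by
      have := (contMDiffAt_iff_contMDiffAt_nhds (by simp)).1 (ContMDiffAt.of_le hf (m := 1) (by simp))
      filter_upwards [this] with y hy using hy.mdifferentiableAt (by simp)
    have hZe : ∀ᶠ y in 𝓝 x, MDifferentiableAt (𝓡 (2 * m)) (𝓡 (2 * m)).tangent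
        (fun y => (Z y : TangentBundle (𝓡 (2 * m)) M)) y := by
      have := (contMDiffAt_iff_contMDiffAt_nhds (by simp)).1 (ContMDiffAt.of_le hZ (m := 1) (by simp))
      filter_upwards [this] with y hy using hy.mdifferentiableAt (by simp)
    have hbr : ∀ W : VField m M, ∀ᶠ y in 𝓝 x, ⟦W, fun y => f y • Z y⟧ y
        = dfun f y (W y) • Z y + f y • ⟦W, Z⟧ y := by
      intro W
      filter_upwards [hfe, hZe] with y h1 h2
      exact VectorField.mlieBracket_smul_right (V := W) h1 h2
    have hexp : ∀ V W : VField m M, SmoothVFieldAt V x → SmoothVFieldAt W x →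
        ⟦V, ⟦W, fun y => f y • Z y⟧⟧ x = (dfun (fun y => dfun f y (W y)) x (V x) • Z x
          + dfun f x (W x) • ⟦V, Z⟧ x) + (dfun f x (V x) • ⟦W, Z⟧ x + f x • ⟦V, ⟦W, Z⟧⟧ x) := by
      intro V W hV hW
      rw [Filter.EventuallyEq.mlieBracket_vectorField_eq (Filter.EventuallyEq.refl _ V) (hbr W)]
      have h1 := hW.dfun_apply hf
      have h2 : ⟦V, fun y => dfun f y (W y) • Z y + f y • ⟦W, Z⟧ y⟧ x
          = ⟦V, fun y => dfun f y (W y) • Z y⟧ x + ⟦V, fun y => f y • ⟦W, Z⟧ y⟧ x :=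
        VectorField.mlieBracket_add_right (hZ.smul h1).mdifferentiableAt
          ((hW.mlieBracket hZ).smul hf).mdifferentiableAt
      rw [h2, mlieBracket_smul_right' (h1.mdifferentiableAt (by simp)) hZ,
        mlieBracket_smul_right' hfd (hW.mlieBracket hZ)]
    have : IsManifold (𝓡 (2 * m)) (minSmoothness ℝ 3) M := isManifold_minSmoothness 3
    have hmin : minSmoothness ℝ 2 ≤ ∞ := by
      rw [minSmoothness_of_isRCLikeNormedField]
      exact WithTop.coe_le_coe.2 (le_top : ((2 : ℕ) : ℕ∞) ≤ ⊤)
    have hJ : ∀ Z : VField m M, SmoothVFieldAt Z x →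
        ⟦X, ⟦Y, Z⟧⟧ x = ⟦⟦X, Y⟧, Z⟧ x + ⟦Y, ⟦X, Z⟧⟧ x := fun Z hZ =>
      VectorField.leibniz_identity_mlieBracket_apply (ContMDiffAt.of_le hX hmin)
        (ContMDiffAt.of_le hY hmin) (ContMDiffAt.of_le hZ hmin)
    have h1 := hJ _ (hZ.smul hf)
    rw [hexp X Y hX hY, hexp Y X hY hX, mlieBracket_smul_right' hfd hZ, hJ Z hZ] at h1
    have h2 : (dfun f x (⟦X, Y⟧ x) - (dfun (fun y => dfun f y (Y y)) x (X x)
        - dfun (fun y => dfun f y (X y)) x (Y x))) • Z x = 0 := by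
      linear_combination (norm := module) (-1 : ℝ) • h1
    rcases smul_eq_zero.mp h2 with h3 | h3
    · exact sub_eq_zero.mp h3
    · exact absurd h3 hZx
  -- `X` or `Y` serves as `Z` unless both vanish at `x`, in which case both sides are zero.
  by_cases hX0 : X x = 0
  · by_cases hY0 : Y x = 0
    · have h0 : ⟦X, Y⟧ x = 0 := VectorField.mlieBracketWithin_eq_zero_of_eq_zero hX0 hY0
      rw [h0, hX0, hY0]; simp
    · exact key Y hY hY0
  · exact key X hX hX0

end Calculus

/-! ### Integral curves on a compact manifold. -/

section Completeness

variable {m : ℕ} {M : Type*} [TopologicalSpace M] [ChartedSpace (Model m) M]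
  [IsManifold (𝓡 (2 * m)) ∞ M]

theorem hasMFDerivAt_extChartAt_symm (x : M) {z : Model m}
    (hz : z ∈ (extChartAt (𝓡 (2 * m)) x).target) :
    HasMFDerivAt 𝓘(ℝ, Model m) (𝓡 (2 * m)) (extChartAt (𝓡 (2 * m)) x).symm z
      (mfderiv 𝓘(ℝ, Model m) (𝓡 (2 * m)) (extChartAt (𝓡 (2 * m)) x).symm z) := by
  have h := mdifferentiableWithinAt_extChartAt_symm (I := 𝓡 (2 * m)) hz
  rw [ModelWithCorners.range_eq_univ, mdifferentiableWithinAt_univ] at h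
  exact h.hasMFDerivAt

theorem mfderiv_extChartAt_symm_apply (x : M) {z : Model m}
    (hz : z ∈ (extChartAt (𝓡 (2 * m)) x).target)
    (v : TangentSpace (𝓡 (2 * m)) ((extChartAt (𝓡 (2 * m)) x).symm z)) :
    mfderiv 𝓘(ℝ, Model m) (𝓡 (2 * m)) (extChartAt (𝓡 (2 * m)) x).symm z
      (mfderiv (𝓡 (2 * m)) 𝓘(ℝ, Model m) (extChartAt (𝓡 (2 * m)) x)
        ((extChartAt (𝓡 (2 * m)) x).symm z) v) = v := by
  have h := mfderivWithin_extChartAt_symm_comp_mfderiv_extChartAt (I := 𝓡 (2 * m)) hz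
  rw [ModelWithCorners.range_eq_univ, mfderivWithin_univ] at h
  exact DFunLike.congr_fun h v

theorem contMDiffAt_extChartAt_symm (x : M) {z : Model m}
    (hz : z ∈ (extChartAt (𝓡 (2 * m)) x).target) :
    ContMDiffAt 𝓘(ℝ, Model m) (𝓡 (2 * m)) ∞ (extChartAt (𝓡 (2 * m)) x).symm z :=
  (contMDiffOn_extChartAt_symm x).contMDiffAt ((isOpen_extChartAt_target x).mem_nhds hz)

/-- Integral curves of a smooth vector field exist for a locally uniform time. -/
theorem exists_uniform_isMIntegralCurveOn {v : VField m M} (hv : ∀ x, SmoothVFieldAt v x) (p : M) :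
    ∃ N ∈ 𝓝 p, ∃ ε > (0 : ℝ), ∀ y ∈ N, ∃ γ : ℝ → M, γ 0 = y ∧
      IsMIntegralCurveOn γ v (Ioo (-ε) ε) := by
  set ψ := extChartAt (𝓡 (2 * m)) p with hψ
  set w : Model m → Model m := fun z => mfderiv (𝓡 (2 * m)) 𝓘(ℝ, Model m) ψ (ψ.symm z) (v (ψ.symm z))
    with hw
  have hpt : ψ p ∈ ψ.target := mem_extChartAt_target p
  have hwd : ContDiffAt ℝ 1 w (ψ p) := by
    have h1 := smoothVFieldAt_iff.1 (hv p)
    have h2 : ContMDiffAt 𝓘(ℝ, Model m) 𝓘(ℝ, Model m) ∞ w (ψ p) := by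
      refine ContMDiffAt.comp_of_eq h1 (contMDiffAt_extChartAt_symm p hpt) ?_
      exact extChartAt_to_inv p
    exact h2.contDiffAt.of_le (by simp)
  obtain ⟨ε, hε, a, r, L, K, hr, hpl⟩ := IsPicardLindelof.of_contDiffAt_one hwd
  obtain ⟨α, hα, hαc⟩ := (hpl 0).exists_forall_mem_closedBall_eq_hasDerivWithinAt_continuousOn
  have hα0 : α (ψ p, 0) = ψ p := (hα (ψ p) (Metric.mem_closedBall_self r.2)).1
  have hcont : ContinuousAt α (ψ p, 0) := by
    refine hαc.continuousAt (prod_mem_nhds (Metric.closedBall_mem_nhds _ hr) ?_)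
    exact Icc_mem_nhds (by simpa using hε) (by simpa using hε)
  have htgt : ∀ᶠ q in 𝓝 (ψ p) ×ˢ 𝓝 (0 : ℝ), α q ∈ ψ.target := by
    rw [← nhds_prod_eq]
    exact hcont.eventually (by rw [hα0]; exact (isOpen_extChartAt_target p).mem_nhds hpt)
  obtain ⟨A, hA, B, hB, hAB⟩ := Filter.eventually_prod_iff.1 htgt
  obtain ⟨δ, hδ, hδB⟩ := Metric.eventually_nhds_iff.1 hB
  refine ⟨{y | y ∈ ψ.source ∧ A (ψ y) ∧ ψ y ∈ Metric.closedBall (ψ p) r}, ?_, min ε δ,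
    lt_min hε hδ, ?_⟩
  · have h1 := (continuousAt_extChartAt (I := 𝓡 (2 * m)) p).eventually
      (hA.and (Metric.closedBall_mem_nhds (ψ p) hr))
    filter_upwards [h1, extChartAt_source_mem_nhds (I := 𝓡 (2 * m)) p] with y h1 h2
    exact ⟨h2, h1⟩
  · rintro y ⟨hy1, hy2, hy3⟩
    obtain ⟨h0, hd⟩ := hα (ψ y) hy3
    refine ⟨fun t => ψ.symm (α (ψ y, t)), ?_, ?_⟩
    · change ψ.symm (α (ψ y, 0)) = y
      rw [h0, ψ.left_inv hy1]
    · intro t ht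
      have ht1 : |t| < δ := abs_lt.2 ⟨by linarith [ht.1, min_le_right ε δ], by linarith [ht.2, min_le_right ε δ]⟩
      have ht2 : 0 - ε < t := by linarith [ht.1, min_le_left ε δ]
      have ht3 : t < 0 + ε := by linarith [ht.2, min_le_left ε δ]
      have hz : α (ψ y, t) ∈ ψ.target := hAB hy2 (hδB (by simpa using ht1))
      have hd1 : HasDerivAt (fun t => α (ψ y, t)) (w (α (ψ y, t))) t :=
        (hd t ⟨ht2.le, ht3.le⟩).hasDerivAt (Icc_mem_nhds ht2 ht3)
      have hd2 : HasMFDerivAt 𝓘(ℝ, ℝ) 𝓘(ℝ, Model m) (fun t => α (ψ y, t)) t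
        ((1 : ℝ →L[ℝ] ℝ).smulRight (w (α (ψ y, t)))) := by
        exact hd1.hasFDerivAt.hasMFDerivAt
      have hd3 := (hasMFDerivAt_extChartAt_symm p hz).comp t hd2
      refine (hd3.congr_mfderiv ?_).hasMFDerivWithinAt
      ext1
      refine (ContinuousLinearMap.map_smul _ (1 : ℝ) _).trans ?_
      exact congrArg (fun v => (1 : ℝ) • v) (mfderiv_extChartAt_symm_apply p hz _)

/-- Compactness turns the locally uniform existence times into a single one, and curves that can
always be continued for a fixed time extend to the whole line. -/
theorem exists_isMIntegralCurve [CompactSpace M] [T2Space M] {v : VField m M}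
    (hv : ∀ x, SmoothVFieldAt v x) (x : M) :
    ∃ γ : ℝ → M, γ 0 = x ∧ IsMIntegralCurve γ v := by
  choose N hN ε hε h using exists_uniform_isMIntegralCurveOn hv
  obtain ⟨t, ht⟩ := CompactSpace.elim_nhds_subcover N hN
  have : IsManifold (𝓡 (2 * m)) 1 M := IsManifold.of_le (n := ∞) (by simp)
  have hne : t.Nonempty := by
    rcases t.eq_empty_or_nonempty with h0 | h0
    · subst h0
      have hx : x ∈ (⊤ : Set M) := mem_univ x
      rw [← ht] at hx
      simp at hx
    · exact h0
  refine exists_isMIntegralCurve_of_isMIntegralCurveOn (v := v) (ε := t.inf' hne ε)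
    (fun x => ContMDiffAt.of_le (hv x) (by simp)) ?_ ?_ x
  · rw [Finset.lt_inf'_iff]
    exact fun p _ => hε p
  · intro y
    have hy : y ∈ ⋃ x ∈ t, N x := ht ▸ mem_univ y
    simp only [mem_iUnion] at hy
    obtain ⟨p, hp, hy⟩ := hy
    obtain ⟨γ, h0, hγ⟩ := h p y hy
    have := Finset.inf'_le ε hp
    exact ⟨γ, h0, hγ.mono (Ioo_subset_Ioo (by linarith) this)⟩

theorem isMIntegralCurve_unique [T2Space M] {v : VField m M} (hv : ∀ x, SmoothVFieldAt v x)
    {γ γ' : ℝ → M} (hγ : IsMIntegralCurve γ v) (hγ' : IsMIntegralCurve γ' v) {t : ℝ}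
    (h : γ t = γ' t) : γ = γ' := by
  have : IsManifold (𝓡 (2 * m)) 1 M := IsManifold.of_le (n := ∞) (by simp)
  exact isMIntegralCurve_Ioo_eq_of_contMDiff_boundaryless (v := v)
    (fun x => ContMDiffAt.of_le (hv x) (by simp)) hγ hγ' h

theorem isMIntegralCurveOn_unique [T2Space M] {v : VField m M} (hv : ∀ x, SmoothVFieldAt v x)
    {γ γ' : ℝ → M} {a b : ℝ} (hγ : IsMIntegralCurveOn γ v (Ioo a b))
    (hγ' : IsMIntegralCurveOn γ' v (Ioo a b)) {t : ℝ} (ht : t ∈ Ioo a b)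
    (h : γ t = γ' t) : EqOn γ γ' (Ioo a b) := by
  have : IsManifold (𝓡 (2 * m)) 1 M := IsManifold.of_le (n := ∞) (by simp)
  exact isMIntegralCurveOn_Ioo_eqOn_of_contMDiff_boundaryless (v := v) ht
    (fun x => ContMDiffAt.of_le (hv x) (by simp)) hγ hγ' h

end Completeness

/-! ### Fixed points of torsion elements have codimension at least two. -/

theorem exists_range_comp_sub_id_eq_top {E : Type*} [NormedAddCommGroup E] [NormedSpace ℝ E]
    [FiniteDimensional ℝ E] {D A : E →L[ℝ] E} (hAA : ∀ v, A (A v) = -v)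
    (hDA : ∀ v, D (A v) = A (D v)) (hD : D ≠ ContinuousLinearMap.id ℝ E) :
    ∃ L : E →L[ℝ] ℝ × ℝ, (L ∘L (D - ContinuousLinearMap.id ℝ E)).range = ⊤ := by
  obtain ⟨v, hv⟩ : ∃ v, D v - v ≠ 0 := by
    by_contra! h
    exact hD (ContinuousLinearMap.ext fun v => sub_eq_zero.1 (h v))
  set w := D v - v with hw
  have hAw : D (A v) - A v = A w := by rw [hDA, hw, map_sub]
  -- The image of `D - id` is stable under the complex structure `A`, so with `w` it contains `A w`,
  -- which is independent of `w`. A left inverse of `(s, t) ↦ s w + t A w` is the required `L`.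
  let φ : ℝ × ℝ →ₗ[ℝ] E := (LinearMap.toSpanSingleton ℝ E w).coprod
    (LinearMap.toSpanSingleton ℝ E (A w))
  have hφ : LinearMap.ker φ = ⊥ := by
    rw [LinearMap.ker_eq_bot']
    rintro ⟨s, t⟩ hst
    replace hst : s • w + t • A w = 0 := by simpa [φ] using hst
    have h1 : s • A w - t • w = 0 := by
      have := congrArg A hst
      simp only [map_add, map_smul, hAA, map_zero] at this
      linear_combination (norm := module) this
    have h2 : (s * s + t * t) • w = 0 := by
      linear_combination (norm := module) s • hst - t • h1
    have h3 : s * s + t * t = 0 := (smul_eq_zero.1 h2).resolve_right hv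
    have h4 : s = 0 := by nlinarith [mul_self_nonneg s, mul_self_nonneg t]
    have h5 : t = 0 := by nlinarith [mul_self_nonneg s, mul_self_nonneg t]
    rw [h4, h5, Prod.mk_zero_zero]
  obtain ⟨L, hL⟩ := φ.exists_leftInverse_of_injective hφ
  refine ⟨LinearMap.toContinuousLinearMap L, ?_⟩
  rw [LinearMap.range_eq_top]
  rintro ⟨a, b⟩
  refine ⟨a • v + b • A v, ?_⟩
  have h6 : D (a • v + b • A v) - (a • v + b • A v) = φ (a, b) := by
    simp only [φ, map_add, map_smul, LinearMap.coprod_apply, LinearMap.toSpanSingleton_apply]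
    linear_combination (norm := module) b • hAw - a • hw
  have h7 := LinearMap.congr_fun hL (a, b)
  simp only [LinearMap.comp_apply, LinearMap.id_apply] at h7
  rw [← h6] at h7
  exact h7

section FixedPoints

variable {m : ℕ} {M : Type*} [TopologicalSpace M] [ChartedSpace (Model m) M]
  [IsManifold (𝓡 (2 * m)) ∞ M]

/-- A map read in the preferred chart at a fixed point. -/
def inChart (x : M) (F : M → M) : Model m → Model m := fun z =>
  extChartAt (𝓡 (2 * m)) x (F ((extChartAt (𝓡 (2 * m)) x).symm z))

theorem contDiffAt_inChart {x : M} {F : M → M}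
    (hF : ContMDiff (𝓡 (2 * m)) (𝓡 (2 * m)) ∞ F) (hx : F x = x) :
    ContDiffAt ℝ ∞ (inChart x F) (extChartAt (𝓡 (2 * m)) x x) := by
  rw [← contMDiffAt_iff_contDiffAt]
  have h1 : ContMDiffAt (𝓡 (2 * m)) 𝓘(ℝ, Model m) ∞ (extChartAt (𝓡 (2 * m)) x) x :=
    contMDiffAt_extChartAt
  refine ContMDiffAt.comp_of_eq (y := x) h1 (ContMDiffAt.comp_of_eq (y := x) (hF x)
    (contMDiffAt_extChartAt_symm x (mem_extChartAt_target x)) ?_) ?_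
  · exact extChartAt_to_inv x
  · simp only [extChartAt_to_inv, hx]

theorem hasStrictFDerivAt_inChart {x : M} {F : M → M} {D : Model m →L[ℝ] Model m}
    (hF : ContMDiff (𝓡 (2 * m)) (𝓡 (2 * m)) ∞ F) (hx : F x = x)
    (hD : HasMFDerivAt (𝓡 (2 * m)) (𝓡 (2 * m)) F x D) :
    HasStrictFDerivAt (inChart x F) D (extChartAt (𝓡 (2 * m)) x x) := by
  refine (contDiffAt_inChart hF hx).hasStrictFDerivAt' ?_ (by simp)
  have h2 : HasFDerivWithinAt (writtenInExtChartAt (𝓡 (2 * m)) (𝓡 (2 * m)) x F) D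
    (range (𝓡 (2 * m))) (extChartAt (𝓡 (2 * m)) x x) := hD.2
  rw [ModelWithCorners.range_eq_univ, hasFDerivWithinAt_univ] at h2
  unfold writtenInExtChartAt at h2
  rw [hx] at h2
  exact h2

/-- A fixed point is linearized in its own preferred chart, whereas thinness is measured in one
given chart; the submersive transition map carries the former information to the latter. -/
theorem exists_hasStrictFDerivAt_chart_comp_symm {p x : M} {z : Model m}
    (hz : z ∈ (extChartAt (𝓡 (2 * m)) p).target) (hx : (extChartAt (𝓡 (2 * m)) p).symm z = x) :
    ∃ T' : Model m →L[ℝ] Model m, HasStrictFDerivAt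
      (fun w => extChartAt (𝓡 (2 * m)) x ((extChartAt (𝓡 (2 * m)) p).symm w)) T' z ∧
      T'.range = ⊤ := by
  set ψ := extChartAt (𝓡 (2 * m)) p with hψ
  set χ := extChartAt (𝓡 (2 * m)) x with hχ
  set T : Model m → Model m := fun w => χ (ψ.symm w) with hT
  set S : Model m → Model m := fun w => ψ (χ.symm w) with hS
  have hTz : T z = χ x := by simp only [hT, hx]
  have hxs : x ∈ ψ.source := hx ▸ ψ.map_target hz
  have hSz : S (T z) = z := by
    rw [hTz]
    simp only [hS, hχ, extChartAt_to_inv]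
    rw [← hx, ψ.right_inv hz]
  have hTd : ContDiffAt ℝ ∞ T z := by
    rw [← contMDiffAt_iff_contDiffAt]
    have h1 : ContMDiffAt (𝓡 (2 * m)) 𝓘(ℝ, Model m) ∞ χ x := contMDiffAt_extChartAt
    exact ContMDiffAt.comp_of_eq (y := x) h1 (contMDiffAt_extChartAt_symm p hz) hx
  have hSd : ContDiffAt ℝ ∞ S (T z) := by
    rw [← contMDiffAt_iff_contDiffAt, hTz]
    have h1 : ContMDiffAt (𝓡 (2 * m)) 𝓘(ℝ, Model m) ∞ ψ x := contMDiffAt_extChartAt' (by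
      rwa [← extChartAt_source (𝓡 (2 * m))])
    exact ContMDiffAt.comp_of_eq (y := x) h1 (contMDiffAt_extChartAt_symm x
      (mem_extChartAt_target x)) (extChartAt_to_inv x)
  have hcomp : T ∘ S =ᶠ[𝓝 (T z)] id := by
    rw [hTz]
    have h1 : ContinuousAt χ.symm (χ x) := continuousAt_extChartAt_symm x
    rw [ContinuousAt, extChartAt_to_inv] at h1
    have h2 : ∀ᶠ y in 𝓝 x, y ∈ ψ.source := extChartAt_source_mem_nhds' hxs
    have h3 : ∀ᶠ w in 𝓝 (χ x), w ∈ χ.target := extChartAt_target_mem_nhds x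
    filter_upwards [h1.eventually h2, h3] with w hw hw'
    simp only [hT, hS, Function.comp, ψ.left_inv hw, χ.right_inv hw', id]
  refine ⟨fderiv ℝ T z, hTd.hasStrictFDerivAt (by simp), ?_⟩
  have hd1 : HasFDerivAt T (fderiv ℝ T z) (S (T z)) := by
    rw [hSz]
    exact (hTd.differentiableAt (by simp)).hasFDerivAt
  have hd2 := (hSd.differentiableAt (by simp)).hasFDerivAt
  have hd3 := (hd1.comp (T z) hd2).congr_of_eventuallyEq hcomp.symm
  have hd4 := hd3.unique (hasFDerivAt_id _)
  rw [LinearMap.range_eq_top]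
  intro v
  exact ⟨fderiv ℝ S (T z) v, DFunLike.congr_fun hd4 v⟩

variable [AddAction (Torus m) M] {Ω : BilinField m M} {μ : M → DualLieAlg m}

theorem hasMFDerivAt_nsmul_vadd (hM : IsSymplecticToric Ω μ) {g : Torus m} {x : M}
    (hx : g +ᵥ x = x)
    (hD : (actDeriv g x : Model m →L[ℝ] Model m) = ContinuousLinearMap.id ℝ (Model m)) (k : ℕ) :
    (k • g) +ᵥ x = x ∧ HasMFDerivAt (𝓡 (2 * m)) (𝓡 (2 * m)) (fun y : M => (k • g) +ᵥ y) x
      (ContinuousLinearMap.id ℝ (Model m)) := by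
  induction k with
  | zero =>
    refine ⟨by simp, ?_⟩
    have h0 : (fun y : M => ((0 : ℕ) • g) +ᵥ y) = id := by
      funext y
      simp
    rw [h0]
    exact hasMFDerivAt_id x
  | succ k ih =>
    obtain ⟨h1, h2⟩ := ih
    have h3 : (fun y : M => ((k + 1) • g) +ᵥ y) = (fun y : M => g +ᵥ y) ∘ (fun y : M => (k • g) +ᵥ y) := by
      funext y
      simp only [Function.comp]
      rw [vadd_vadd, add_smul, one_smul, add_comm]
    refine ⟨?_, ?_⟩
    · rw [add_smul, one_smul, ← vadd_vadd, hx, h1]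
    · rw [h3]
      have h4 : ∀ y : M, y = x → HasMFDerivAt (𝓡 (2 * m)) (𝓡 (2 * m)) (fun y : M => g +ᵥ y) y
          (ContinuousLinearMap.id ℝ (Model m)) := by
        rintro _ rfl
        rw [← hD]
        exact hM.hasMFDerivAt_vadd g _
      exact (h4 _ h1).comp x h2

/-- A torsion element of the torus that fixes `x` to first order acts trivially near `x`. -/
theorem eventually_vadd_eq (hM : IsSymplecticToric Ω μ) {g : Torus m} {x : M}
    (hx : g +ᵥ x = x)
    (hD : (actDeriv g x : Model m →L[ℝ] Model m) = ContinuousLinearMap.id ℝ (Model m))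
    {q : ℕ} (hq : 0 < q) (hg : q • g = 0) : ∀ᶠ y in 𝓝 x, g +ᵥ y = y := by
  set ψ := extChartAt (𝓡 (2 * m)) x with hψ
  -- Averaging over the cyclic group generated by `g`: in the chart, `h` is the sum of the iterates.
  -- Its derivative at the fixed point is `q` times the identity, so `h` is injective nearby. Since
  -- `q • g = 0`, the shifted sum telescopes and `h` takes the same value at `y` and `g +ᵥ y`.
  set h : Model m → Model m := fun z => ∑ k ∈ Finset.range q, inChart x (fun y : M => (k • g) +ᵥ y) z
    with hh
  have hstrict : HasStrictFDerivAt h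
      (∑ k ∈ Finset.range q, ContinuousLinearMap.id ℝ (Model m)) (ψ x) := by
    refine HasStrictFDerivAt.fun_sum fun k _ => ?_
    obtain ⟨h1, h2⟩ := hasMFDerivAt_nsmul_vadd hM hx hD k
    exact hasStrictFDerivAt_inChart (hM.contMDiff_vadd _) h1 h2
  have hq0 : (q : ℝ) ≠ 0 := by exact_mod_cast hq.ne'
  let e : Model m ≃L[ℝ] Model m := ContinuousLinearEquiv.smulLeft (Units.mk0 (q : ℝ) hq0)
  have hstrict' : HasStrictFDerivAt h (e : Model m →L[ℝ] Model m) (ψ x) := by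
    convert hstrict using 1
    ext v : 1
    simp [e, Finset.sum_const, Nat.cast_smul_eq_nsmul]
  have hcont : ContinuousAt (fun y : M => g +ᵥ y) x := (hM.contMDiff_vadd g).continuous.continuousAt
  rw [ContinuousAt, hx] at hcont
  have hsrc : ∀ᶠ y in 𝓝 x, y ∈ ψ.source := extChartAt_source_mem_nhds x
  have hsrc' : ∀ᶠ y in 𝓝 x, g +ᵥ y ∈ ψ.source :=
    hcont.eventually hsrc
  have hinv := hstrict'.eventually_left_inverse
  have hψc : ContinuousAt ψ x := continuousAt_extChartAt x
  have hinv1 := hψc.eventually hinv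
  have hinv2 : ∀ᶠ y in 𝓝 x, hstrict'.localInverse _ _ _ (h (ψ (g +ᵥ y))) = ψ (g +ᵥ y) :=
    hcont.eventually hinv1
  filter_upwards [hsrc, hsrc', hinv1, hinv2] with y h1 h2 h3 h4
  have h5 : h (ψ (g +ᵥ y)) = h (ψ y) := by
    simp only [hh, inChart, ← hψ, ψ.left_inv h1, ψ.left_inv h2]
    have h6 : ∀ k : ℕ, ψ ((k • g) +ᵥ (g +ᵥ y)) = ψ (((k + 1) • g) +ᵥ y) := fun k => by
      rw [vadd_vadd, add_smul, one_smul]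
    simp only [h6]
    have h7 := Finset.sum_range_succ (fun k : ℕ => ψ ((k • g) +ᵥ y)) q
    rw [Finset.sum_range_succ', hg, zero_smul] at h7
    exact add_right_cancel h7
  exact ψ.injOn h2 h1 (by rw [← h4, h5, h3])

/-- A nontrivial torsion element of the torus fixes no point to first order. -/
theorem IsSymplecticToric.actDeriv_ne_id [T2Space M] [ConnectedSpace M]
    (hM : IsSymplecticToric Ω μ) {g : Torus m} (hg0 : g ≠ 0) {q : ℕ} (hq : 0 < q)
    (hg : q • g = 0) {x : M} (hx : g +ᵥ x = x) :
    (actDeriv g x : Model m →L[ℝ] Model m) ≠ ContinuousLinearMap.id ℝ (Model m) := by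
  intro hD
  set S : Set M := {y | ∀ᶠ z in 𝓝 y, g +ᵥ z = z} with hS
  have hopen : IsOpen S := isOpen_iff_eventually.2 fun y hy => eventually_eventually_nhds.2 hy
  have hcontg : Continuous (fun y : M => g +ᵥ y) := (hM.contMDiff_vadd g).continuous
  have hfix : ∀ y ∈ S, g +ᵥ y = y := fun y hy => hy.self_of_nhds
  -- A limit point of `S` is fixed by `g`, and the differential there is the identity because the
  -- derivative in the chart is continuous; `eventually_vadd_eq` puts the point back in `S`.
  have hclosed : IsClosed S := by
    refine isClosed_of_closure_subset fun y hy => ?_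
    have hy0 : g +ᵥ y = y := (closure_minimal hfix (isClosed_eq hcontg continuous_id) hy)
    let A : Model m →L[ℝ] Model m := actDeriv g y
    suffices hA : A = ContinuousLinearMap.id ℝ (Model m) from eventually_vadd_eq hM hy0 hA hq hg
    set ψ := extChartAt (𝓡 (2 * m)) y with hψ
    set f : Model m → Model m := inChart y (fun z : M => g +ᵥ z) with hf
    have hsm : ContDiffAt ℝ ∞ f (ψ y) := contDiffAt_inChart (hM.contMDiff_vadd g) hy0
    have hst : HasStrictFDerivAt f A (ψ y) := by
      refine hasStrictFDerivAt_inChart (hM.contMDiff_vadd g) hy0 ?_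
      exact hM.hasMFDerivAt_vadd g y
    have hcd : ContinuousAt (fderiv ℝ f) (ψ y) :=
      (hsm.fderiv_right (m := 0) (by simp)).continuousAt
    have hψc : ContinuousAt ψ y := continuousAt_extChartAt y
    have hcd' : ContinuousAt (fun z => fderiv ℝ f (ψ z)) y :=
      ContinuousAt.comp (g := fderiv ℝ f) hcd hψc
    have hfr : ∃ᶠ z in 𝓝 y, fderiv ℝ f (ψ z) ∈ ({ContinuousLinearMap.id ℝ (Model m)} : Set _) := by
      have h1 : ∃ᶠ z in 𝓝 y, z ∈ S := mem_closure_iff_frequently.1 hy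
      have h2 : ∀ᶠ z in 𝓝 y, z ∈ ψ.source := extChartAt_source_mem_nhds y
      refine (h1.and_eventually h2).mono ?_
      rintro z ⟨hz, hzs⟩
      have h3 : f =ᶠ[𝓝 (ψ z)] id := by
        have h4 : ContinuousAt ψ.symm (ψ z) :=
          continuousAt_extChartAt_symm'' (ψ.map_source hzs)
        have h5 : ∀ᶠ w in 𝓝 (ψ z), w ∈ ψ.target := extChartAt_target_mem_nhds' (ψ.map_source hzs)
        rw [ContinuousAt, ψ.left_inv hzs] at h4
        filter_upwards [h4.eventually hz, h5] with w hw hw'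
        simp only [hf, inChart, ← hψ, hw, ψ.right_inv hw', id]
      rw [h3.fderiv_eq]
      exact fderiv_id
    have hmem : fderiv ℝ f (ψ y) = ContinuousLinearMap.id ℝ (Model m) := (isClosed_singleton (x := ContinuousLinearMap.id ℝ (Model m))).closure_subset
      (mem_closure_of_frequently_of_tendsto hfr hcd')
    exact hst.hasFDerivAt.fderiv.symm.trans hmem
  have huniv : S = univ := IsClopen.eq_univ ⟨hclosed, hopen⟩ ⟨x, eventually_vadd_eq hM hx hD hq hg⟩
  exact hg0 (hM.effective g fun y => hfix y (huniv ▸ mem_univ y))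

/-- Near a fixed point, the fixed point set of a nontrivial torsion element, read in a chart,
is thin. -/
theorem exists_nhds_isThin_fixedPoints [T2Space M] [ConnectedSpace M]
    (hM : IsSymplecticToric Ω μ) {J : EndField m M} (hJ : IsDGAK Ω μ univ J)
    {g : Torus m} (hg0 : g ≠ 0) {q : ℕ} (hq : 0 < q) (hg : q • g = 0) {p : M} {z : Model m}
    (hz : z ∈ (extChartAt (𝓡 (2 * m)) p).target)
    (hgz : g +ᵥ (extChartAt (𝓡 (2 * m)) p).symm z = (extChartAt (𝓡 (2 * m)) p).symm z) :
    ∃ N ∈ 𝓝 z, IsThin (N ∩ {w | g +ᵥ (extChartAt (𝓡 (2 * m)) p).symm w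
      = (extChartAt (𝓡 (2 * m)) p).symm w}) := by
  obtain ⟨x, hxz⟩ : ∃ x, (extChartAt (𝓡 (2 * m)) p).symm z = x := ⟨_, rfl⟩
  have hx : g +ᵥ x = x := by rwa [hxz] at hgz
  set D : Model m →L[ℝ] Model m := actDeriv g x with hD
  set A : Model m →L[ℝ] Model m := J x with hA
  have hDA : ∀ v, D (A v) = A (D v) := fun v => by
    have h1 : D (A v) = (J (g +ᵥ x) : Model m →L[ℝ] Model m) (D v) :=
      hJ.invariant g x (mem_univ x) v
    have h2 : (J (g +ᵥ x) : Model m →L[ℝ] Model m) = A :=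
      congrArg (fun y : M => (show Model m →L[ℝ] Model m from J y)) hx
    rw [h2] at h1
    exact h1
  -- Invariance of `J` makes `D` commute with `A`. Composing the displacement `g - id`, read in the
  -- chart, with `L` thus gives a submersion to the plane at the fixed point, which vanishes at all
  -- nearby fixed points.
  obtain ⟨L, hL⟩ := exists_range_comp_sub_id_eq_top (D := D) (A := A)
    (hJ.sq_eq_neg x (mem_univ x)) hDA (hM.actDeriv_ne_id hg0 hq hg hx)
  have hst : HasStrictFDerivAt (inChart x (fun y : M => g +ᵥ y)) D (extChartAt (𝓡 (2 * m)) x x) :=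
    hasStrictFDerivAt_inChart (hM.contMDiff_vadd g) hx (hM.hasMFDerivAt_vadd g x)
  have hst' : HasStrictFDerivAt (fun z => L (inChart x (fun y : M => g +ᵥ y) z - z))
      (L ∘L (D - ContinuousLinearMap.id ℝ (Model m))) (extChartAt (𝓡 (2 * m)) x x) :=
    L.hasStrictFDerivAt.comp _ (hst.sub (hasStrictFDerivAt_id _))
  obtain ⟨T', hT, hT'⟩ := exists_hasStrictFDerivAt_chart_comp_symm hz hxz
  have hst'' := HasStrictFDerivAt.comp z (by rw [hxz]; exact hst') hT
  obtain ⟨N, hN, hthin⟩ := exists_nhds_isThin_of_hasStrictFDerivAt hst'' (by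
      rw [LinearMap.range_eq_top] at hL hT' ⊢
      exact hL.comp hT')
    (by simp only [inChart, hxz, extChartAt_to_inv, hx, sub_self, map_zero])
  have h1 : ContinuousAt (extChartAt (𝓡 (2 * m)) p).symm z := continuousAt_extChartAt_symm'' hz
  rw [ContinuousAt, hxz] at h1
  have h2 : ∀ᶠ w in 𝓝 z, (extChartAt (𝓡 (2 * m)) p).symm w ∈ (extChartAt (𝓡 (2 * m)) x).source :=
    h1.eventually (extChartAt_source_mem_nhds x)
  refine ⟨N ∩ _, Filter.inter_mem hN h2, hthin.mono ?_⟩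
  rintro w ⟨⟨hw, hws⟩, hw'⟩
  refine ⟨hw, ?_⟩
  simp only [mem_ofPred_eq] at hws hw'
  simp only [inChart, (extChartAt (𝓡 (2 * m)) x).left_inv hws, hw', sub_self, map_zero]

end FixedPoints

/-! ### The points fixed by no torsion element form a dense connected set. -/

theorem isPreconnected_of_forall_nhds {M : Type*} [TopologicalSpace M] [PreconnectedSpace M]
    {A : Set M} (hA : Dense A) (h : ∀ p, ∃ U ∈ 𝓝 p, IsPreconnected (U ∩ A)) :
    IsPreconnected A := by
  rw [isPreconnected_iff_subset_of_disjoint]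
  intro u v hu hv hAuv hdisj
  -- A splitting of `A` is extended to `M`: the sets of points near which `A` lies in `u`,
  -- respectively in `v`, are open, cover `M` by local connectedness, and are disjoint by density.
  let S : Set M → Set M := fun w => {p | ∀ᶠ y in 𝓝 p, y ∈ A → y ∈ w}
  have hS : ∀ w, IsOpen (S w) := fun w =>
    isOpen_iff_eventually.2 fun y hy => eventually_eventually_nhds.2 hy
  have hcov : univ ⊆ S u ∪ S v := by
    intro p _
    obtain ⟨U, hU, hUc⟩ := h p
    have h1 := isPreconnected_iff_subset_of_disjoint.1 hUc u v hu hv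
      (inter_subset_right.trans hAuv) (by
        rw [← subset_empty_iff, ← hdisj]
        exact inter_subset_inter_left _ inter_subset_right)
    refine h1.imp (fun h2 => ?_) (fun h2 => ?_)
    all_goals
      filter_upwards [hU] with y hy hyA
      exact h2 ⟨hy, hyA⟩
  have hdis : univ ∩ (S u ∩ S v) = ∅ := by
    rw [univ_inter, eq_empty_iff_forall_notMem]
    rintro p ⟨h1, h2⟩
    obtain ⟨y, hy, hyA⟩ := mem_closure_iff_nhds.1 (hA p) _ (h1.and h2)
    have : y ∈ A ∩ (u ∩ v) := ⟨hyA, hy.1 hyA, hy.2 hyA⟩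
    rw [hdisj] at this
    exact this
  have := isPreconnected_iff_subset_of_disjoint.1 (isPreconnected_univ (α := M)) _ _ (hS u) (hS v)
    hcov hdis
  refine this.imp (fun h1 y hy => ?_) (fun h1 y hy => ?_)
  all_goals exact (h1 (mem_univ y)).self_of_nhds hy

theorem countable_torsion (m : ℕ) : {g : Torus m | ∃ q : ℕ, 0 < q ∧ q • g = 0}.Countable := by
  refine (countable_range fun r : ℕ × (Fin m → ℤ) =>
    torusExp (fun i => (r.2 i : ℝ) / r.1)).mono ?_
  rintro g ⟨q, hq, hg⟩
  obtain ⟨a, rfl⟩ := torusExp_surjective g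
  have hq0 : (q : ℝ) ≠ 0 := by exact_mod_cast hq.ne'
  have h1 : ∀ i, ∃ n : ℤ, (n : ℝ) = q * a i := fun i => by
    have h2 : ((q * a i : ℝ) : UnitAddCircle) = 0 := by
      have := congrFun hg i
      simpa [torusExp, ← nsmul_eq_mul] using this
    obtain ⟨n, hn⟩ := (AddCircle.coe_eq_zero_iff 1).1 h2
    exact ⟨n, by simpa using hn⟩
  choose n hn using h1
  refine ⟨(q, n), ?_⟩
  funext i
  simp only [hn]
  field_simp

section Regular

variable {m : ℕ} {M : Type*} [TopologicalSpace M] [ChartedSpace (Model m) M]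
  [AddAction (Torus m) M]

/-- The points that are fixed by no nontrivial torsion element of the torus. -/
def torsionRegular (m : ℕ) (M : Type*) [AddAction (Torus m) M] : Set M :=
  {x | ∀ g : Torus m, g ≠ 0 → (∃ q : ℕ, 0 < q ∧ q • g = 0) → g +ᵥ x ≠ x}

variable [IsManifold (𝓡 (2 * m)) ∞ M] {Ω : BilinField m M} {μ : M → DualLieAlg m}
  [T2Space M] [ConnectedSpace M]

/-- The complement is a union of fixed point sets of nontrivial torsion elements. Restricting to
torsion keeps this union countable, and thinness survives countable unions. -/
theorem isThin_compl_torsionRegular (hM : IsSymplecticToric Ω μ) {J : EndField m M}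
    (hJ : IsDGAK Ω μ univ J) (p : M) :
    IsThin {z | z ∈ (extChartAt (𝓡 (2 * m)) p).target ∧
      (extChartAt (𝓡 (2 * m)) p).symm z ∉ torsionRegular m M} := by
  set ψ := extChartAt (𝓡 (2 * m)) p with hψ
  refine (isThin_biUnion (s := {g : Torus m | ∃ q : ℕ, 0 < q ∧ q • g = 0} \ {0})
    (Z := fun g => {z | z ∈ ψ.target ∧ g +ᵥ ψ.symm z = ψ.symm z})
    ((countable_torsion m).mono sdiff_subset) ?_).mono ?_
  · rintro g ⟨⟨q, hq, hg⟩, hg0⟩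
    refine isThin_of_forall_nhds ?_
    rintro z ⟨hz, hgz⟩
    obtain ⟨N, hN, hthin⟩ := exists_nhds_isThin_fixedPoints hM hJ hg0 hq hg hz hgz
    exact ⟨N, hN, hthin.mono fun w hw => ⟨hw.1, hw.2.2⟩⟩
  · rintro z ⟨hz, hzr⟩
    simp only [torsionRegular, mem_ofPred_eq, not_forall, not_not] at hzr
    obtain ⟨g, hg0, hg, hgz⟩ := hzr
    simp only [mem_iUnion]
    exact ⟨g, ⟨hg, hg0⟩, hz, hgz⟩

/-- In chart balls, removing a thin set leaves a dense connected set, and density then globalizes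
connectedness. Dimension zero, where thin sets need not be small, is trivial because the torus is.
-/
theorem dense_and_isPreconnected_torsionRegular (hM : IsSymplecticToric Ω μ) {J : EndField m M}
    (hJ : IsDGAK Ω μ univ J) :
    Dense (torsionRegular m M) ∧ IsPreconnected (torsionRegular m M) := by
  rcases Nat.eq_zero_or_pos m with rfl | hm
  · have h1 : torsionRegular 0 M = univ :=
      eq_univ_of_forall fun x g hg => (hg (Subsingleton.elim _ _)).elim
    rw [h1]
    exact ⟨dense_univ, isPreconnected_univ⟩
  have hE : 0 < Module.finrank ℝ (Model m) := by simp [hm]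
  have key : ∀ (p : M), ∀ U ∈ 𝓝 p, ∃ W ∈ 𝓝 p, W ⊆ U ∧ (W ∩ torsionRegular m M).Nonempty ∧
      IsPreconnected (W ∩ torsionRegular m M) := by
    intro p U hU
    set ψ := extChartAt (𝓡 (2 * m)) p with hψ
    have hthin := isThin_compl_torsionRegular hM hJ p
    have h1 : ψ.symm ⁻¹' U ∩ ψ.target ∈ 𝓝 (ψ p) := by
      refine Filter.inter_mem ?_ (extChartAt_target_mem_nhds p)
      have h2 : ContinuousAt ψ.symm (ψ p) := continuousAt_extChartAt_symm p
      rw [ContinuousAt, extChartAt_to_inv] at h2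
      exact h2 hU
    obtain ⟨r, hr, hb⟩ := Metric.mem_nhds_iff.1 h1
    have himg : ψ.symm '' (Metric.ball (ψ p) r) ∩ torsionRegular m M = ψ.symm ''
        (Metric.ball (ψ p) r \ {z | z ∈ ψ.target ∧ ψ.symm z ∉ torsionRegular m M}) := by
      ext y
      constructor
      · rintro ⟨⟨z, hz, rfl⟩, hy⟩
        exact ⟨z, ⟨hz, fun h => h.2 hy⟩, rfl⟩
      · rintro ⟨z, ⟨hz, hz'⟩, rfl⟩
        refine ⟨⟨z, hz, rfl⟩, ?_⟩
        by_contra h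
        exact hz' ⟨(hb hz).2, h⟩
    refine ⟨ψ.symm '' (Metric.ball (ψ p) r), ?_, ?_, ?_, ?_⟩
    · have h3 : ∀ᶠ y in 𝓝 p, ψ y ∈ Metric.ball (ψ p) r :=
        (continuousAt_extChartAt (I := 𝓡 (2 * m)) p).eventually (Metric.ball_mem_nhds _ hr)
      have h4 : ∀ᶠ y in 𝓝 p, y ∈ ψ.source := extChartAt_source_mem_nhds p
      filter_upwards [h3, h4] with y hy hy'
      exact ⟨ψ y, hy, ψ.left_inv hy'⟩
    · rintro _ ⟨z, hz, rfl⟩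
      exact (hb hz).1
    · rw [himg]
      refine Nonempty.image _ ?_
      obtain ⟨z, hz, hz'⟩ := (hthin.dense_compl hE).inter_open_nonempty _ Metric.isOpen_ball
        ⟨ψ p, Metric.mem_ball_self hr⟩
      exact ⟨z, hz, hz'⟩
    · rw [himg]
      refine (hthin.isPreconnected_diff hE Metric.isOpen_ball (convex_ball _ _)).image _ ?_
      refine (continuousOn_extChartAt_symm (I := 𝓡 (2 * m)) p).mono fun z hz => (hb hz.1).2
  have hd : Dense (torsionRegular m M) := fun p => mem_closure_iff_nhds.2 fun U hU => by
    obtain ⟨W, -, hWU, hne, -⟩ := key p U hU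
    exact hne.mono (inter_subset_inter_left _ hWU)
  refine ⟨hd, isPreconnected_of_forall_nhds hd fun p => ?_⟩
  obtain ⟨W, hW, -, -, hc⟩ := key p univ Filter.univ_mem
  exact ⟨W, hW, hc⟩

end Regular

/-- Simultaneous approximation: a multiple of a nonzero vector is close to a nonzero integer
vector. -/
theorem exists_int_vector_near {m : ℕ} {a : LieAlg m} (ha : a ≠ 0) {ε : ℝ} (hε : 0 < ε) :
    ∃ (n : ℕ) (p : Fin m → ℤ), p ≠ 0 ∧ ‖(n : ℝ) • a - (fun i => (p i : ℝ))‖ < ε := by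
  set f : ℕ → LieAlg m := fun n i => Int.fract (n * a i) with hf
  have hmem : ∀ n, f n ∈ Icc (0 : LieAlg m) 1 := fun n =>
    ⟨fun i => Int.fract_nonneg _, fun i => (Int.fract_lt_one _).le⟩
  obtain ⟨l, -, φ, hφ, hl⟩ := isCompact_Icc.tendsto_subseq hmem
  -- The bound `‖a‖` excludes `p = 0`: otherwise `‖n • a‖ < ‖a‖` with `n ≥ 1`.
  have hδ : 0 < min ε ‖a‖ := lt_min hε (norm_pos_iff.2 ha)
  obtain ⟨N, hN⟩ := Metric.cauchySeq_iff.1 hl.cauchySeq _ hδ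
  have h1 := hN (N + 1) (by simp) N le_rfl
  have hlt : φ N < φ (N + 1) := hφ (Nat.lt_succ_self N)
  rw [dist_eq_norm] at h1
  set n := φ (N + 1) - φ N with hn
  set p : Fin m → ℤ := fun i => ⌊(φ (N + 1) : ℝ) * a i⌋ - ⌊(φ N : ℝ) * a i⌋ with hp
  have hnc : (n : ℝ) = φ (N + 1) - φ N := by rw [hn, Nat.cast_sub hlt.le]
  have h2 : (n : ℝ) • a - (fun i => (p i : ℝ)) = (f ∘ φ) (N + 1) - (f ∘ φ) N := by
    funext i
    simp only [hf, hp, hnc, Pi.sub_apply, Pi.smul_apply, smul_eq_mul, Function.comp, Int.cast_sub,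
      Int.fract]
    ring
  refine ⟨n, p, ?_, by rw [h2]; exact h1.trans_le (min_le_left _ _)⟩
  intro hp0
  have h3 : (fun i => (p i : ℝ)) = (0 : LieAlg m) := by
    funext i
    simp [hp0]
  rw [h3, sub_zero] at h2
  rw [← h2, norm_smul, Real.norm_natCast] at h1
  have h4 : (1 : ℝ) ≤ n := by exact_mod_cast Nat.sub_pos_of_lt hlt
  have h5 := h1.trans_le (min_le_right _ _)
  nlinarith [norm_nonneg a]

/-! ### Stabilizers and injectivity of the infinitesimal action. -/

section Stabilizer

variable {m : ℕ} {M : Type*} [TopologicalSpace M] [ChartedSpace (Model m) M]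
  [AddAction (Torus m) M] [IsManifold (𝓡 (2 * m)) ∞ M] {Ω : BilinField m M}
  {μ : M → DualLieAlg m} [T2Space M]

theorem IsSymplecticToric.torusExp_vadd_eq_of_fundField_eq_zero (hM : IsSymplecticToric Ω μ)
    {a : LieAlg m} {x : M} (h : orbitDeriv x a = 0) : torusExp a +ᵥ x = x := by
  have h0 : (fundField a : VField m M) x = 0 := (hM.fundField_eq a x).trans h
  have h1 := isMIntegralCurve_unique (t := 0) (smoothVFieldAt_fundField hM a)
    (hM.isMIntegralCurve_orbit x a) (isMIntegralCurve_const h0) (by simp)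
  simpa using congrFun h1 1

/-- Small elements of the stabilizer lie in its Lie algebra. With `P` a projection onto the kernel
of `D`, the map `w ↦ (w·x, P w)` has injective derivative at `0`, so near `0` it takes its value at
`0` only there. If `w` stabilizes `x`, so does `w - P w`, which is killed by `P`; hence `w = P w`.
-/
theorem IsSymplecticToric.exists_pos_forall_stabilizer (hM : IsSymplecticToric Ω μ) (x : M) :
    ∃ ε > 0, ∀ w : LieAlg m, ‖w‖ < ε → torusExp w +ᵥ x = x → orbitDeriv x w = 0 := by
  set D : LieAlg m →L[ℝ] Model m := orbitDeriv x with hD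
  obtain ⟨g, hg⟩ := (LinearMap.ker D.toLinearMap).subtype.exists_leftInverse_of_injective
    (by simp)
  set P : LieAlg m →L[ℝ] LieAlg m := LinearMap.toContinuousLinearMap
    ((LinearMap.ker D.toLinearMap).subtype ∘ₗ g) with hP
  have hPk : ∀ w, D (P w) = 0 := fun w => (g w).2
  have hPP : ∀ w, D w = 0 → P w = w := fun w hw =>
    congrArg Subtype.val (LinearMap.congr_fun hg ⟨w, hw⟩)
  set O : LieAlg m → M := fun w => torusExp w +ᵥ x with hO
  set f : LieAlg m → Model m := fun w => extChartAt (𝓡 (2 * m)) (O 0) (O w) with hf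
  have hfd : HasFDerivAt f D 0 := by
    have h1 : HasMFDerivAt 𝓘(ℝ, LieAlg m) (𝓡 (2 * m)) O 0 D :=
      ((hM.contMDiff_orbit x).mdifferentiable (by simp) 0).hasMFDerivAt
    have h2 : HasFDerivWithinAt (writtenInExtChartAt 𝓘(ℝ, LieAlg m) (𝓡 (2 * m)) 0 O) D
      (range 𝓘(ℝ, LieAlg m)) (extChartAt 𝓘(ℝ, LieAlg m) (0 : LieAlg m) 0) := h1.2
    rw [ModelWithCorners.range_eq_univ, hasFDerivWithinAt_univ] at h2
    exact h2
  have hGd : HasFDerivAt (fun w => (f w, P w)) (D.prod P) 0 := hfd.prodMk P.hasFDerivAt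
  have hinj : Function.Injective (D.prod P) := by
    rw [injective_iff_map_eq_zero]
    intro w hw
    rw [ContinuousLinearMap.prod_apply, Prod.mk_eq_zero] at hw
    rw [← hPP w hw.1, hw.2]
  obtain ⟨K, -, hK⟩ := (D.prod P).toLinearMap.exists_antilipschitzWith
    (LinearMap.ker_eq_bot.2 hinj)
  have hne := hGd.eventually_ne (c := (f 0, P 0)) ⟨K, hK⟩
  rw [eventually_nhdsWithin_iff] at hne
  have hcont : Filter.Tendsto (fun w => w - P w) (𝓝 0) (𝓝 0) := by
    have : Continuous fun w => w - P w := continuous_id.sub P.continuous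
    simpa using this.tendsto 0
  obtain ⟨ε, hε, hball⟩ := Metric.eventually_nhds_iff.1 (hcont.eventually hne)
  refine ⟨ε, hε, fun w hw hwx => ?_⟩
  have h3 := hball (y := w) (by simpa using hw)
  have h4 : w - P w = 0 := by
    by_contra h
    refine h3 h ?_
    have h5 : O (w - P w) = O 0 := by
      simp only [hO, sub_eq_add_neg, torusExp_add, torusExp_neg, add_comm (torusExp w),
        ← vadd_vadd, hwx, torusExp_zero, zero_vadd]
      rw [neg_vadd_eq_iff]
      exact (hM.torusExp_vadd_eq_of_fundField_eq_zero (hPk w)).symm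
    rw [Prod.mk.injEq]
    refine ⟨by simp only [hf, h5], ?_⟩
    rw [map_sub, hPP _ (hPk w), sub_self, map_zero]
  rw [sub_eq_zero.1 h4]
  exact hPk w

/-- At a point fixed by no torsion element the infinitesimal action is injective. -/
theorem IsSymplecticToric.orbitDeriv_injective_of_mem_torsionRegular (hM : IsSymplecticToric Ω μ)
    {x : M} (hx : x ∈ torsionRegular m M) : Function.Injective (orbitDeriv (m := m) x) := by
  rw [injective_iff_map_eq_zero]
  intro a ha
  by_contra ha0
  obtain ⟨ε, hε, hst⟩ := hM.exists_pos_forall_stabilizer x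
  obtain ⟨n, p, hp0, hnp⟩ := exists_int_vector_near ha0 hε
  set b : LieAlg m := fun i => (p i : ℝ) with hb
  have hexpb : torusExp b = 0 := by
    funext i
    simp only [torusExp, hb, Pi.zero_apply]
    exact (AddCircle.coe_eq_zero_iff 1).2 ⟨p i, by simp⟩
  have hna : orbitDeriv x ((n : ℝ) • a) = 0 := by rw [map_smul, ha, smul_zero]
  -- The integer vector `b` has trivial exponential, so the small vector `n • a - b` stabilizes `x`
  -- and lies in the kernel; therefore `b` does too.
  have h1 : orbitDeriv x ((n : ℝ) • a - b) = 0 := by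
    refine hst _ hnp ?_
    rw [sub_eq_add_neg, torusExp_add, torusExp_neg, hexpb, neg_zero, add_zero]
    exact hM.torusExp_vadd_eq_of_fundField_eq_zero hna
  have h2 : orbitDeriv x b = 0 := by
    rw [map_sub, hna, zero_sub, neg_eq_zero] at h1
    exact h1
  obtain ⟨i, hi⟩ := Function.ne_iff.1 hp0
  have hi' : (p i : ℝ) ≠ 0 := by exact_mod_cast hi
  -- Scaling `b` by `1 / (2 p i)` keeps it in the kernel and makes its `i`-th coordinate `1/2`, so
  -- its exponential is nontrivial, is torsion and fixes `x`.
  set c : LieAlg m := (1 / (2 * p i : ℝ)) • b with hc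
  have h3 : orbitDeriv x c = 0 := by rw [hc, map_smul, h2, smul_zero]
  refine hx (torusExp c) ?_ ⟨(2 * p i).natAbs, ?_, ?_⟩
    (hM.torusExp_vadd_eq_of_fundField_eq_zero h3)
  · intro h
    have h4 := congrFun h i
    simp only [torusExp, hc, hb, Pi.smul_apply, smul_eq_mul, Pi.zero_apply] at h4
    obtain ⟨k, hk⟩ := (AddCircle.coe_eq_zero_iff 1).1 h4
    have h5 : (2 * k : ℝ) = 1 := by
      rw [zsmul_one] at hk
      rw [hk]
      field_simp
    have h6 : 2 * k = 1 := by exact_mod_cast h5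
    omega
  · exact Int.natAbs_pos.2 (mul_ne_zero two_ne_zero hi)
  · have h4 : (2 * p i) • torusExp c = 0 := by
      rw [← hexpb]
      funext j
      simp only [torusExp, Pi.smul_apply, ← AddCircle.coe_zsmul]
      congr 1
      simp only [hc, hb, Pi.smul_apply, smul_eq_mul, zsmul_eq_mul]
      push_cast
      field_simp
    rcases Int.natAbs_eq (2 * p i) with h5 | h5
    · rw [h5, natCast_zsmul] at h4
      exact h4
    · rw [h5, neg_smul, natCast_zsmul, neg_eq_zero] at h4
      exact h4

end Stabilizer

theorem sum_apply_dualVec_apply {m : ℕ} (ξ : Module.Basis (Fin m) ℝ (LieAlg m)) (w : Fin m → ℝ)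
    (j : Fin m) : (∑ i, w i • dualVec ξ i) (ξ j) = w j := by
  rw [← evalAt_apply, map_sum]
  simp [evalAt_apply, dualVec_apply_basis]

/-- The linear coordinates on `𝔱*` given by a basis of `𝔱`. -/
def dualCoord {m : ℕ} (ξ : Module.Basis (Fin m) ℝ (LieAlg m)) :
    DualLieAlg m ≃L[ℝ] EuclideanSpace ℝ (Fin m) where
  toFun y := WithLp.toLp 2 fun j => y (ξ j)
  invFun w := ∑ i, w i • dualVec ξ i
  map_add' y z := by ext j; simp
  map_smul' c y := by ext j; simp
  left_inv y := sum_apply_smul_dualVec ξ y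
  right_inv w := by ext j; exact sum_apply_dualVec_apply ξ w j
  continuous_toFun := by
    refine (PiLp.continuous_toLp 2 _).comp (continuous_pi fun j => (evalAt (ξ j)).continuous)
  continuous_invFun := by
    refine continuous_finsetSum _ fun i _ => ?_
    exact (EuclideanSpace.proj (𝕜 := ℝ) i).continuous.smul continuous_const

theorem dualCoord_apply {m : ℕ} (ξ : Module.Basis (Fin m) ℝ (LieAlg m)) (y : DualLieAlg m)
    (j : Fin m) : dualCoord ξ y j = y (ξ j) := rfl

/-! ### The moment map at points with injective infinitesimal action. -/

section FreePart

variable {m : ℕ} {M : Type*} [TopologicalSpace M] [ChartedSpace (Model m) M]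
  [AddAction (Torus m) M] [IsManifold (𝓡 (2 * m)) ∞ M] {Ω : BilinField m M}
  {μ : M → DualLieAlg m}

theorem IsSymplecticToric.isOpen_openPart (hM : IsSymplecticToric Ω μ) : IsOpen (openPart μ) :=
  isOpen_interior.preimage hM.smooth_moment.continuous

theorem IsSymplecticToric.vadd_mem_openPart (hM : IsSymplecticToric Ω μ) (g : Torus m) {x : M} :
    g +ᵥ x ∈ openPart μ ↔ x ∈ openPart μ := by
  simp only [openPart, mem_preimage, hM.invariant_moment]

theorem IsSymplecticToric.contMDiff_moment_apply (hM : IsSymplecticToric Ω μ) (a : LieAlg m) :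
    ContMDiff (𝓡 (2 * m)) 𝓘(ℝ, ℝ) ∞ (fun y => μ y a) :=
  (evalAt a).contMDiff.comp hM.smooth_moment

/-- The differential of the moment map. -/
def momentDeriv (μ : M → DualLieAlg m) (x : M) : Model m →L[ℝ] DualLieAlg m :=
  mfderiv (𝓡 (2 * m)) 𝓘(ℝ, DualLieAlg m) μ x

theorem IsSymplecticToric.hasMFDerivAt_moment (hM : IsSymplecticToric Ω μ) (x : M) :
    HasMFDerivAt (𝓡 (2 * m)) 𝓘(ℝ, DualLieAlg m) μ x (momentDeriv μ x) :=
  (hM.smooth_moment.mdifferentiable (by simp) x).hasMFDerivAt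

theorem IsSymplecticToric.dfun_moment (hM : IsSymplecticToric Ω μ) (a : LieAlg m) (x : M)
    (v : Model m) : dfun (fun y => μ y a) x v = momentDeriv μ x v a := by
  have h1 : HasMFDerivAt 𝓘(ℝ, DualLieAlg m) 𝓘(ℝ, ℝ) (evalAt a) (μ x) (evalAt a) :=
    (evalAt a).hasFDerivAt.hasMFDerivAt
  exact DFunLike.congr_fun (h1.comp x (hM.hasMFDerivAt_moment x)).mfderiv v

/-- Through `Ω`, the differential of `μ` is minus the transpose of the infinitesimal action: a
linear form vanishing on its range yields an element of `𝔱` whose field is `Ω`-orthogonal to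
everything at `x`. Injectivity therefore makes `dμ` onto, and `μ` is open at `x`. -/
theorem IsSymplecticToric.mem_openPart_of_injective (hM : IsSymplecticToric Ω μ)
    {x : M} (hx : Function.Injective (orbitDeriv (m := m) x)) : x ∈ openPart μ := by
  let ξ : Module.Basis (Fin m) ℝ (LieAlg m) := Pi.basisFun ℝ (Fin m)
  set F : M → EuclideanSpace ℝ (Fin m) := fun y => dualCoord ξ (μ y) with hF
  have hFs : ContMDiff (𝓡 (2 * m)) 𝓘(ℝ, EuclideanSpace ℝ (Fin m)) ∞ F :=
    (dualCoord ξ).toContinuousLinearMap.contMDiff.comp hM.smooth_moment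
  set D : Model m →L[ℝ] EuclideanSpace ℝ (Fin m) :=
    (dualCoord ξ).toContinuousLinearMap ∘L momentDeriv μ x with hD
  have hFd : HasMFDerivAt (𝓡 (2 * m)) 𝓘(ℝ, EuclideanSpace ℝ (Fin m)) F x D := by
    have h1 : HasMFDerivAt 𝓘(ℝ, DualLieAlg m) 𝓘(ℝ, EuclideanSpace ℝ (Fin m)) (dualCoord ξ) (μ x)
      (dualCoord ξ).toContinuousLinearMap := (dualCoord ξ).hasFDerivAt.hasMFDerivAt
    exact h1.comp x (hM.hasMFDerivAt_moment x)
  have hsurj : LinearMap.range D.toLinearMap = ⊤ := by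
    by_contra hne
    obtain ⟨f, hf0, hf⟩ := Submodule.exists_le_ker_of_lt_top _ (lt_top_iff_ne_top.2 hne)
    let b : Fin m → ℝ := fun j => f (EuclideanSpace.single j 1)
    have hfw : ∀ w : EuclideanSpace ℝ (Fin m), f w = ∑ j, b j * w j := fun w => by
      conv_lhs => rw [← (EuclideanSpace.basisFun (Fin m) ℝ).sum_repr w]
      simp [b, mul_comm]
    have h0 : fundField (∑ j, b j • ξ j) x = 0 := by
      refine hM.symplectic.nondegenerate x _ fun v => ?_
      have h1 := hM.hamiltonian (∑ j, b j • ξ j) x v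
      rw [h1, neg_eq_zero]
      refine (hM.dfun_moment _ x v).trans ?_
      have h4 : f (D v) = 0 := hf ⟨v, rfl⟩
      rw [hfw] at h4
      rw [map_sum, ← h4]
      exact Finset.sum_congr rfl fun j _ => map_smul _ _ _
    have h5 : orbitDeriv x (∑ j, b j • ξ j) = 0 := (hM.fundField_eq _ x).symm.trans h0
    have h6 := (injective_iff_map_eq_zero _).1 hx _ h5
    have h7 := Fintype.linearIndependent_iff.1 ξ.linearIndependent b h6
    refine hf0 (LinearMap.ext fun w => ?_)
    simp [hfw, h7]
  set ψ := extChartAt (𝓡 (2 * m)) x with hψ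
  have hG : HasStrictFDerivAt (fun z => F (ψ.symm z)) D (ψ x) := by
    have h1 : ContDiffAt ℝ ∞ (fun z => F (ψ.symm z)) (ψ x) := by
      rw [← contMDiffAt_iff_contDiffAt]
      exact ContMDiffAt.comp_of_eq (g := F) (y := x) (hFs x)
        (contMDiffAt_extChartAt_symm x (mem_extChartAt_target x)) (extChartAt_to_inv x)
    refine h1.hasStrictFDerivAt' ?_ (by simp)
    have h2 : HasFDerivWithinAt (writtenInExtChartAt (𝓡 (2 * m)) 𝓘(ℝ, EuclideanSpace ℝ (Fin m)) x F)
      D (range (𝓡 (2 * m))) (extChartAt (𝓡 (2 * m)) x x) := hFd.2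
    rw [ModelWithCorners.range_eq_univ, hasFDerivWithinAt_univ] at h2
    exact h2
  have hmap := hG.map_nhds_eq_of_surj hsurj
  have hr : range F ∈ 𝓝 (F x) := by
    have h1 : F (ψ.symm (ψ x)) = F x := by simp only [hψ, extChartAt_to_inv]
    rw [← h1, ← hmap]
    refine Filter.mem_map.2 (Filter.univ_mem' fun z => ⟨_, rfl⟩)
  have hr' : range μ ∈ 𝓝 (μ x) := by
    have h1 : range μ = dualCoord ξ ⁻¹' range F := by
      ext y
      constructor
      · rintro ⟨z, rfl⟩
        exact ⟨z, rfl⟩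
      · rintro ⟨z, hz⟩
        exact ⟨z, (dualCoord ξ).injective hz⟩
    rw [h1]
    exact (dualCoord ξ).continuous.continuousAt hr
  exact mem_interior_iff_mem_nhds.2 hr'

theorem IsHolCoord.orbitDeriv_injective (hM : IsSymplecticToric Ω μ)
    {ξ : Module.Basis (Fin m) ℝ (LieAlg m)} {J : EndField m M} {V : Set M} {u t : Fin m → M → ℝ}
    (h : IsHolCoord μ ξ J V u t) {x : M} (hx : x ∈ V) :
    Function.Injective (orbitDeriv (m := m) x) := by
  rw [injective_iff_map_eq_zero]
  intro a ha
  have h1 : ∀ i, ξ.repr a i = 0 := fun i => by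
    have h2 : dfun (t i) x (orbitDeriv x (∑ j, ξ.repr a j • ξ j)) = 0 := by
      rw [ξ.sum_repr, ha]
      exact map_zero _
    have h3 : dfun (t i) x (fundField (∑ j, ξ.repr a j • ξ j) x) = 0 :=
      (congrArg _ (hM.fundField_eq _ x)).trans h2
    rw [hM.fundField_sum_smul, map_sum] at h3
    simpa [h.dt_K x hx] using h3
  rw [← ξ.sum_repr a]
  simp [h1]

/-- `M°` lies between the connected set of points with no torsion stabilizer and the closure of that
set, which is all of `M`. -/
theorem IsSymplecticToric.isPreconnected_openPart [T2Space M] [ConnectedSpace M]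
    (hM : IsSymplecticToric Ω μ) {J : EndField m M} (hJ : IsDGAK Ω μ univ J) :
    IsPreconnected (openPart μ) := by
  obtain ⟨hd, hc⟩ := dense_and_isPreconnected_torsionRegular hM hJ
  refine hc.subset_closure (fun x hx => ?_) (by rw [hd.closure_eq]; exact subset_univ _)
  exact hM.mem_openPart_of_injective (hM.orbitDeriv_injective_of_mem_torsionRegular hx)

end FreePart

/-! ### The flows of the fields `-J a^♯`. -/

section GradientFlow

variable {m : ℕ} {M : Type*} [TopologicalSpace M] [ChartedSpace (Model m) M]
  [AddAction (Torus m) M]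

/-- The vector field `- J a^♯`, for `a ∈ 𝔱`. -/
def gradField (J : EndField m M) (a : LieAlg m) : VField m M := fun y => - J y (fundField a y)

/-- The time-one flow of the vector field `- J a^♯`. -/
def gradExp (J : EndField m M) (x : M) (a : LieAlg m) : M :=
  open Classical in
  if h : ∃ γ : ℝ → M, γ 0 = x ∧ IsMIntegralCurve γ (gradField J a) then h.choose 1 else x

variable [IsManifold (𝓡 (2 * m)) ∞ M] {Ω : BilinField m M} {μ : M → DualLieAlg m}
  {J : EndField m M}

/-- The linear map `a ↦ - J a^♯` at a point. -/
def gradMap (J : EndField m M) (y : M) : LieAlg m →L[ℝ] Model m :=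
  - ((J y : Model m →L[ℝ] Model m) ∘L orbitDeriv y)

theorem IsSymplecticToric.gradField_eq (hM : IsSymplecticToric Ω μ) (a : LieAlg m) (y : M) :
    gradField J a y = gradMap J y a := by
  refine congrArg (fun v : Model m => - (J y : Model m →L[ℝ] Model m) v) ?_
  exact hM.fundField_eq a y

theorem IsSymplecticToric.gradField_smul (hM : IsSymplecticToric Ω μ) (s : ℝ) (a : LieAlg m) :
    (gradField J (s • a) : VField m M) = s • gradField J a := by
  funext y
  refine (hM.gradField_eq _ y).trans ?_
  refine (map_smul (gradMap J y) s a).trans ?_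
  exact congrArg (fun v : Model m => s • v) (hM.gradField_eq a y).symm

theorem IsSymplecticToric.smoothVFieldAt_gradField (hM : IsSymplecticToric Ω μ)
    (hJ : IsDGAK Ω μ univ J) (a : LieAlg m) (y : M) : SmoothVFieldAt (gradField J a) y :=
  ((smoothVFieldAt_fundField hM a y).clm_apply hJ.smooth Filter.univ_mem).neg

variable [T2Space M]

/-- Rescaling time by `s` turns an integral curve for `a` into one for `s • a`, so the time-one map
records all integral curves. -/
theorem IsSymplecticToric.eq_gradExp_of_isMIntegralCurve (hM : IsSymplecticToric Ω μ)
    (hJ : IsDGAK Ω μ univ J) {a : LieAlg m} {γ : ℝ → M}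
    (hγ : IsMIntegralCurve γ (gradField J a)) (s : ℝ) : γ s = gradExp J (γ 0) (s • a) := by
  have h1 : IsMIntegralCurve (γ ∘ (· * s)) (gradField J (s • a)) := by
    rw [hM.gradField_smul]
    exact hγ.comp_mul s
  have h : ∃ γ' : ℝ → M, γ' 0 = γ 0 ∧ IsMIntegralCurve γ' (gradField J (s • a)) :=
    ⟨_, by simp, h1⟩
  rw [gradExp, dif_pos h]
  have h2 := isMIntegralCurve_unique (t := 0) (hM.smoothVFieldAt_gradField hJ (s • a))
    h.choose_spec.2 h1 (by simp [h.choose_spec.1])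
  rw [h2]
  simp

variable [CompactSpace M]

theorem IsSymplecticToric.isMIntegralCurve_gradExp (hM : IsSymplecticToric Ω μ)
    (hJ : IsDGAK Ω μ univ J) (x : M) (a : LieAlg m) :
    IsMIntegralCurve (fun s : ℝ => gradExp J x (s • a)) (gradField J a) := by
  obtain ⟨γ, h0, hγ⟩ := exists_isMIntegralCurve (hM.smoothVFieldAt_gradField hJ a) x
  have : γ = fun s : ℝ => gradExp J x (s • a) := by
    funext s
    rw [← h0]
    exact hM.eq_gradExp_of_isMIntegralCurve hJ hγ s
  rwa [← this]

theorem IsSymplecticToric.gradExp_zero (hM : IsSymplecticToric Ω μ)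
    (hJ : IsDGAK Ω μ univ J) (x : M) : gradExp J x 0 = x := by
  obtain ⟨γ, h0, hγ⟩ := exists_isMIntegralCurve (hM.smoothVFieldAt_gradField hJ 0) x
  have := hM.eq_gradExp_of_isMIntegralCurve hJ hγ 0
  rw [h0, smul_zero] at this
  exact this.symm

theorem IsSymplecticToric.gradExp_add_smul (hM : IsSymplecticToric Ω μ)
    (hJ : IsDGAK Ω μ univ J) (x : M) (a : LieAlg m) (r s : ℝ) :
    gradExp J x ((r + s) • a) = gradExp J (gradExp J x (r • a)) (s • a) := by
  have h1 := (hM.isMIntegralCurve_gradExp hJ x a).comp_add r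
  have h2 := hM.eq_gradExp_of_isMIntegralCurve hJ h1 s
  simpa [add_comm] using h2

theorem IsSymplecticToric.gradExp_vadd (hM : IsSymplecticToric Ω μ)
    (hJ : IsDGAK Ω μ univ J) (g : Torus m) (x : M) (a : LieAlg m) :
    gradExp J (g +ᵥ x) a = g +ᵥ gradExp J x a := by
  have h1 : IsMIntegralCurve (fun s : ℝ => g +ᵥ gradExp J x (s • a)) (gradField J a) := by
    intro s
    have h2 := hM.isMIntegralCurve_gradExp hJ x a s
    have h3 := (hM.hasMFDerivAt_vadd g (gradExp J x (s • a))).comp s h2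
    refine h3.congr_mfderiv ?_
    ext1
    set y := gradExp J x (s • a)
    have h4 : actDeriv g y (gradField J a y) = gradField J a (g +ᵥ y) := by
      refine (map_neg (actDeriv g y) _).trans ?_
      refine congrArg Neg.neg ?_
      refine (hJ.invariant g y (mem_univ y) _).trans ?_
      exact congrArg _ (hM.actDeriv_fundField g y a)
    refine (map_smul (actDeriv g y) (1 : ℝ) _).trans ?_
    exact congrArg (fun v : Model m => (1 : ℝ) • v) h4
  have h5 := hM.eq_gradExp_of_isMIntegralCurve hJ h1 1
  simpa [hM.gradExp_zero hJ] using h5.symm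

/-- The flow is invertible and commutes with the torus, so a one-parameter group that fixes the
endpoint also fixes `x`. -/
theorem IsSymplecticToric.injective_orbitDeriv_gradExp (hM : IsSymplecticToric Ω μ)
    (hJ : IsDGAK Ω μ univ J) {x : M} (hx : Function.Injective (orbitDeriv (m := m) x))
    (a : LieAlg m) : Function.Injective (orbitDeriv (m := m) (gradExp J x a)) := by
  rw [injective_iff_map_eq_zero] at hx ⊢
  intro b hb
  refine hx b ?_
  have h1 : ∀ s : ℝ, torusExp (s • b) +ᵥ x = x := fun s => by
    have h2 : torusExp (s • b) +ᵥ gradExp J x a = gradExp J x a :=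
      hM.torusExp_vadd_eq_of_fundField_eq_zero (by rw [map_smul, hb, smul_zero])
    rw [← hM.gradExp_vadd hJ] at h2
    have h3 := congrArg (fun y => gradExp J y ((-1 : ℝ) • a)) h2
    have h4 : ∀ z, gradExp J (gradExp J z a) ((-1 : ℝ) • a) = z := fun z => by
      have := hM.gradExp_add_smul hJ z a 1 (-1)
      rw [one_smul] at this
      rw [← this]
      simp [hM.gradExp_zero hJ]
    simpa only [h4] using h3
  refine (hM.fundField_eq b x).symm.trans ?_
  have h5 : (fun s : ℝ => torusExp (s • b) +ᵥ x) = fun _ => x := funext h1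
  unfold fundField
  rw [h5, mfderiv_const]
  rfl

/-- The margin `δ` allows uniqueness of integral curves, which is applied on open intervals, to
compare the endpoints `0` and `1`. -/
theorem exists_gt_forall_smul_mem_ball {E : Type*} [NormedAddCommGroup E] [NormedSpace ℝ E]
    {c w d : E} {ε : ℝ} (hw : w ∈ Metric.ball c ε) (hwd : w + d ∈ Metric.ball c ε) :
    ∃ δ : ℝ, 0 < δ ∧ ∀ s ∈ Ioo (-δ) (1 + δ), w + s • d ∈ Metric.ball c ε := by
  have hcont : Continuous fun s : ℝ => w + s • d := by fun_prop
  have hopen : IsOpen {s : ℝ | w + s • d ∈ Metric.ball c ε} := Metric.isOpen_ball.preimage hcont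
  obtain ⟨δ₁, h1, h1'⟩ := Metric.isOpen_iff.1 hopen 0 (by simpa using hw)
  obtain ⟨δ₂, h2, h2'⟩ := Metric.isOpen_iff.1 hopen 1 (by simpa using hwd)
  refine ⟨min δ₁ δ₂, lt_min h1 h2, fun s hs => ?_⟩
  by_cases h0 : s < 0
  · refine h1' ?_
    rw [Metric.mem_ball, Real.dist_eq, sub_zero, abs_lt]
    exact ⟨by linarith [hs.1, min_le_left δ₁ δ₂], by linarith⟩
  by_cases h3 : 1 < s
  · refine h2' ?_
    rw [Metric.mem_ball, Real.dist_eq, abs_lt]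
    exact ⟨by linarith, by linarith [hs.2, min_le_right δ₁ δ₂]⟩
  · have := (convex_ball c ε).add_smul_sub_mem hw hwd (t := s) ⟨not_lt.1 h0, not_lt.1 h3⟩
    simpa using this

end GradientFlow

/-! ### Flat charts and additivity of the gradient flows. -/

section FlatChart

variable {m : ℕ} {M : Type*} [TopologicalSpace M] [ChartedSpace (Model m) M]
  [AddAction (Torus m) M] [IsManifold (𝓡 (2 * m)) ∞ M] {Ω : BilinField m M}
  {μ : M → DualLieAlg m} {J : EndField m M}

/-- `κ` parametrizes a neighbourhood of `p` by a ball of radius `ε` such that its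
coordinate fields are `- J a^♯` and `b^♯`. -/
structure IsFlatChart (J : EndField m M) (p : M) (κ : LieAlg m × LieAlg m → M) (ε : ℝ) : Prop where
  pos : 0 < ε
  map_zero : κ 0 = p
  smooth : ∀ w ∈ Metric.ball (0 : LieAlg m × LieAlg m) ε,
    ContMDiffAt 𝓘(ℝ, LieAlg m × LieAlg m) (𝓡 (2 * m)) ∞ κ w
  hasMFDerivAt : ∀ w ∈ Metric.ball (0 : LieAlg m × LieAlg m) ε,
    HasMFDerivAt 𝓘(ℝ, LieAlg m × LieAlg m) (𝓡 (2 * m)) κ w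
      ((gradMap J (κ w)).coprod (orbitDeriv (κ w)) : LieAlg m × LieAlg m →L[ℝ] Model m)
  eventually : ∀ᶠ y in 𝓝 p, ∃ w ∈ Metric.ball (0 : LieAlg m × LieAlg m) ε, κ w = y

/-- In a flat chart, straight segments are integral curves of the constant combinations of the
coordinate fields, so uniqueness identifies them with the global curve. -/
theorem IsFlatChart.eq_of_isMIntegralCurve [T2Space M] {p : M} {κ : LieAlg m × LieAlg m → M}
    {ε : ℝ} (h : IsFlatChart J p κ ε) {v : VField m M} (hv : ∀ x, SmoothVFieldAt v x)
    {w d : LieAlg m × LieAlg m} (hw : w ∈ Metric.ball (0 : LieAlg m × LieAlg m) ε)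
    (hwd : w + d ∈ Metric.ball (0 : LieAlg m × LieAlg m) ε)
    (hd : ∀ y, v y = (gradMap J y).coprod (orbitDeriv y) d) {γ : ℝ → M}
    (hγ : IsMIntegralCurve γ v) (hγ0 : γ 0 = κ w) : κ (w + d) = γ 1 := by
  obtain ⟨δ, hδ, hball⟩ := exists_gt_forall_smul_mem_ball hw hwd
  have h1 : IsMIntegralCurveOn (fun s : ℝ => κ (w + s • d)) v (Ioo (-δ) (1 + δ)) := by
    intro s hs
    have h2 : HasMFDerivAt 𝓘(ℝ, ℝ) 𝓘(ℝ, LieAlg m × LieAlg m) (fun s : ℝ => w + s • d) s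
        ((1 : ℝ →L[ℝ] ℝ).smulRight d) := by
      refine HasFDerivAt.hasMFDerivAt ?_
      exact ((hasFDerivAt_id s).smul_const d).const_add w
    have h3 := (h.hasMFDerivAt _ (hball s hs)).comp s h2
    refine HasMFDerivAt.hasMFDerivWithinAt ?_
    refine h3.congr_mfderiv ?_
    ext1
    refine (map_smul ((gradMap J (κ (w + s • d))).coprod (orbitDeriv (κ (w + s • d)))) (1 : ℝ) d).trans ?_
    exact congrArg (fun v : Model m => (1 : ℝ) • v) (hd _).symm
  have h2 := isMIntegralCurveOn_unique hv h1 (hγ.isMIntegralCurveOn _) (t := 0)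
    ⟨by linarith, by linarith⟩ (by simp [hγ0])
  simpa using h2 (show (1 : ℝ) ∈ Ioo (-δ) (1 + δ) from ⟨by linarith, by linarith⟩)

theorem IsFlatChart.apply_add_right [T2Space M] {p : M} {κ : LieAlg m × LieAlg m → M} {ε : ℝ}
    (h : IsFlatChart J p κ ε) (hM : IsSymplecticToric Ω μ)
    {w : LieAlg m × LieAlg m} {b : LieAlg m} (hw : w ∈ Metric.ball (0 : LieAlg m × LieAlg m) ε)
    (hwd : w + (0, b) ∈ Metric.ball (0 : LieAlg m × LieAlg m) ε) :
    κ (w + (0, b)) = torusExp b +ᵥ κ w := by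
  have hd : ∀ y : M, orbitDeriv y b = (gradMap J y).coprod (orbitDeriv y) (0, b) := by simp
  have := h.eq_of_isMIntegralCurve (smoothVFieldAt_fundField hM b) hw hwd
    (fun y => (hM.fundField_eq b y).trans (hd y))
    (hM.isMIntegralCurve_orbit (κ w) b) (by simp)
  simpa using this

variable [T2Space M] [CompactSpace M]

theorem IsFlatChart.apply_add_left {p : M} {κ : LieAlg m × LieAlg m → M} {ε : ℝ}
    (h : IsFlatChart J p κ ε) (hM : IsSymplecticToric Ω μ) (hJ : IsDGAK Ω μ univ J)
    {w : LieAlg m × LieAlg m} {a : LieAlg m} (hw : w ∈ Metric.ball (0 : LieAlg m × LieAlg m) ε)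
    (hwd : w + (a, 0) ∈ Metric.ball (0 : LieAlg m × LieAlg m) ε) :
    κ (w + (a, 0)) = gradExp J (κ w) a := by
  have hd : ∀ y : M, gradMap J y a = (gradMap J y).coprod (orbitDeriv y) (a, 0) := by simp
  have := h.eq_of_isMIntegralCurve (hM.smoothVFieldAt_gradField hJ a) hw hwd
    (fun y => (hM.gradField_eq a y).trans (hd y))
    (hM.isMIntegralCurve_gradExp hJ (κ w) a) (by simp [hM.gradExp_zero hJ])
  simpa using this

/-- Flat charts give additivity only locally. The statement is therefore propagated along the ray `s
• a`: its validity at `s`, for germs in `b`, is locally constant in `s`, and it holds at `s = 0`. -/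
theorem IsSymplecticToric.eventually_gradExp_add (hM : IsSymplecticToric Ω μ)
    (hJ : IsDGAK Ω μ univ J)
    (hflat : ∀ p ∈ openPart μ, ∃ κ ε, IsFlatChart J p κ ε) {x : M}
    (hx : ∀ a, gradExp J x a ∈ openPart μ) (a : LieAlg m) :
    ∀ᶠ b in 𝓝 (0 : LieAlg m), gradExp J x (a + b) = gradExp J (gradExp J x a) b := by
  let Q : ℝ → Prop := fun s =>
    ∀ᶠ b in 𝓝 (0 : LieAlg m), gradExp J x (s • a + b) = gradExp J (gradExp J x (s • a)) b
  have hQ0 : Q 0 := Filter.Eventually.of_forall fun b => by simp [hM.gradExp_zero hJ]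
  have hloc : ∀ s₀ : ℝ, ∀ᶠ s in 𝓝 s₀, (Q s₀ ↔ Q s) := by
    intro s₀
    obtain ⟨κ, ε, hκ⟩ := hflat _ (hx (s₀ • a))
    set f : LieAlg m → M := fun v => κ (v - s₀ • a, 0) with hf
    have hmem : ∀ v : LieAlg m, v ∈ Metric.ball (s₀ • a) ε →
        ((v - s₀ • a, 0) : LieAlg m × LieAlg m) ∈ Metric.ball (0 : LieAlg m × LieAlg m) ε := by
      intro v hv
      rw [mem_ball_zero_iff, Prod.norm_mk, norm_zero, max_eq_left (norm_nonneg _)]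
      rwa [Metric.mem_ball, dist_eq_norm] at hv
    have hfadd : ∀ v w : LieAlg m, v ∈ Metric.ball (s₀ • a) ε → v + w ∈ Metric.ball (s₀ • a) ε →
        f (v + w) = gradExp J (f v) w := by
      intro v w hv hvw
      have h1 : ((v - s₀ • a, 0) : LieAlg m × LieAlg m) + (w, 0) = (v + w - s₀ • a, 0) := by
        rw [Prod.mk_add_mk, add_zero, sub_add_eq_add_sub]
      have h2 := hκ.apply_add_left hM hJ (a := w) (hmem v hv) (by rw [h1]; exact hmem _ hvw)
      rw [h1] at h2
      exact h2
    have hf0 : f (s₀ • a) = gradExp J x (s₀ • a) := by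
      simp only [hf, sub_self]
      exact hκ.map_zero
    have hcent : s₀ • a ∈ Metric.ball (s₀ • a) ε := Metric.mem_ball_self hκ.pos
    have hfray : ∀ s : ℝ, s • a ∈ Metric.ball (s₀ • a) ε → f (s • a) = gradExp J x (s • a) := by
      intro s hs
      have h1 : s • a = s₀ • a + (s - s₀) • a := by module
      have h2 := hfadd (s₀ • a) ((s - s₀) • a) hcent (h1 ▸ hs)
      rw [← h1, hf0, ← hM.gradExp_add_smul hJ, add_sub_cancel] at h2
      exact h2
    have hQR : ∀ s : ℝ, s • a ∈ Metric.ball (s₀ • a) ε →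
        (Q s ↔ ∀ᶠ v in 𝓝 (s • a), gradExp J x v = f v) := by
      intro s hs
      have h1 : ∀ᶠ b in 𝓝 (0 : LieAlg m), s • a + b ∈ Metric.ball (s₀ • a) ε := by
        have : Filter.Tendsto (fun b : LieAlg m => s • a + b) (𝓝 0) (𝓝 (s • a)) := by
          have h2 : Continuous fun b : LieAlg m => s • a + b := by fun_prop
          simpa using h2.tendsto 0
        exact this.eventually (Metric.isOpen_ball.mem_nhds hs)
      have h2 : 𝓝 (s • a) = Filter.map (fun b => s • a + b) (𝓝 0) := by
        rw [map_add_left_nhds_zero]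
      rw [h2, Filter.eventually_map]
      refine Filter.eventually_congr ?_
      filter_upwards [h1] with b hb
      rw [hfadd _ _ hs hb, hfray s hs]
    -- The points `v` and `(s₁ / s₂) • v` lie on one line through `0`, along which `gradExp J x` and
    -- `f` follow the same flow; agreement near `s₁ • a` passes to `s₂ • a`. The ratio needs `s₂ ≠
    -- 0`, but at `0` the claim is known.
    have hRR : ∀ s₁ s₂ : ℝ, s₁ • a ∈ Metric.ball (s₀ • a) ε → s₂ • a ∈ Metric.ball (s₀ • a) ε →
        Q s₁ → Q s₂ := by
      intro s₁ s₂ h1 h2 hQ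
      rcases eq_or_ne s₂ 0 with rfl | hs
      · exact hQ0
      rw [hQR s₁ h1] at hQ
      rw [hQR s₂ h2]
      have h3 : Filter.Tendsto (fun v : LieAlg m => (s₁ / s₂) • v) (𝓝 (s₂ • a)) (𝓝 (s₁ • a)) := by
        have h4 : Continuous fun v : LieAlg m => (s₁ / s₂) • v := by fun_prop
        have h5 := h4.tendsto (s₂ • a)
        rwa [smul_smul, div_mul_cancel₀ _ hs] at h5
      filter_upwards [h3.eventually hQ, h3.eventually (Metric.isOpen_ball.mem_nhds h1),
        Metric.isOpen_ball.mem_nhds h2] with v h4 h5 h6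
      have h7 : (s₁ / s₂) • v + (1 - s₁ / s₂) • v = v := by module
      have h8 := hfadd _ ((1 - s₁ / s₂) • v) h5 (by rw [h7]; exact h6)
      rw [h7, ← h4, ← hM.gradExp_add_smul hJ, add_sub_cancel, one_smul] at h8
      exact h8.symm
    have hnear : ∀ᶠ s in 𝓝 s₀, s • a ∈ Metric.ball (s₀ • a) ε := by
      have h1 : Continuous fun s : ℝ => s • a := by fun_prop
      exact h1.continuousAt.eventually (Metric.isOpen_ball.mem_nhds hcent)
    filter_upwards [hnear] with s hs
    exact ⟨hRR s₀ s hcent hs, hRR s s₀ hs hcent⟩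
  have h1 := (isPreconnected_univ (α := ℝ)).induction₂ (fun s s' => Q s ↔ Q s')
    (fun s _ => by rw [nhdsWithin_univ]; exact hloc s)
    (fun _ _ _ _ _ _ h h' => h.trans h') (fun _ _ _ _ h => h.symm) (mem_univ 0) (mem_univ 1)
  simpa [Q] using h1.1 hQ0

/-- The germ version shows that `s ↦ gradExp J x (a + s • b)` is an integral curve of the field of
`b` at every time, so uniqueness makes the identity global in `b`. -/
theorem IsSymplecticToric.gradExp_gradExp (hM : IsSymplecticToric Ω μ)
    (hJ : IsDGAK Ω μ univ J)
    (hflat : ∀ p ∈ openPart μ, ∃ κ ε, IsFlatChart J p κ ε) {x : M}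
    (hx : ∀ a, gradExp J x a ∈ openPart μ) (a b : LieAlg m) :
    gradExp J (gradExp J x a) b = gradExp J x (a + b) := by
  have h1 : IsMIntegralCurve (fun s : ℝ => gradExp J x (a + s • b)) (gradField J b) := by
    intro s₀
    set y := gradExp J x (a + s₀ • b) with hy
    have h2 : HasMFDerivAt 𝓘(ℝ, ℝ) (𝓡 (2 * m)) ((fun s : ℝ => gradExp J y (s • b)) ∘ (· + (-s₀))) s₀
        ((1 : ℝ →L[ℝ] ℝ).smulRight (gradField J b y : Model m)) := by
      have h3 := (hM.isMIntegralCurve_gradExp hJ y b).comp_add (-s₀) s₀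
      have h4 : gradExp J y ((s₀ + -s₀) • b) = y := by simp [hM.gradExp_zero hJ]
      have h5 : (gradField J b (gradExp J y ((s₀ + -s₀) • b)) : Model m) = gradField J b y :=
        congrArg (fun z : M => (show Model m from gradField J b z)) h4
      rw [← h5]
      exact h3
    refine h2.congr_of_eventuallyEq ?_
    have h6 := hM.eventually_gradExp_add hJ hflat hx (a + s₀ • b)
    have h7 : Filter.Tendsto (fun s : ℝ => (s - s₀) • b) (𝓝 s₀) (𝓝 0) := by
      have h8 : Continuous fun s : ℝ => (s - s₀) • b := by fun_prop
      simpa using h8.tendsto s₀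
    filter_upwards [h7.eventually h6] with s hs
    rw [← hy] at hs
    simp only [Function.comp, ← sub_eq_add_neg]
    rw [← hs]
    congr 1
    module
  have h2 := hM.eq_gradExp_of_isMIntegralCurve hJ h1 1
  simpa using h2.symm

end FlatChart

/-! ### Holomorphic coordinates give flat charts. -/

section HolCoord

variable {m : ℕ} {M : Type*} [TopologicalSpace M] [ChartedSpace (Model m) M]
  [AddAction (Torus m) M] {Ω : BilinField m M}
  {μ : M → DualLieAlg m} {J : EndField m M} {ξ : Module.Basis (Fin m) ℝ (LieAlg m)}
  {V : Set M} {u t : Fin m → M → ℝ}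

/-- The pair of `𝔱`-valued functions `(∑ uʲ ξ_j, ∑ tʲ ξ_j)`. -/
def holMap (ξ : Module.Basis (Fin m) ℝ (LieAlg m)) (u t : Fin m → M → ℝ) (y : M) :
    LieAlg m × LieAlg m :=
  (∑ j, u j y • ξ j, ∑ j, t j y • ξ j)

theorem IsHolCoord.contMDiffAt_holMap (h : IsHolCoord μ ξ J V u t) {y : M} (hy : y ∈ V) :
    ContMDiffAt (𝓡 (2 * m)) 𝓘(ℝ, LieAlg m × LieAlg m) ∞ (holMap ξ u t) y := by
  have hV : V ∈ 𝓝 y := h.isOpen.mem_nhds hy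
  refine ContMDiffAt.prodMk_space ?_ ?_
  · refine contMDiffAt_finsetSum fun j _ => ?_
    exact ((h.smooth_u j).contMDiffAt hV).smul contMDiffAt_const
  · refine contMDiffAt_finsetSum fun j _ => ?_
    exact ((h.smooth_t j).contMDiffAt hV).smul contMDiffAt_const

/-- The differential of `holMap`. -/
def holDeriv (ξ : Module.Basis (Fin m) ℝ (LieAlg m)) (u t : Fin m → M → ℝ) (y : M) :
    Model m →L[ℝ] LieAlg m × LieAlg m :=
  mfderiv (𝓡 (2 * m)) 𝓘(ℝ, LieAlg m × LieAlg m) (holMap ξ u t) y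

theorem IsHolCoord.hasMFDerivAt_holMap (h : IsHolCoord μ ξ J V u t) {y : M} (hy : y ∈ V) :
    HasMFDerivAt (𝓡 (2 * m)) 𝓘(ℝ, LieAlg m × LieAlg m) (holMap ξ u t) y (holDeriv ξ u t y) :=
  ((h.contMDiffAt_holMap hy).mdifferentiableAt (by simp)).hasMFDerivAt

theorem IsHolCoord.holDeriv_apply (h : IsHolCoord μ ξ J V u t) {y : M} (hy : y ∈ V)
    (v : Model m) :
    holDeriv ξ u t y v = (∑ j, dfun (u j) y v • ξ j, ∑ j, dfun (t j) y v • ξ j) := by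
  have key : ∀ (ℓ : LieAlg m × LieAlg m →L[ℝ] ℝ) (f : M → ℝ), (∀ z, ℓ (holMap ξ u t z) = f z) →
      ℓ (holDeriv ξ u t y v) = dfun f y v := by
    intro ℓ f hf
    have h1 : HasMFDerivAt 𝓘(ℝ, LieAlg m × LieAlg m) 𝓘(ℝ, ℝ) ℓ (holMap ξ u t y) ℓ :=
      ℓ.hasFDerivAt.hasMFDerivAt
    have h2 := (h1.comp y (h.hasMFDerivAt_holMap hy)).mfderiv
    have h3 : ℓ ∘ holMap ξ u t = f := funext hf
    rw [h3] at h2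
    exact (DFunLike.congr_fun h2 v).symm
  refine Prod.ext (ξ.ext_elem fun j => ?_) (ξ.ext_elem fun j => ?_)
  · rw [ξ.repr_sum_self]
    exact key ((dualVec ξ j).comp (ContinuousLinearMap.fst ℝ _ _)) (u j) fun z => by
      exact congrFun (ξ.repr_sum_self _) j
  · rw [ξ.repr_sum_self]
    exact key ((dualVec ξ j).comp (ContinuousLinearMap.snd ℝ _ _)) (t j) fun z => by
      exact congrFun (ξ.repr_sum_self _) j

variable [IsManifold (𝓡 (2 * m)) ∞ M]

theorem IsHolCoord.holDeriv_coprod (hM : IsSymplecticToric Ω μ) (h : IsHolCoord μ ξ J V u t)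
    {y : M} (hy : y ∈ V) (w : LieAlg m × LieAlg m) :
    holDeriv ξ u t y ((gradMap J y).coprod (orbitDeriv y) w) = w := by
  have h1 : ∀ k, holDeriv ξ u t y (gradMap J y (ξ k)) = (ξ k, 0) := fun k => by
    have e : gradMap J y (ξ k) = - J y (fundField (ξ k) y) := (hM.gradField_eq (ξ k) y).symm
    have h2 : ∀ j, dfun (u j) y (gradMap J y (ξ k)) = if j = k then 1 else 0 := fun j =>
      (congrArg _ e).trans (h.du_JK y hy j k)
    have h3 : ∀ j, dfun (t j) y (gradMap J y (ξ k)) = 0 := fun j =>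
      (congrArg _ e).trans (h.dt_JK y hy j k)
    rw [h.holDeriv_apply hy]
    simp only [h2, h3]
    simp
  have h1' : ∀ k, holDeriv ξ u t y (orbitDeriv y (ξ k)) = (0, ξ k) := fun k => by
    have e : orbitDeriv y (ξ k) = fundField (ξ k) y := (hM.fundField_eq (ξ k) y).symm
    have h2 : ∀ j, dfun (t j) y (orbitDeriv y (ξ k)) = if j = k then 1 else 0 := fun j =>
      (congrArg _ e).trans (h.dt_K y hy j k)
    have h3 : ∀ j, dfun (u j) y (orbitDeriv y (ξ k)) = 0 := fun j =>
      (congrArg _ e).trans (h.du_K y hy j k)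
    rw [h.holDeriv_apply hy]
    simp only [h2, h3]
    simp
  obtain ⟨a, b⟩ := w
  rw [← ξ.sum_repr a, ← ξ.sum_repr b]
  simp only [ContinuousLinearMap.coprod_apply, map_add, map_sum, map_smul, h1, h1', Prod.smul_mk,
    smul_zero]
  refine Prod.ext ?_ ?_ <;> simp [Prod.fst_sum, Prod.snd_sum]

theorem IsHolCoord.bijective_holDeriv (hM : IsSymplecticToric Ω μ) (h : IsHolCoord μ ξ J V u t)
    {y : M} (hy : y ∈ V) : Function.Bijective (holDeriv ξ u t y) := by
  have h1 : Function.Surjective (holDeriv ξ u t y) := fun w => ⟨_, h.holDeriv_coprod hM hy w⟩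
  refine ⟨?_, h1⟩
  have h2 : Module.finrank ℝ (Model m) = Module.finrank ℝ (LieAlg m × LieAlg m) := by
    simp [two_mul]
  exact (LinearMap.injective_iff_surjective_of_finrank_eq_finrank
    (f := (holDeriv ξ u t y).toLinearMap) h2).2 h1

/-- The flat chart is a local inverse of `(u, t)`, translated to be centred at `p`. The differential
of `(u, t)` is bijective and sends `-J a^♯ + b^♯` to `(a, b)`, which determines the differential of
the inverse. -/
theorem IsHolCoord.exists_isFlatChart (hM : IsSymplecticToric Ω μ) (h : IsHolCoord μ ξ J V u t)
    {p : M} (hp : p ∈ V) : ∃ κ ε, IsFlatChart J p κ ε := by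
  set ψ := extChartAt (𝓡 (2 * m)) p with hψ
  set H := holMap ξ u t with hH
  set G : Model m → LieAlg m × LieAlg m := fun z => H (ψ.symm z) with hG
  have hGs : ∀ z ∈ ψ.target, ψ.symm z ∈ V → ContDiffAt ℝ ∞ G z := fun z hz hzV => by
    rw [← contMDiffAt_iff_contDiffAt]
    exact ContMDiffAt.comp_of_eq (g := H) (h.contMDiffAt_holMap hzV)
      (contMDiffAt_extChartAt_symm p hz) rfl
  have hGd : ∀ z ∈ ψ.target, ψ.symm z ∈ V →
      ∃ e : Model m ≃L[ℝ] LieAlg m × LieAlg m, HasFDerivAt G (e : Model m →L[ℝ] _) z := by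
    intro z hz hzV
    set B : Model m →L[ℝ] Model m := mfderiv 𝓘(ℝ, Model m) (𝓡 (2 * m)) ψ.symm z with hB
    have h1 : HasMFDerivAt 𝓘(ℝ, Model m) 𝓘(ℝ, LieAlg m × LieAlg m) (H ∘ ψ.symm) z
        ((holDeriv ξ u t (ψ.symm z)).comp B) :=
      (h.hasMFDerivAt_holMap hzV).comp z (hasMFDerivAt_extChartAt_symm p hz)
    have h2 : Function.Surjective B := fun v => ⟨_, mfderiv_extChartAt_symm_apply p hz v⟩
    have h3 : Function.Surjective ((holDeriv ξ u t (ψ.symm z)).comp B) :=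
      (h.bijective_holDeriv hM hzV).2.comp h2
    have h4 : Module.finrank ℝ (Model m) = Module.finrank ℝ (LieAlg m × LieAlg m) := by
      simp [two_mul]
    have h5 : Function.Injective ((holDeriv ξ u t (ψ.symm z)).comp B) :=
      (LinearMap.injective_iff_surjective_of_finrank_eq_finrank
        (f := ((holDeriv ξ u t (ψ.symm z)).comp B).toLinearMap) h4).2 h3
    refine ⟨(LinearEquiv.ofBijective ((holDeriv ξ u t (ψ.symm z)).comp B).toLinearMap
      ⟨h5, h3⟩).toContinuousLinearEquiv, ?_⟩
    exact hasMFDerivAt_iff_hasFDerivAt.1 h1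
  have hpt : ψ p ∈ ψ.target := mem_extChartAt_target p
  have hpp : ψ.symm (ψ p) = p := extChartAt_to_inv p
  obtain ⟨e₀, he₀⟩ := hGd (ψ p) hpt (by rwa [hpp])
  have hst : HasStrictFDerivAt G (e₀ : Model m →L[ℝ] _) (ψ p) :=
    (hGs (ψ p) hpt (by rwa [hpp])).hasStrictFDerivAt' he₀ (by simp)
  set e := hst.toOpenPartialHomeomorph G with he
  have heG : ∀ z, e z = G z := fun z => rfl
  have hsrc : ψ p ∈ e.source := hst.mem_toOpenPartialHomeomorph_source
  set c : LieAlg m × LieAlg m := H p with hc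
  have hGc : G (ψ p) = c := by simp only [hG, hpp, hc]
  have hesc : e.symm c = ψ p := by rw [← hGc, ← heG]; exact e.left_inv hsrc
  have hct : c ∈ e.target := by rw [← hGc, ← heG]; exact e.map_source hsrc
  set S : Set (Model m) := ψ.target ∩ ψ.symm ⁻¹' V with hS
  have hSo : IsOpen S := (continuousOn_extChartAt_symm (I := 𝓡 (2 * m)) p).isOpen_inter_preimage
    (isOpen_extChartAt_target p) h.isOpen
  set T : Set (LieAlg m × LieAlg m) := e.target ∩ e.symm ⁻¹' S with hT
  have hTo : IsOpen T := e.symm.isOpen_inter_preimage hSo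
  have hcT : c ∈ T := ⟨hct, by
    rw [mem_preimage, hesc]
    exact ⟨hpt, by rwa [mem_preimage, hpp]⟩⟩
  set k : LieAlg m × LieAlg m → M := fun w => ψ.symm (e.symm w) with hk
  have hks : ∀ w ∈ T, ContMDiffAt 𝓘(ℝ, LieAlg m × LieAlg m) (𝓡 (2 * m)) ∞ k w := by
    rintro w ⟨hw, hwt, hwV⟩
    obtain ⟨e₁, he₁⟩ := hGd _ hwt hwV
    have h1 : ContDiffAt ℝ ∞ e.symm w := e.contDiffAt_symm hw he₁ (hGs _ hwt hwV)
    exact ContMDiffAt.comp_of_eq (contMDiffAt_extChartAt_symm p hwt) h1.contMDiffAt rfl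
  have hHk : ∀ w ∈ T, H (k w) = w := fun w hw => e.right_inv hw.1
  have hkd : ∀ w ∈ T, HasMFDerivAt 𝓘(ℝ, LieAlg m × LieAlg m) (𝓡 (2 * m)) k w
      ((gradMap J (k w)).coprod (orbitDeriv (k w)) : LieAlg m × LieAlg m →L[ℝ] Model m) := by
    intro w hw
    have hwV : k w ∈ V := hw.2.2
    set A : LieAlg m × LieAlg m →L[ℝ] Model m :=
      mfderiv 𝓘(ℝ, LieAlg m × LieAlg m) (𝓡 (2 * m)) k w with hA
    have h1 : HasMFDerivAt 𝓘(ℝ, LieAlg m × LieAlg m) (𝓡 (2 * m)) k w A :=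
      ((hks w hw).mdifferentiableAt (by simp)).hasMFDerivAt
    have h2 : HasMFDerivAt 𝓘(ℝ, LieAlg m × LieAlg m) 𝓘(ℝ, LieAlg m × LieAlg m) (H ∘ k) w
      ((holDeriv ξ u t (k w)).comp A) := (h.hasMFDerivAt_holMap hwV).comp w h1
    have h2' : HasFDerivAt (H ∘ k) ((holDeriv ξ u t (k w)).comp A) w :=
      hasMFDerivAt_iff_hasFDerivAt.1 h2
    have h3 : H ∘ k =ᶠ[𝓝 w] id := by
      filter_upwards [hTo.mem_nhds hw] with w' hw' using hHk w' hw'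
    have h4 : HasFDerivAt (H ∘ k) (ContinuousLinearMap.id ℝ (LieAlg m × LieAlg m)) w :=
      (hasFDerivAt_id w).congr_of_eventuallyEq h3
    have h5 : (holDeriv ξ u t (k w)).comp A = ContinuousLinearMap.id ℝ (LieAlg m × LieAlg m) :=
      h2'.unique h4
    have h6 : A = (gradMap J (k w)).coprod (orbitDeriv (k w)) := by
      refine ContinuousLinearMap.ext fun d => ?_
      refine (h.bijective_holDeriv hM hwV).1 ?_
      rw [h.holDeriv_coprod hM hwV]
      exact DFunLike.congr_fun h5 d
    rw [← h6]
    exact h1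
  obtain ⟨ε, hε, hball⟩ := Metric.isOpen_iff.1 hTo c hcT
  have hadd : ∀ w ∈ Metric.ball (0 : LieAlg m × LieAlg m) ε, c + w ∈ T := fun w hw =>
    hball (by simpa using hw)
  refine ⟨fun w => k (c + w), ε, hε, ?_, fun w hw => ?_, fun w hw => ?_, ?_⟩
  · simp only [add_zero, hk, hesc, hpp]
  · have h1 : ContMDiffAt 𝓘(ℝ, LieAlg m × LieAlg m) 𝓘(ℝ, LieAlg m × LieAlg m) ∞
      (fun w => c + w) w := (contDiff_const.add contDiff_id).contDiffAt.contMDiffAt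
    exact ContMDiffAt.comp_of_eq (g := k) (hks _ (hadd w hw)) h1 rfl
  · have h1 : HasMFDerivAt 𝓘(ℝ, LieAlg m × LieAlg m) 𝓘(ℝ, LieAlg m × LieAlg m)
        (fun w => c + w) w (ContinuousLinearMap.id ℝ (LieAlg m × LieAlg m)) :=
      ((hasFDerivAt_id w).const_add c).hasMFDerivAt
    have h2 := HasMFDerivAt.comp (g := k) w (hkd _ (hadd w hw)) h1
    exact h2.congr_mfderiv (ContinuousLinearMap.comp_id _)
  · have h1 : ∀ᶠ y in 𝓝 p, y ∈ ψ.source := extChartAt_source_mem_nhds p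
    have h2 : ∀ᶠ y in 𝓝 p, ψ y ∈ e.source :=
      (continuousAt_extChartAt (I := 𝓡 (2 * m)) p).eventually (e.open_source.mem_nhds hsrc)
    have h3 : ∀ᶠ y in 𝓝 p, H y ∈ Metric.ball c ε :=
      (h.contMDiffAt_holMap hp).continuousAt.eventually (Metric.ball_mem_nhds _ hε)
    filter_upwards [h1, h2, h3] with y hy1 hy2 hy3
    refine ⟨H y - c, by simpa [dist_eq_norm] using hy3, ?_⟩
    have h4 : H y = e (ψ y) := by simp only [heG, hG, ψ.left_inv hy1]
    simp only [add_sub_cancel, hk]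
    rw [h4, e.left_inv hy2, ψ.left_inv hy1]

end HolCoord

/-! ### Transitivity on `M°`, fibres of the moment map, convexity of `Δ°`. -/

section Orbits

variable {m : ℕ} {M : Type*} [TopologicalSpace M] [ChartedSpace (Model m) M]
  [AddAction (Torus m) M] [IsManifold (𝓡 (2 * m)) ∞ M] {Ω : BilinField m M}
  {μ : M → DualLieAlg m} {J : EndField m M} {ξ : Module.Basis (Fin m) ℝ (LieAlg m)}
  {X : Fin m → VField m M} {θ : Fin m → CovField m M}

theorem IsInducedCoord.exists_isFlatChart (hX : IsInducedCoord μ ξ J X θ)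
    (hM : IsSymplecticToric Ω μ) : ∀ p ∈ openPart μ, ∃ κ ε, IsFlatChart J p κ ε := by
  intro p hp
  obtain ⟨V, u, t, hpV, hV, -⟩ := hX p hp
  exact hV.exists_isFlatChart hM hpV

theorem IsInducedCoord.injective_orbitDeriv (hX : IsInducedCoord μ ξ J X θ)
    (hM : IsSymplecticToric Ω μ) {p : M} (hp : p ∈ openPart μ) :
    Function.Injective (orbitDeriv (m := m) p) := by
  obtain ⟨V, u, t, hpV, hV, -⟩ := hX p hp
  exact hV.orbitDeriv_injective hM hpV

/-- By the Hamiltonian condition `dμ^b(-J b^♯) = Ω(b^♯, J b^♯)`, which taming makes positive since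
`b^♯ ≠ 0` on `M°`. -/
theorem IsInducedCoord.dfun_moment_gradField_pos (hX : IsInducedCoord μ ξ J X θ)
    (hM : IsSymplecticToric Ω μ) (hJ : IsDGAK Ω μ univ J) {p : M} (hp : p ∈ openPart μ)
    {b : LieAlg m} (hb : b ≠ 0) : 0 < dfun (fun y => μ y b) p (gradField J b p) := by
  have h9 := hM.hamiltonian b p (gradField J b p)
  rw [← neg_eq_iff_eq_neg] at h9
  rw [← h9]
  have h10 : Ω p (fundField b p) (gradField J b p) = - Ω p (fundField b p) (J p (fundField b p)) :=
    map_neg _ _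
  rw [h10, neg_neg]
  refine hJ.tamed p (mem_univ p) _ fun h0 => hb ?_
  exact (injective_iff_map_eq_zero _).1 (hX.injective_orbitDeriv hM hp) b
    ((hM.fundField_eq b p).symm.trans h0)

variable [T2Space M] [CompactSpace M]

theorem IsInducedCoord.gradExp_mem (hX : IsInducedCoord μ ξ J X θ)
    (hM : IsSymplecticToric Ω μ) (hJ : IsDGAK Ω μ univ J) {x : M} (hx : x ∈ openPart μ)
    (a : LieAlg m) : gradExp J x a ∈ openPart μ :=
  hM.mem_openPart_of_injective
    (hM.injective_orbitDeriv_gradExp hJ (hX.injective_orbitDeriv hM hx) a)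

theorem IsInducedCoord.gradExp_add (hX : IsInducedCoord μ ξ J X θ)
    (hM : IsSymplecticToric Ω μ) (hJ : IsDGAK Ω μ univ J) {x : M} (hx : x ∈ openPart μ)
    (a b : LieAlg m) : gradExp J (gradExp J x a) b = gradExp J x (a + b) :=
  hM.gradExp_gradExp hJ (hX.exists_isFlatChart hM) (hX.gradExp_mem hM hJ hx) a b

theorem IsInducedCoord.contMDiffAt_gradExp (hX : IsInducedCoord μ ξ J X θ)
    (hM : IsSymplecticToric Ω μ) (hJ : IsDGAK Ω μ univ J) {x : M} (hx : x ∈ openPart μ)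
    (a : LieAlg m) : ContMDiffAt 𝓘(ℝ, LieAlg m) (𝓡 (2 * m)) ∞ (gradExp J x) a := by
  obtain ⟨κ, ε, hκ⟩ := hX.exists_isFlatChart hM _ (hX.gradExp_mem hM hJ hx a)
  have h0 : (0 : LieAlg m × LieAlg m) ∈ Metric.ball (0 : LieAlg m × LieAlg m) ε :=
    Metric.mem_ball_self hκ.pos
  have h1 : ContMDiffAt 𝓘(ℝ, LieAlg m) (𝓡 (2 * m)) ∞ (fun v : LieAlg m => κ (v - a, 0)) a := by
    have h2 : ContMDiffAt 𝓘(ℝ, LieAlg m) 𝓘(ℝ, LieAlg m × LieAlg m) ∞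
        (fun v : LieAlg m => ((v - a, 0) : LieAlg m × LieAlg m)) a :=
      ((contDiff_id.sub contDiff_const).prodMk contDiff_const).contDiffAt.contMDiffAt
    refine ContMDiffAt.comp_of_eq (g := κ) (hκ.smooth 0 h0) h2 ?_
    rw [sub_self, Prod.mk_zero_zero]
  refine h1.congr_of_eventuallyEq ?_
  have h3 : ∀ᶠ v in 𝓝 a, ((v - a, 0) : LieAlg m × LieAlg m) ∈ Metric.ball 0 ε := by
    have h4 : Continuous fun v : LieAlg m => ((v - a, 0) : LieAlg m × LieAlg m) := by fun_prop
    refine h4.continuousAt.eventually (Metric.isOpen_ball.mem_nhds ?_)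
    simp only [sub_self, Prod.mk_zero_zero]
    exact h0
  filter_upwards [h3] with v hv
  have h5 := hκ.apply_add_left hM hJ (a := v - a) h0 (by rwa [zero_add])
  rw [zero_add, hκ.map_zero, hX.gradExp_add hM hJ hx, add_sub_cancel] at h5
  exact h5.symm

/-- The gradient flows and the torus act transitively on `M°`. -/
theorem IsInducedCoord.exists_eq_vadd_gradExp [ConnectedSpace M] (hX : IsInducedCoord μ ξ J X θ)
    (hM : IsSymplecticToric Ω μ) (hJ : IsDGAK Ω μ univ J) {x y : M} (hx : x ∈ openPart μ)
    (hy : y ∈ openPart μ) : ∃ a b : LieAlg m, y = torusExp b +ᵥ gradExp J x a := by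
  -- The relation is an equivalence on `M°`, by additivity of the flows and their commutation with
  -- the torus. Flat charts make its classes open, and `M°` is connected.
  refine (hM.isPreconnected_openPart hJ).induction₂
    (fun x y => ∃ a b : LieAlg m, y = torusExp b +ᵥ gradExp J x a) ?_ ?_ ?_ hx hy
  · intro p hp
    obtain ⟨κ, ε, hκ⟩ := hX.exists_isFlatChart hM p hp
    have h0 : (0 : LieAlg m × LieAlg m) ∈ Metric.ball (0 : LieAlg m × LieAlg m) ε :=
      Metric.mem_ball_self hκ.pos
    refine Filter.Eventually.filter_mono nhdsWithin_le_nhds ?_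
    filter_upwards [hκ.eventually] with y ⟨w, hw, hwy⟩
    have hw1 : (0 : LieAlg m × LieAlg m) + (w.1, 0) ∈ Metric.ball (0 : LieAlg m × LieAlg m) ε := by
      rw [mem_ball_zero_iff] at hw ⊢
      rw [zero_add, Prod.norm_mk, norm_zero, max_eq_left (norm_nonneg _)]
      exact (norm_fst_le w).trans_lt hw
    have hw2 : (0 : LieAlg m × LieAlg m) + (w.1, 0) + (0, w.2) = w := by simp
    have h1 := hκ.apply_add_left hM hJ h0 hw1
    have h2 := hκ.apply_add_right hM hw1 (b := w.2) (by rwa [hw2])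
    rw [hw2, h1, hκ.map_zero, hwy] at h2
    exact ⟨w.1, w.2, h2⟩
  · rintro x y z hx - - ⟨a, b, rfl⟩ ⟨a', b', rfl⟩
    refine ⟨a + a', b' + b, ?_⟩
    rw [hM.gradExp_vadd hJ, hX.gradExp_add hM hJ hx, vadd_vadd, torusExp_add]
  · rintro x y hx - ⟨a, b, rfl⟩
    refine ⟨-a, -b, ?_⟩
    rw [hM.gradExp_vadd hJ, hX.gradExp_add hM hJ hx, vadd_vadd, ← torusExp_add]
    simp [hM.gradExp_zero hJ]

/-- The linear map with coordinates given by the basis `ξ`. -/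
def basisMap (ξ : Module.Basis (Fin m) ℝ (LieAlg m)) : EuclideanSpace ℝ (Fin m) →L[ℝ] LieAlg m :=
  ∑ j, (EuclideanSpace.proj (𝕜 := ℝ) j).smulRight (ξ j)

theorem basisMap_apply (e : EuclideanSpace ℝ (Fin m)) : basisMap ξ e = ∑ j, e j • ξ j := by
  simp [basisMap]

theorem basisMap_injective : Function.Injective (basisMap ξ) := by
  rw [injective_iff_map_eq_zero]
  intro e he
  rw [basisMap_apply] at he
  ext j
  exact Fintype.linearIndependent_iff.1 ξ.linearIndependent _ he j

theorem inner_dualCoord (y : DualLieAlg m) (h : EuclideanSpace ℝ (Fin m)) :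
    inner ℝ (dualCoord ξ y) h = y (basisMap ξ h) := by
  rw [basisMap_apply, map_sum, PiLp.inner_apply]
  refine Finset.sum_congr rfl fun j _ => ?_
  simp [dualCoord_apply]

/-- The moment map along the gradient flow through `x`, in coordinates. -/
def momentFlow (μ : M → DualLieAlg m) (ξ : Module.Basis (Fin m) ℝ (LieAlg m)) (J : EndField m M)
    (x : M) (e : EuclideanSpace ℝ (Fin m)) : EuclideanSpace ℝ (Fin m) :=
  dualCoord ξ (μ (gradExp J x (basisMap ξ e)))

theorem IsInducedCoord.contDiff_momentFlow (hX : IsInducedCoord μ ξ J X θ)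
    (hM : IsSymplecticToric Ω μ) (hJ : IsDGAK Ω μ univ J) {x : M} (hx : x ∈ openPart μ) :
    ContDiff ℝ ∞ (momentFlow μ ξ J x) := by
  rw [← contMDiff_iff_contDiff]
  refine (dualCoord ξ).toContinuousLinearMap.contMDiff.comp (hM.smooth_moment.comp ?_)
  exact ContMDiff.comp (fun a => hX.contMDiffAt_gradExp hM hJ hx a) (basisMap ξ).contMDiff

/-- With `b` the element of `𝔱` having coordinates `h`, additivity of the flow identifies the
quadratic form of the derivative with `dμ^b(-J b^♯)`. -/
theorem IsInducedCoord.inner_fderiv_momentFlow_pos (hX : IsInducedCoord μ ξ J X θ)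
    (hM : IsSymplecticToric Ω μ) (hJ : IsDGAK Ω μ univ J) {x : M} (hx : x ∈ openPart μ)
    (e h : EuclideanSpace ℝ (Fin m)) (hh : h ≠ 0) :
    0 < inner ℝ (fderiv ℝ (momentFlow μ ξ J x) e h) h := by
  set p := gradExp J x (basisMap ξ e) with hp
  have hpm : p ∈ openPart μ := hX.gradExp_mem hM hJ hx _
  set b := basisMap ξ h with hb
  have hb0 : b ≠ 0 := (map_ne_zero_iff _ basisMap_injective).2 hh
  have h1 : HasDerivAt (fun s : ℝ => inner ℝ (momentFlow μ ξ J x (e + s • h)) h)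
      (inner ℝ (fderiv ℝ (momentFlow μ ξ J x) e h) h) 0 := by
    have h2 : HasFDerivAt (momentFlow μ ξ J x) (fderiv ℝ (momentFlow μ ξ J x) e) (e + (0 : ℝ) • h) := by
      rw [zero_smul, add_zero]
      exact ((hX.contDiff_momentFlow hM hJ hx).differentiable (by simp) e).hasFDerivAt
    have h3 : HasDerivAt (fun s : ℝ => e + s • h) h 0 := by
      simpa using ((hasDerivAt_id (0 : ℝ)).smul_const h).const_add e
    have h4 := (h2.comp_hasDerivAt 0 h3).inner ℝ (hasDerivAt_const (0 : ℝ) h)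
    simpa using h4
  have h5 : (fun s : ℝ => inner ℝ (momentFlow μ ξ J x (e + s • h)) h)
      = (fun y => μ y b) ∘ fun s : ℝ => gradExp J p (s • b) := by
    funext s
    simp only [Function.comp, momentFlow]
    rw [inner_dualCoord, hp, hX.gradExp_add hM hJ hx, map_add, map_smul]
  have h6 := hM.isMIntegralCurve_gradExp hJ p b 0
  have h7 := hasDerivAt_comp_curve
    ((hM.contMDiff_moment_apply b).mdifferentiable (by simp) _) h6
  rw [h5] at h1
  rw [h1.unique h7]
  exact hX.dfun_moment_gradField_pos hM hJ (hX.gradExp_mem hM hJ hpm _) hb0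

theorem IsInducedCoord.injective_momentFlow (hX : IsInducedCoord μ ξ J X θ)
    (hM : IsSymplecticToric Ω μ) (hJ : IsDGAK Ω μ univ J) {x : M} (hx : x ∈ openPart μ) :
    Function.Injective (momentFlow μ ξ J x) :=
  injective_of_hasFDerivAt_pos
    (fun e => ((hX.contDiff_momentFlow hM hJ hx).differentiable (by simp) e).hasFDerivAt)
    (hX.inner_fderiv_momentFlow_pos hM hJ hx)

theorem basisMap_surjective : Function.Surjective (basisMap ξ) := fun a =>
  ⟨WithLp.toLp 2 fun j => ξ.repr a j, by rw [basisMap_apply]; exact ξ.sum_repr a⟩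

/-- The moment map has a smooth local section through each point of `M°`. -/
theorem IsInducedCoord.exists_local_section (hX : IsInducedCoord μ ξ J X θ)
    (hM : IsSymplecticToric Ω μ) (hJ : IsDGAK Ω μ univ J) {x : M} (hx : x ∈ openPart μ) :
    ∃ σ : DualLieAlg m → M, σ (μ x) = x ∧
      ContMDiffAt 𝓘(ℝ, DualLieAlg m) (𝓡 (2 * m)) ∞ σ (μ x) ∧ ∀ᶠ y in 𝓝 (μ x), μ (σ y) = y := by
  set F := momentFlow μ ξ J x with hF
  set D := fderiv ℝ F 0 with hD
  have hFs : ContDiffAt ℝ ∞ F 0 := (hX.contDiff_momentFlow hM hJ hx).contDiffAt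
  have hinj : Function.Injective D.toLinearMap := by
    rw [injective_iff_map_eq_zero]
    intro h h0
    by_contra hh
    have h1 := hX.inner_fderiv_momentFlow_pos hM hJ hx 0 h hh
    have h2 : fderiv ℝ (momentFlow μ ξ J x) 0 h = 0 := h0
    rw [h2, inner_zero_left] at h1
    exact h1.ne rfl
  let e : EuclideanSpace ℝ (Fin m) ≃L[ℝ] EuclideanSpace ℝ (Fin m) :=
    (LinearEquiv.ofInjectiveEndo D.toLinearMap hinj).toContinuousLinearEquiv
  have hFd : HasFDerivAt F (e : EuclideanSpace ℝ (Fin m) →L[ℝ] _) 0 :=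
    (hFs.differentiableAt (by simp)).hasFDerivAt
  have hF0 : F 0 = dualCoord ξ (μ x) := by
    simp only [hF, momentFlow, map_zero, hM.gradExp_zero hJ]
  set L := hFs.localInverse hFd (by simp) with hL
  have hL0 : L (dualCoord ξ (μ x)) = 0 := by
    rw [← hF0]
    exact hFs.localInverse_apply_image hFd (by simp)
  have hLs : ContDiffAt ℝ ∞ L (dualCoord ξ (μ x)) := by
    rw [← hF0]
    exact hFs.to_localInverse hFd (by simp)
  have hFL : ∀ᶠ w in 𝓝 (dualCoord ξ (μ x)), F (L w) = w := by
    rw [← hF0]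
    exact (hFs.hasStrictFDerivAt' hFd (by simp)).eventually_right_inverse
  refine ⟨fun y => gradExp J x (basisMap ξ (L (dualCoord ξ y))), ?_, ?_, ?_⟩
  · simp only [hL0, map_zero, hM.gradExp_zero hJ]
  · have h1 : ContMDiffAt 𝓘(ℝ, DualLieAlg m) 𝓘(ℝ, EuclideanSpace ℝ (Fin m)) ∞
        (fun y => L (dualCoord ξ y)) (μ x) :=
      ContMDiffAt.comp_of_eq (g := L) hLs.contMDiffAt
        ((dualCoord ξ).toContinuousLinearMap.contMDiff (μ x)) rfl
    have h2 : ContMDiffAt 𝓘(ℝ, DualLieAlg m) 𝓘(ℝ, LieAlg m) ∞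
        (fun y => basisMap ξ (L (dualCoord ξ y))) (μ x) :=
      ((basisMap ξ).contMDiff _).comp (μ x) h1
    exact (hX.contMDiffAt_gradExp hM hJ hx _).comp (μ x) h2
  · filter_upwards [(dualCoord ξ).continuous.continuousAt.eventually hFL] with y hy
    exact (dualCoord ξ).injective hy

variable [ConnectedSpace M]

/-- The fibres of the moment map over the interior of the polytope are torus orbits. -/
theorem IsInducedCoord.exists_eq_vadd (hX : IsInducedCoord μ ξ J X θ)
    (hM : IsSymplecticToric Ω μ) (hJ : IsDGAK Ω μ univ J) {x y : M} (hx : x ∈ openPart μ)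
    (hxy : μ x = μ y) : ∃ g : Torus m, y = g +ᵥ x := by
  have hy : y ∈ openPart μ := by rwa [openPart, mem_preimage, ← hxy]
  obtain ⟨a, b, h⟩ := hX.exists_eq_vadd_gradExp hM hJ hx hy
  refine ⟨torusExp b, ?_⟩
  obtain ⟨e, rfl⟩ := basisMap_surjective (ξ := ξ) a
  -- The torus does not move `μ`, so equal moments force equal values along the flow orbit, and
  -- injectivity there leaves only the torus element.
  have h1 : momentFlow μ ξ J x e = momentFlow μ ξ J x 0 := by
    simp only [momentFlow, map_zero, hM.gradExp_zero hJ]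
    rw [hxy, h, hM.invariant_moment]
  rw [h, hX.injective_momentFlow hM hJ hx h1, map_zero, hM.gradExp_zero hJ]

theorem IsInducedCoord.polyInt_eq_preimage (hX : IsInducedCoord μ ξ J X θ)
    (hM : IsSymplecticToric Ω μ) (hJ : IsDGAK Ω μ univ J) {x : M} (hx : x ∈ openPart μ) :
    polyInt μ = dualCoord ξ ⁻¹' range (momentFlow μ ξ J x) := by
  ext z
  constructor
  · intro hz
    obtain ⟨y, rfl⟩ := interior_subset hz
    obtain ⟨a, b, h⟩ := hX.exists_eq_vadd_gradExp hM hJ hx (show y ∈ openPart μ from hz)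
    obtain ⟨e, rfl⟩ := basisMap_surjective (ξ := ξ) a
    exact ⟨e, by rw [momentFlow, h, hM.invariant_moment]⟩
  · rintro ⟨e, he⟩
    rw [← (dualCoord ξ).injective he]
    exact hX.gradExp_mem hM hJ hx _

/-- Modulo the torus a single flow orbit fills `M°`, so in coordinates `Δ°` is the range of a map
with positive definite derivative. -/
theorem IsInducedCoord.convex_polyInt (hX : IsInducedCoord μ ξ J X θ)
    (hM : IsSymplecticToric Ω μ) (hJ : IsDGAK Ω μ univ J) : Convex ℝ (polyInt μ) := by
  rcases (polyInt μ).eq_empty_or_nonempty with h | ⟨z, hz⟩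
  · rw [h]
    exact convex_empty
  obtain ⟨x, rfl⟩ := interior_subset hz
  rw [hX.polyInt_eq_preimage hM hJ (show x ∈ openPart μ from hz)]
  refine Convex.linear_preimage ?_ (dualCoord ξ).toLinearEquiv.toLinearMap
  exact convex_range_of_hasStrictFDerivAt_pos
    (fun e => (hX.contDiff_momentFlow hM hJ hz).contDiffAt.hasStrictFDerivAt (by simp))
    (hX.inner_fderiv_momentFlow_pos hM hJ hz)

end Orbits

/-! ### Components in the frame `∂/∂μʲ`, `K_j`. -/

section Frames

variable {m : ℕ} {M : Type*} [TopologicalSpace M] [ChartedSpace (Model m) M]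
  [AddAction (Torus m) M] {Ω : BilinField m M}
  {μ : M → DualLieAlg m} {J : EndField m M} {ξ : Module.Basis (Fin m) ℝ (LieAlg m)}
  {X : Fin m → VField m M} {θ : Fin m → CovField m M} {x : M}

/-- The components `dμʲ(v)` of a tangent vector. -/
def muPart (μ : M → DualLieAlg m) (ξ : Module.Basis (Fin m) ℝ (LieAlg m)) (x : M)
    (v : TangentSpace (𝓡 (2 * m)) x) : Fin m → ℝ := fun j => dmu μ ξ j x v

/-- The components `dtʲ(v)` of a tangent vector. -/
def anglePart (θ : Fin m → CovField m M) (x : M) (v : TangentSpace (𝓡 (2 * m)) x) : Fin m → ℝ :=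
  fun j => θ j x v

theorem IsInducedCoord.dmu_X (hX : IsInducedCoord μ ξ J X θ) (hx : x ∈ openPart μ) (i j : Fin m) :
    dmu μ ξ i x (X j x) = if i = j then 1 else 0 := by
  obtain ⟨V, u, t, hpV, hV, h⟩ := hX x hx
  exact ((h x hpV).2 i j).1

theorem IsInducedCoord.angle_X (hX : IsInducedCoord μ ξ J X θ) (hx : x ∈ openPart μ)
    (i j : Fin m) : θ i x (X j x) = 0 := by
  obtain ⟨V, u, t, hpV, hV, h⟩ := hX x hx
  rw [(h x hpV).1 i]
  exact ((h x hpV).2 i j).2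

theorem IsInducedCoord.angle_fundField (hX : IsInducedCoord μ ξ J X θ) (hx : x ∈ openPart μ)
    (i j : Fin m) : θ i x (fundField (ξ j) x) = if i = j then 1 else 0 := by
  obtain ⟨V, u, t, hpV, hV, h⟩ := hX x hx
  rw [(h x hpV).1 i]
  exact hV.dt_K x hpV i j

theorem IsInducedCoord.angle_gradField (hX : IsInducedCoord μ ξ J X θ) (hx : x ∈ openPart μ)
    (i j : Fin m) : θ i x (gradField J (ξ j) x) = 0 := by
  obtain ⟨V, u, t, hpV, hV, h⟩ := hX x hx
  rw [(h x hpV).1 i]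
  exact hV.dt_JK x hpV i j

theorem antiDiag_apply (Ψ : M → Matrix (Fin m) (Fin m) ℝ) (v : TangentSpace (𝓡 (2 * m)) x) :
    antiDiag μ ξ X θ Ψ x v = ∑ i, (Ψ x).mulVec (muPart μ ξ x v) i • fundField (ξ i) x
      - ∑ i, (Ψ x)⁻¹.mulVec (anglePart θ x v) i • X i x := by
  simp only [antiDiag, sub_apply, sum_apply, smul_apply, ContinuousLinearMap.smulRight_apply,
    Matrix.mulVec, dotProduct, Finset.sum_smul, smul_smul]
  rfl

theorem IsInducedCoord.anglePart_antiDiag (hX : IsInducedCoord μ ξ J X θ)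
    (hx : x ∈ openPart μ) (Ψ : M → Matrix (Fin m) (Fin m) ℝ)
    (v : TangentSpace (𝓡 (2 * m)) x) : anglePart θ x (antiDiag μ ξ X θ Ψ x v)
      = (Ψ x).mulVec (muPart μ ξ x v) := by
  funext i
  rw [antiDiag_apply]
  simp only [anglePart, map_sub, map_sum, map_smul, hX.angle_X hx, hX.angle_fundField hx]
  simp

variable [IsManifold (𝓡 (2 * m)) ∞ M]

theorem IsSymplecticToric.dfun_moment_fundField (hM : IsSymplecticToric Ω μ) (a b : LieAlg m)
    (x : M) : dfun (fun y => μ y a) x (fundField b x) = 0 := by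
  have h1 := hM.isMIntegralCurve_orbit x b 0
  have h2 := hasDerivAt_comp_curve
    ((hM.contMDiff_moment_apply a).mdifferentiable (by simp) _) h1
  have h3 : (fun y => μ y a) ∘ (fun s : ℝ => torusExp (s • b) +ᵥ x) = fun _ => μ x a := by
    funext s
    simp only [Function.comp, hM.invariant_moment]
  rw [h3] at h2
  have h4 := h2.unique (hasDerivAt_const (0 : ℝ) (μ x a))
  have h5 : ∀ y : M, y = x → dfun (fun y => μ y a) y (fundField b y) = 0 →
      dfun (fun y => μ y a) x (fundField b x) = 0 := by
    rintro _ rfl h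
    exact h
  exact h5 _ (by simp) h4

theorem IsSymplecticToric.dmu_fundField (hM : IsSymplecticToric Ω μ) (i : Fin m) (b : LieAlg m)
    (x : M) : dmu μ ξ i x (fundField b x) = 0 :=
  hM.dfun_moment_fundField (ξ i) b x

/-- The forms `dμʲ`, `dtʲ` separate tangent vectors. -/
theorem IsInducedCoord.ext (hX : IsInducedCoord μ ξ J X θ) (hM : IsSymplecticToric Ω μ)
    (hx : x ∈ openPart μ) {v w : TangentSpace (𝓡 (2 * m)) x}
    (h₁ : muPart μ ξ x v = muPart μ ξ x w) (h₂ : anglePart θ x v = anglePart θ x w) : v = w := by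
  let Φ : Model m →ₗ[ℝ] (Fin m → ℝ) × (Fin m → ℝ) :=
    (LinearMap.pi fun j => (dmu μ ξ j x : Model m →L[ℝ] ℝ).toLinearMap).prod
      (LinearMap.pi fun j => (θ j x : Model m →L[ℝ] ℝ).toLinearMap)
  have hs : Function.Surjective Φ := by
    rintro ⟨a, b⟩
    let v : TangentSpace (𝓡 (2 * m)) x := ∑ j, a j • X j x + ∑ j, b j • fundField (ξ j) x
    refine ⟨v, ?_⟩
    have h1 : ∀ i, dmu μ ξ i x v = a i := fun i => by
      simp only [v, map_add, map_sum, map_smul, hX.dmu_X hx, hM.dmu_fundField]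
      simp
    have h2 : ∀ i, θ i x v = b i := fun i => by
      simp only [v, map_add, map_sum, map_smul, hX.angle_X hx, hX.angle_fundField hx]
      simp
    exact Prod.ext (funext h1) (funext h2)
  have hd : Module.finrank ℝ (Model m) = Module.finrank ℝ ((Fin m → ℝ) × (Fin m → ℝ)) := by
    simp [two_mul]
  have hi := (LinearMap.injective_iff_surjective_of_finrank_eq_finrank (f := Φ) hd).2 hs
  exact hi (Prod.ext h₁ h₂)

theorem IsInducedCoord.expand (hX : IsInducedCoord μ ξ J X θ) (hM : IsSymplecticToric Ω μ)
    (hx : x ∈ openPart μ) (v : TangentSpace (𝓡 (2 * m)) x) :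
    v = ∑ j, muPart μ ξ x v j • X j x + ∑ j, anglePart θ x v j • fundField (ξ j) x := by
  refine hX.ext hM hx (funext fun i => ?_) (funext fun i => ?_)
  · simp only [muPart, map_add, map_sum, map_smul, hX.dmu_X hx, hM.dmu_fundField]
    simp
  · simp only [anglePart, map_add, map_sum, map_smul, hX.angle_X hx, hX.angle_fundField hx]
    simp

theorem IsInducedCoord.muPart_antiDiag (hX : IsInducedCoord μ ξ J X θ)
    (hM : IsSymplecticToric Ω μ) (hx : x ∈ openPart μ) (Ψ : M → Matrix (Fin m) (Fin m) ℝ)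
    (v : TangentSpace (𝓡 (2 * m)) x) : muPart μ ξ x (antiDiag μ ξ X θ Ψ x v)
      = - (Ψ x)⁻¹.mulVec (anglePart θ x v) := by
  funext i
  rw [antiDiag_apply]
  simp only [muPart, map_sub, map_sum, map_smul, hX.dmu_X hx, hM.dmu_fundField]
  simp

end Frames

/-! ### The symplectic form and adjoints in the frame. -/

section SymplecticFrame

variable {m : ℕ} {M : Type*} [TopologicalSpace M] [ChartedSpace (Model m) M]
  [IsManifold (𝓡 (2 * m)) ∞ M]
  {Ω : BilinField m M} {x : M}

theorem IsSymplecticForm.ext (hΩ : IsSymplecticForm Ω) {v w : TangentSpace (𝓡 (2 * m)) x}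
    (h : ∀ z, Ω x v z = Ω x w z) : v = w := by
  refine sub_eq_zero.1 (hΩ.nondegenerate x _ fun z => ?_)
  rw [map_sub, sub_apply, h z, sub_self]

theorem IsSymplecticForm.sympAdj_apply (hΩ : IsSymplecticForm Ω) (J : EndField m M)
    (v w : TangentSpace (𝓡 (2 * m)) x) : Ω x (sympAdj Ω J x v) w = Ω x v (J x w) := by
  let B : Model m →L[ℝ] Model m →L[ℝ] ℝ := Ω x
  have hinj : Function.Injective B.toLinearMap := fun v w h =>
    hΩ.ext fun z => DFunLike.congr_fun h z
  have hd : Module.finrank ℝ (Model m) = Module.finrank ℝ (Model m →L[ℝ] ℝ) := by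
    rw [← (LinearMap.toContinuousLinearMap (𝕜 := ℝ) (E := Model m) (F' := ℝ)).finrank_eq]
    exact (Subspace.dual_finrank_eq).symm
  have hsurj := (LinearMap.injective_iff_surjective_of_finrank_eq_finrank
    (f := B.toLinearMap) hd).1 hinj
  let e : Model m ≃L[ℝ] (Model m →L[ℝ] ℝ) :=
    (LinearEquiv.ofBijective B.toLinearMap ⟨hinj, hsurj⟩).toContinuousLinearEquiv
  have he : B = (e : Model m →L[ℝ] Model m →L[ℝ] ℝ) := rfl
  have h1 : ∀ f : Model m →L[ℝ] ℝ, B (B.inverse f) = f := fun f => by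
    rw [he, ContinuousLinearMap.inverse_equiv]
    exact e.apply_symm_apply f
  exact DFunLike.congr_fun (h1 ((B v).comp (J x : Model m →L[ℝ] Model m))) w

variable [AddAction (Torus m) M] {μ : M → DualLieAlg m} {J : EndField m M}
  {ξ : Module.Basis (Fin m) ℝ (LieAlg m)} {X : Fin m → VField m M} {θ : Fin m → CovField m M}

theorem IsSymplecticToric.omega_fundField_left (hM : IsSymplecticToric Ω μ) (i : Fin m)
    (v : TangentSpace (𝓡 (2 * m)) x) : Ω x (fundField (ξ i) x) v = - dmu μ ξ i x v :=
  hM.hamiltonian (ξ i) x v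

theorem IsSymplecticToric.omega_eq_zero_of_mem_orbitSpan (hM : IsSymplecticToric Ω μ)
    (a : LieAlg m) {v : TangentSpace (𝓡 (2 * m)) x} (hv : v ∈ orbitSpan x) :
    Ω x v (fundField a x) = 0 := by
  induction hv using Submodule.span_induction with
  | mem v hv =>
    obtain ⟨b, rfl⟩ := hv
    rw [hM.hamiltonian, hM.dfun_moment_fundField, neg_zero]
  | zero => rw [map_zero]; rfl
  | add v w _ _ h1 h2 => rw [map_add, add_apply, h1, h2, add_zero]
  | smul c v _ h1 => rw [map_smul, smul_apply, h1, smul_zero]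

/-- `J𝒦` is isotropic. -/
theorem IsDGAK.omega_gradField_gradField (hJ : IsDGAK Ω μ univ J) (hM : IsSymplecticToric Ω μ)
    (hx : x ∈ openPart μ) (a b : LieAlg m) : Ω x (gradField J a x) (gradField J b x) = 0 := by
  -- The condition `J^{*Ω}𝒦 = J𝒦` writes `J a^♯` as `J^{*Ω} k` with `k` in `𝒦`. Then `Ω(J^{*Ω} k, J
  -- b^♯) = Ω(k, J J b^♯) = -Ω(k, b^♯)`, and the orbits are isotropic.
  have h1 : J x (fundField a x) ∈ (orbitSpan x).map (sympAdj Ω J x).toLinearMap := by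
    rw [hJ.map_orbitSpan x ⟨mem_univ x, hx⟩]
    exact ⟨_, Submodule.subset_span ⟨a, rfl⟩, rfl⟩
  obtain ⟨k, hk, hk'⟩ := h1
  replace hk' : sympAdj Ω J x k = J x (fundField a x) := hk'
  have h2 : Ω x (J x (fundField a x)) (J x (fundField b x)) = 0 := by
    rw [← hk', hM.symplectic.sympAdj_apply, hJ.sq_eq_neg x (mem_univ x), map_neg,
      hM.omega_eq_zero_of_mem_orbitSpan b hk, neg_zero]
  simp only [gradField, map_neg, neg_apply, h2, neg_zero]

/-- The matrix with entries `dμⁱ(- J K_j)`. -/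
def gradGram (μ : M → DualLieAlg m) (ξ : Module.Basis (Fin m) ℝ (LieAlg m)) (J : EndField m M)
    (x : M) : Matrix (Fin m) (Fin m) ℝ := fun i j => dmu μ ξ i x (gradField J (ξ j) x)

theorem IsInducedCoord.isUnit_det_gradGram (hX : IsInducedCoord μ ξ J X θ)
    (hM : IsSymplecticToric Ω μ) (hJ : IsDGAK Ω μ univ J) (hx : x ∈ openPart μ) :
    IsUnit (gradGram μ ξ J x).det := by
  rw [← Matrix.isUnit_iff_isUnit_det, ← Matrix.mulVec_injective_iff_isUnit]
  intro a b hab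
  rw [← sub_eq_zero]
  set c := a - b with hc
  have hc0 : (gradGram μ ξ J x).mulVec c = 0 := by rw [hc, Matrix.mulVec_sub, hab, sub_self]
  by_contra hne
  have hb0 : ∑ j, c j • ξ j ≠ 0 := fun h =>
    hne (funext (Fintype.linearIndependent_iff.1 ξ.linearIndependent c h))
  have h1 := hX.dfun_moment_gradField_pos hM hJ hx hb0
  have e1 : (gradField J (∑ j, c j • ξ j) x : TangentSpace (𝓡 (2 * m)) x)
      = ∑ j, c j • gradField J (ξ j) x := by
    simp only [gradField, hM.fundField_sum_smul, map_sum, map_smul, smul_neg, Finset.sum_neg_distrib]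
  have e2 : ∀ v, dfun (fun y => μ y (∑ j, c j • ξ j)) x v = ∑ i, c i * dmu μ ξ i x v := fun v => by
    refine (hM.dfun_moment _ x v).trans ?_
    rw [map_sum]
    refine Finset.sum_congr rfl fun i _ => ?_
    rw [map_smul, smul_eq_mul]
    exact congrArg _ (hM.dfun_moment _ x v).symm
  rw [e1, e2] at h1
  refine h1.ne' (Finset.sum_eq_zero fun i _ => ?_)
  have h2 := congrFun hc0 i
  rw [map_sum]
  simp only [map_smul, smul_eq_mul]
  rw [Finset.sum_congr rfl fun j _ => mul_comm (c j) _]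
  exact mul_eq_zero_of_right _ h2

/-- Both families lie in the common kernel of the `dtʲ`, and the Gram matrix changes one into the
other. Smoothness, isotropy and behaviour under the torus thus pass from the fields `-J K_i` to
`∂/∂μʲ`. -/
theorem IsInducedCoord.X_eq_sum (hX : IsInducedCoord μ ξ J X θ)
    (hM : IsSymplecticToric Ω μ) (hJ : IsDGAK Ω μ univ J) (hx : x ∈ openPart μ) (j : Fin m) :
    X j x = ∑ i, (gradGram μ ξ J x)⁻¹ i j • gradField J (ξ i) x := by
  have hG := Matrix.mul_nonsing_inv _ (hX.isUnit_det_gradGram hM hJ hx)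
  refine hX.ext hM hx (funext fun k => ?_) (funext fun k => ?_)
  · have h1 := congrFun (congrFun hG k) j
    rw [Matrix.mul_apply, Matrix.one_apply] at h1
    simp only [muPart, map_sum, map_smul, hX.dmu_X hx]
    rw [← h1]
    exact Finset.sum_congr rfl fun i _ => mul_comm _ _
  · simp only [anglePart, map_sum, map_smul, hX.angle_X hx, hX.angle_gradField hx]
    simp

theorem IsInducedCoord.omega_X_X (hX : IsInducedCoord μ ξ J X θ)
    (hM : IsSymplecticToric Ω μ) (hJ : IsDGAK Ω μ univ J) (hx : x ∈ openPart μ) (i j : Fin m) :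
    Ω x (X i x) (X j x) = 0 := by
  rw [hX.X_eq_sum hM hJ hx i, hX.X_eq_sum hM hJ hx j]
  simp only [map_sum, map_smul, sum_apply, smul_apply, hJ.omega_gradField_gradField hM hx]
  simp

/-- `Ω = ∑ dμⁱ ∧ dtⁱ` on `M°`. -/
theorem IsInducedCoord.omega_eq (hX : IsInducedCoord μ ξ J X θ)
    (hM : IsSymplecticToric Ω μ) (hJ : IsDGAK Ω μ univ J) (hx : x ∈ openPart μ)
    (v w : TangentSpace (𝓡 (2 * m)) x) :
    Ω x v w = muPart μ ξ x v ⬝ᵥ anglePart θ x w - anglePart θ x v ⬝ᵥ muPart μ ξ x w := by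
  have hXw : ∀ i, Ω x (X i x) w = anglePart θ x w i := fun i => by
    conv_lhs => rw [hX.expand hM hx w]
    have h1 : ∀ j, Ω x (X i x) (fundField (ξ j) x) = if j = i then 1 else 0 := fun j => by
      rw [hM.symplectic.antisymm, hM.omega_fundField_left, neg_neg, hX.dmu_X hx]
    simp only [map_add, map_sum, map_smul, hX.omega_X_X hM hJ hx, h1]
    simp
  conv_lhs => rw [hX.expand hM hx v]
  simp only [map_add, map_sum, map_smul, add_apply, sum_apply, smul_apply, hXw,
    hM.omega_fundField_left, smul_eq_mul, mul_neg, Finset.sum_neg_distrib]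
  rfl

/-- In the pairing `Ω = ∑ dμⁱ ∧ dtⁱ`, moving an anti-diagonal endomorphism to the other side
transposes its matrix and changes its sign. -/
theorem IsInducedCoord.sympAdj_eq (hX : IsInducedCoord μ ξ J X θ)
    (hM : IsSymplecticToric Ω μ) (hJ : IsDGAK Ω μ univ J) (hx : x ∈ openPart μ)
    {J' : EndField m M} {Ψ Ψ' : M → Matrix (Fin m) (Fin m) ℝ}
    (hJ' : J' x = antiDiag μ ξ X θ Ψ x) (hΨ : IsUnit (Ψ x).det)
    (hΨ' : Ψ' x = - (Ψ x).transpose) :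
    sympAdj Ω J' x = antiDiag μ ξ X θ Ψ' x := by
  refine ContinuousLinearMap.ext fun v => hM.symplectic.ext fun w => ?_
  rw [hM.symplectic.sympAdj_apply, hJ', hX.omega_eq hM hJ hx, hX.omega_eq hM hJ hx,
    hX.muPart_antiDiag hM hx, hX.anglePart_antiDiag hx, hX.muPart_antiDiag hM hx,
    hX.anglePart_antiDiag hx, hΨ']
  have h1 : (-(Ψ x).transpose)⁻¹ = -((Ψ x)⁻¹).transpose := by
    refine Matrix.inv_eq_left_inv ?_
    rw [neg_mul_neg, ← Matrix.transpose_mul, Matrix.mul_nonsing_inv _ hΨ,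
      Matrix.transpose_one]
  rw [h1]
  simp only [Matrix.neg_mulVec, neg_neg, dotProduct_neg, neg_dotProduct, Matrix.mulVec_transpose,
    Matrix.dotProduct_mulVec]
  ring

end SymplecticFrame

/-! ### Smoothness and torus invariance of the frame components. -/

section SmoothEnd

variable {m : ℕ} {M : Type*} [TopologicalSpace M] [ChartedSpace (Model m) M]

theorem contMDiffAt_clm_of_forall {x : M} {f : M → Model m →L[ℝ] Model m}
    (h : ∀ v, ContMDiffAt (𝓡 (2 * m)) 𝓘(ℝ, Model m) ∞ (fun y => f y v) x) :
    ContMDiffAt (𝓡 (2 * m)) 𝓘(ℝ, Model m →L[ℝ] Model m) ∞ f x := by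
  let b := EuclideanSpace.basisFun (Fin (2 * m)) ℝ
  have h1 : f = fun y => ∑ k, (ContinuousLinearMap.smulRightL ℝ (Model m) (Model m)
      (EuclideanSpace.proj k)) (f y (b k)) := by
    funext y
    refine ContinuousLinearMap.ext fun v => ?_
    conv_lhs => rw [← b.sum_repr v]
    simp [map_sum, b]
  rw [h1]
  refine contMDiffAt_finsetSum fun k _ => ?_
  exact ((ContinuousLinearMap.smulRightL ℝ (Model m) (Model m)
      (EuclideanSpace.proj k)).contMDiff _).comp x (h (b k))

theorem contMDiffAt_det {x : M} {n : ℕ} {G : M → Matrix (Fin n) (Fin n) ℝ}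
    (hG : ∀ i j, ContMDiffAt (𝓡 (2 * m)) 𝓘(ℝ, ℝ) ∞ (fun y => G y i j) x) :
    ContMDiffAt (𝓡 (2 * m)) 𝓘(ℝ, ℝ) ∞ (fun y => (G y).det) x := by
  simp only [Matrix.det_apply']
  refine contMDiffAt_finsetSum fun σ _ => ?_
  exact contMDiffAt_const.mul (contMDiffAt_finsetProd fun i _ => hG _ _)

theorem contMDiffAt_matrix_inv {x : M} {n : ℕ} {G : M → Matrix (Fin n) (Fin n) ℝ}
    (hG : ∀ i j, ContMDiffAt (𝓡 (2 * m)) 𝓘(ℝ, ℝ) ∞ (fun y => G y i j) x)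
    (hx : IsUnit (G x).det) (i j : Fin n) :
    ContMDiffAt (𝓡 (2 * m)) 𝓘(ℝ, ℝ) ∞ (fun y => (G y)⁻¹ i j) x := by
  simp only [Matrix.inv_def, Ring.inverse_eq_inv', Matrix.smul_apply, smul_eq_mul,
    Matrix.adjugate_apply]
  have h1 : ContMDiffAt (𝓡 (2 * m)) 𝓘(ℝ, ℝ) ∞ (fun y => ((G y).det)⁻¹) x :=
    (contDiffAt_inv ℝ hx.ne_zero).contMDiffAt.comp x (contMDiffAt_det hG)
  refine h1.mul (contMDiffAt_det fun k l => ?_)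
  by_cases hk : k = j
  · subst hk
    simp only [Matrix.updateRow_self]
    exact contMDiffAt_const
  · simp only [Matrix.updateRow_ne hk]
    exact hG k l

section

variable [IsManifold (𝓡 (2 * m)) ∞ M]

/-- A field of endomorphisms that maps smooth fields to smooth fields is smooth. -/
theorem smoothEndOn_of_forall {J : EndField m M} {U : Set M}
    (h : ∀ x ∈ U, ∀ Y : VField m M, SmoothVFieldAt Y x → SmoothVFieldAt (fun y => J y (Y y)) x) :
    SmoothEndOn J U := by
  intro x hx
  refine ContMDiffAt.contMDiffWithinAt ?_
  rw [contMDiffAt_hom_bundle]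
  refine ⟨contMDiffAt_id, ?_⟩
  refine contMDiffAt_clm_of_forall fun v => ?_
  set e := trivializationAt (Model m) (TangentSpace (𝓡 (2 * m)) : M → Type _) x with he
  have hxe : x ∈ e.baseSet := mem_baseSet_trivializationAt (Model m) _ x
  let Y : VField m M := fun y => e.symm y v
  have hY : SmoothVFieldAt Y x := by
    refine (contMDiffAt_section x).2 ?_
    refine (contMDiffAt_const (c := v)).congr_of_eventuallyEq ?_
    filter_upwards [e.open_baseSet.mem_nhds hxe] with y hy
    rw [e.apply_mk_symm hy]
  have h1 := (contMDiffAt_section x).1 (h x hx Y hY)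
  refine h1.congr_of_eventuallyEq ?_
  filter_upwards [e.open_baseSet.mem_nhds hxe] with y hy
  simp only [ContinuousLinearMap.inCoordinates, ContinuousLinearMap.comp_apply, ← he]
  rw [Trivialization.continuousLinearMapAt_apply, Trivialization.linearMapAt_apply, if_pos hy,
    e.symmL_apply hy]

end

variable [AddAction (Torus m) M] {μ : M → DualLieAlg m} {J : EndField m M} {Ω : BilinField m M}
  {ξ : Module.Basis (Fin m) ℝ (LieAlg m)} {X : Fin m → VField m M} {θ : Fin m → CovField m M}
  {x : M}

theorem IsInducedCoord.exists_angle (hX : IsInducedCoord μ ξ J X θ) (hx : x ∈ openPart μ) :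
    ∃ t : Fin m → M → ℝ, (∀ i, ContMDiffAt (𝓡 (2 * m)) 𝓘(ℝ, ℝ) ∞ (t i) x) ∧
      ∀ᶠ y in 𝓝 x, ∀ i, θ i y = dfun (t i) y := by
  obtain ⟨V, u, t, hpV, hV, h⟩ := hX x hx
  refine ⟨t, fun i => (hV.smooth_t i).contMDiffAt (hV.isOpen.mem_nhds hpV), ?_⟩
  filter_upwards [hV.isOpen.mem_nhds hpV] with y hy using (h y hy).1

variable [IsManifold (𝓡 (2 * m)) ∞ M]

theorem IsSymplecticToric.contMDiffAt_dmu (hM : IsSymplecticToric Ω μ) {Y : VField m M}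
    (hY : SmoothVFieldAt Y x) (i : Fin m) :
    ContMDiffAt (𝓡 (2 * m)) 𝓘(ℝ, ℝ) ∞ (fun y => dmu μ ξ i y (Y y)) x :=
  hY.dfun_apply (hM.contMDiff_moment_apply (ξ i) x)

theorem IsInducedCoord.contMDiffAt_angle (hX : IsInducedCoord μ ξ J X θ) (hx : x ∈ openPart μ)
    {Y : VField m M} (hY : SmoothVFieldAt Y x) (i : Fin m) :
    ContMDiffAt (𝓡 (2 * m)) 𝓘(ℝ, ℝ) ∞ (fun y => θ i y (Y y)) x := by
  obtain ⟨t, ht, h⟩ := hX.exists_angle hx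
  refine (hY.dfun_apply (ht i)).congr_of_eventuallyEq ?_
  filter_upwards [h] with y hy
  rw [hy i]

theorem IsInducedCoord.smoothVFieldAt_X (hX : IsInducedCoord μ ξ J X θ)
    (hM : IsSymplecticToric Ω μ) (hJ : IsDGAK Ω μ univ J) (hx : x ∈ openPart μ) (j : Fin m) :
    SmoothVFieldAt (X j) x := by
  have h1 : SmoothVFieldAt (fun y => ∑ i, (gradGram μ ξ J y)⁻¹ i j • gradField J (ξ i) y) x := by
    refine SmoothVFieldAt.sum fun i _ => SmoothVFieldAt.smul ?_ (hM.smoothVFieldAt_gradField hJ _ x)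
    refine contMDiffAt_matrix_inv (fun k l => ?_) (hX.isUnit_det_gradGram hM hJ hx) i j
    exact hM.contMDiffAt_dmu (hM.smoothVFieldAt_gradField hJ _ x) k
  refine h1.congr ?_
  filter_upwards [hM.isOpen_openPart.mem_nhds hx] with y hy using hX.X_eq_sum hM hJ hy j

theorem IsInducedCoord.smoothVFieldAt_antiDiag (hX : IsInducedCoord μ ξ J X θ)
    (hM : IsSymplecticToric Ω μ) (hJ : IsDGAK Ω μ univ J) (hx : x ∈ openPart μ)
    {Ψ : M → Matrix (Fin m) (Fin m) ℝ}
    (hΨ : ∀ i j, ContMDiffAt (𝓡 (2 * m)) 𝓘(ℝ, ℝ) ∞ (fun y => Ψ y i j) x)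
    (hdet : IsUnit (Ψ x).det) {Y : VField m M} (hY : SmoothVFieldAt Y x) :
    SmoothVFieldAt (fun y => antiDiag μ ξ X θ Ψ y (Y y)) x := by
  have h1 : SmoothVFieldAt (fun y => ∑ i, (Ψ y).mulVec (muPart μ ξ y (Y y)) i • fundField (ξ i) y
      + - ∑ i, (Ψ y)⁻¹.mulVec (anglePart θ y (Y y)) i • X i y) x := by
    refine SmoothVFieldAt.add (SmoothVFieldAt.sum fun i _ => ?_)
      (SmoothVFieldAt.neg (SmoothVFieldAt.sum fun i _ => ?_))
    · refine SmoothVFieldAt.smul ?_ (smoothVFieldAt_fundField hM _ x)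
      simp only [Matrix.mulVec, dotProduct]
      exact contMDiffAt_finsetSum fun j _ => (hΨ i j).mul (hM.contMDiffAt_dmu hY j)
    · refine SmoothVFieldAt.smul ?_ (hX.smoothVFieldAt_X hM hJ hx i)
      simp only [Matrix.mulVec, dotProduct]
      exact contMDiffAt_finsetSum fun j _ =>
        (contMDiffAt_matrix_inv hΨ hdet i j).mul (hX.contMDiffAt_angle hx hY j)
  refine h1.congr (Filter.Eventually.of_forall fun y => ?_)
  rw [antiDiag_apply, sub_eq_add_neg]

theorem IsSymplecticToric.muPart_actDeriv (hM : IsSymplecticToric Ω μ) (g : Torus m)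
    (v : TangentSpace (𝓡 (2 * m)) x) :
    muPart μ ξ (g +ᵥ x) (actDeriv g x v) = muPart μ ξ x v := by
  funext i
  have h1 := (hasMFDerivAt_dfun ((hM.contMDiff_moment_apply (ξ i)).mdifferentiable (by simp)
    (g +ᵥ x))).comp x (hM.hasMFDerivAt_vadd g x)
  have h2 : (fun y => μ y (ξ i)) ∘ (fun y : M => g +ᵥ y) = fun y => μ y (ξ i) := by
    funext y
    simp only [Function.comp, hM.invariant_moment]
  rw [h2] at h1
  exact (DFunLike.congr_fun h1.mfderiv v).symm

theorem IsSymplecticToric.actDeriv_gradField (hM : IsSymplecticToric Ω μ)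
    (hJ : IsDGAK Ω μ univ J) (g : Torus m) (x : M) (a : LieAlg m) :
    actDeriv g x (gradField J a x) = gradField J a (g +ᵥ x) := by
  simp only [gradField]
  rw [map_neg, hJ.invariant g x (mem_univ x), hM.actDeriv_fundField]

theorem IsInducedCoord.anglePart_actDeriv (hX : IsInducedCoord μ ξ J X θ)
    (hM : IsSymplecticToric Ω μ) (hJ : IsDGAK Ω μ univ J) (hx : x ∈ openPart μ) (g : Torus m)
    (v : TangentSpace (𝓡 (2 * m)) x) :
    anglePart θ (g +ᵥ x) (actDeriv g x v) = anglePart θ x v := by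
  have hgx : g +ᵥ x ∈ openPart μ := (hM.vadd_mem_openPart g).2 hx
  funext i
  have h1 : ∀ j, θ i (g +ᵥ x) (actDeriv g x (X j x)) = 0 := fun j => by
    rw [hX.X_eq_sum hM hJ hx j]
    simp only [map_sum, map_smul, hM.actDeriv_gradField hJ, hX.angle_gradField hgx, smul_zero,
      Finset.sum_const_zero]
  simp only [anglePart]
  conv_lhs => rw [hX.expand hM hx v]
  simp only [map_add, map_sum, map_smul, h1, hM.actDeriv_fundField, hX.angle_fundField hgx]
  simp [anglePart]

end SmoothEnd

theorem differentiableAt_of_contDiffOn {D : Type*} [NormedAddCommGroup D] [NormedSpace ℝ D]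
    {f : D → ℝ} {S : Set D} (hf : ContDiffOn ℝ ∞ f S) (hS : IsOpen S) {y : D} (hy : y ∈ S) :
    DifferentiableAt ℝ f y :=
  (hf.contDiffAt (hS.mem_nhds hy)).differentiableAt (by simp)

/-! ### The Nijenhuis tensor of an anti-diagonal structure. -/

section Integrability

variable {m : ℕ} {M : Type*} [TopologicalSpace M] [ChartedSpace (Model m) M]

theorem dfun_congr {f g : M → ℝ} {x : M} (h : f =ᶠ[𝓝 x] g) :
    dfun (m := m) f x = dfun g x :=
  Filter.EventuallyEq.mfderiv_eq h

theorem dfun_neg (f : M → ℝ) (x : M) :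
    dfun (m := m) (fun y => - f y) x = - dfun f x :=
  mfderiv_neg

theorem dfun_const (c : ℝ) (x : M) : dfun (m := m) (fun _ => c) x = 0 :=
  mfderiv_const

variable [IsManifold (𝓡 (2 * m)) ∞ M]

/-- The differential of a function with a `J`-conjugate vanishes on the Nijenhuis tensor. -/
theorem dfun_nijenhuis_eq_zero {J : EndField m M} {x : M} {f g : M → ℝ}
    (hf : ContMDiffAt (𝓡 (2 * m)) 𝓘(ℝ, ℝ) ∞ f x) (hg : ContMDiffAt (𝓡 (2 * m)) 𝓘(ℝ, ℝ) ∞ g x)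
    (hfg : ∀ᶠ y in 𝓝 x, ∀ v, dfun f y (J y v) = dfun g y v)
    (hgf : ∀ᶠ y in 𝓝 x, ∀ v, dfun g y (J y v) = - dfun f y v) {Y Z : VField m M}
    (hY : SmoothVFieldAt Y x) (hZ : SmoothVFieldAt Z x)
    (hJY : SmoothVFieldAt (fun y => J y (Y y)) x) (hJZ : SmoothVFieldAt (fun y => J y (Z y)) x) :
    dfun f x (nijenhuis J Y Z x) = 0 := by
  have hfgx := hfg.self_of_nhds
  have e1 : ∀ W : VField m M, (fun y => dfun f y (J y (W y))) =ᶠ[𝓝 x] fun y => dfun g y (W y) :=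
    fun W => hfg.mono fun y hy => hy (W y)
  have e2 : ∀ W : VField m M, (fun y => dfun g y (J y (W y))) =ᶠ[𝓝 x] fun y => - dfun f y (W y) :=
    fun W => hgf.mono fun y hy => hy (W y)
  simp only [nijenhuis, map_sub, hfgx]
  rw [dfun_mlieBracket hf hJY hJZ, dfun_mlieBracket hg hJY hZ, dfun_mlieBracket hg hY hJZ,
    dfun_mlieBracket hf hY hZ, dfun_congr (e1 Y), dfun_congr (e1 Z), dfun_congr (e2 Y),
    dfun_congr (e2 Z), dfun_neg, dfun_neg, neg_apply, neg_apply]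
  ring

variable [AddAction (Torus m) M] {μ : M → DualLieAlg m} {J : EndField m M} {Ω : BilinField m M}
  {ξ : Module.Basis (Fin m) ℝ (LieAlg m)} {X : Fin m → VField m M} {θ : Fin m → CovField m M}
  {x : M}

theorem IsSymplecticToric.momentDeriv_eq (hM : IsSymplecticToric Ω μ)
    (v : TangentSpace (𝓡 (2 * m)) x) :
    momentDeriv μ x v = ∑ k, muPart μ ξ x v k • dualVec ξ k := by
  rw [← sum_apply_smul_dualVec ξ (momentDeriv μ x v)]
  refine Finset.sum_congr rfl fun k _ => ?_
  exact congrArg (fun c : ℝ => c • dualVec ξ k) (hM.dfun_moment (ξ k) x v).symm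

theorem IsSymplecticToric.dfun_comp_moment (hM : IsSymplecticToric Ω μ) {f : DualLieAlg m → ℝ}
    (hf : DifferentiableAt ℝ f (μ x)) (v : TangentSpace (𝓡 (2 * m)) x) :
    dfun (fun y => f (μ y)) x v = ∑ k, muPart μ ξ x v k * fderiv ℝ f (μ x) (dualVec ξ k) := by
  have h1 : HasMFDerivAt 𝓘(ℝ, DualLieAlg m) 𝓘(ℝ, ℝ) f (μ x) (fderiv ℝ f (μ x)) :=
    hf.hasFDerivAt.hasMFDerivAt
  have h2 : dfun (fun y => f (μ y)) x v = fderiv ℝ f (μ x) (momentDeriv μ x v) :=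
    DFunLike.congr_fun (h1.comp x (hM.hasMFDerivAt_moment x)).mfderiv v
  rw [h2, hM.momentDeriv_eq (ξ := ξ) v, map_sum]
  simp only [map_smul, smul_eq_mul]

theorem IsInducedCoord.dfun_comp_moment_X (hX : IsInducedCoord μ ξ J X θ)
    (hM : IsSymplecticToric Ω μ) (hx : x ∈ openPart μ) {f : DualLieAlg m → ℝ}
    (hf : DifferentiableAt ℝ f (μ x)) (k : Fin m) :
    dfun (fun y => f (μ y)) x (X k x) = fderiv ℝ f (μ x) (dualVec ξ k) := by
  rw [hM.dfun_comp_moment (ξ := ξ) hf]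
  simp only [muPart, hX.dmu_X hx]
  simp

theorem IsSymplecticToric.contMDiffAt_comp_moment (hM : IsSymplecticToric Ω μ)
    (hx : x ∈ openPart μ) {f : DualLieAlg m → ℝ} (hf : ContDiffOn ℝ ∞ f (polyInt μ)) :
    ContMDiffAt (𝓡 (2 * m)) 𝓘(ℝ, ℝ) ∞ (fun y => f (μ y)) x :=
  ContMDiffAt.comp_of_eq (g := f) (hf.contDiffAt (isOpen_interior.mem_nhds hx)).contMDiffAt
    (hM.smooth_moment x) rfl

/-- The fields `X j` have constant components, and `J' (X j)` is vertical with `dt`-components the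
`j`-th column of `P ∘ μ`. So only the two mixed brackets contribute: their `dt`-components are
derivatives of `P`, which `J'` sends to `dμ`-components through `-P⁻¹`. -/
theorem IsInducedCoord.nijenhuis_X_X (hX : IsInducedCoord μ ξ J X θ)
    (hM : IsSymplecticToric Ω μ) (hJ : IsDGAK Ω μ univ J) (hx : x ∈ openPart μ)
    {J' : EndField m M} {P : DualLieAlg m → Matrix (Fin m) (Fin m) ℝ}
    (hP : ∀ i j, ContDiffOn ℝ ∞ (fun y => P y i j) (polyInt μ))
    (hdet : ∀ y ∈ polyInt μ, IsUnit (P y).det)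
    (hJ' : ∀ x ∈ openPart μ, J' x = antiDiag μ ξ X θ (fun x => P (μ x)) x) (j k : Fin m) :
    muPart μ ξ x (nijenhuis J' (X j) (X k) x) = - (P (μ x))⁻¹.mulVec (fun i =>
      fderiv ℝ (fun y => P y i j) (μ x) (dualVec ξ k)
        - fderiv ℝ (fun y => P y i k) (μ x) (dualVec ξ j)) := by
  have hnear : ∀ᶠ y in 𝓝 x, y ∈ openPart μ := hM.isOpen_openPart.mem_nhds hx
  have hsX := hX.smoothVFieldAt_X hM hJ hx
  have hΨ : ∀ i j, ContMDiffAt (𝓡 (2 * m)) 𝓘(ℝ, ℝ) ∞ (fun y => P (μ y) i j) x := fun i j =>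
    hM.contMDiffAt_comp_moment hx (hP i j)
  have hsJ : ∀ j, SmoothVFieldAt (fun y => J' y (X j y)) x := fun j =>
    (hX.smoothVFieldAt_antiDiag hM hJ hx (Ψ := fun x => P (μ x)) hΨ (hdet _ hx) (hsX j)).congr
      (hnear.mono fun y hy => by rw [hJ' y hy])
  have hmuX : ∀ y ∈ openPart μ, ∀ j, muPart μ ξ y (X j y) = Pi.single j 1 := fun y hy j => by
    funext i
    simp only [muPart, hX.dmu_X hy, Pi.single_apply]
  have hangX : ∀ y ∈ openPart μ, ∀ j, anglePart θ y (X j y) = 0 := fun y hy j => by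
    funext i
    exact hX.angle_X hy i j
  obtain ⟨t, ht, htθ⟩ := hX.exists_angle hx
  have hbr : ∀ (A B : VField m M) (c : Fin m → ℝ), SmoothVFieldAt A x → SmoothVFieldAt B x →
      (∀ i, dfun (fun y => θ i y (B y)) x (A x) - dfun (fun y => θ i y (A y)) x (B x) = c i) →
      anglePart θ x (VectorField.mlieBracket (𝓡 (2 * m)) A B x) = c := by
    intro A B c hA hB h
    funext i
    rw [← h i]
    simp only [anglePart]
    have e1 : ∀ Y : VField m M, (fun y => θ i y (Y y)) =ᶠ[𝓝 x] fun y => dfun (t i) y (Y y) :=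
      fun Y => htθ.mono fun y hy => congrArg (fun α : Model m →L[ℝ] ℝ => α (Y y)) (hy i)
    rw [htθ.self_of_nhds i, dfun_mlieBracket (ht i) hA hB, dfun_congr (e1 A), dfun_congr (e1 B)]
  have hθJ : ∀ i j, (fun y => θ i y (J' y (X j y))) =ᶠ[𝓝 x] fun y => P (μ y) i j := fun i j => by
    filter_upwards [hnear] with y hy
    have h1 := congrFun (hX.anglePart_antiDiag hy (fun x => P (μ x)) (X j y)) i
    rw [← hJ' y hy, hmuX y hy j] at h1
    simpa [anglePart] using h1
  have hθX : ∀ i j, (fun y => θ i y (X j y)) =ᶠ[𝓝 x] fun _ => 0 := fun i j =>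
    hnear.mono fun y hy => hX.angle_X hy i j
  have hμJ : ∀ i j, (fun y => dmu μ ξ i y (J' y (X j y))) =ᶠ[𝓝 x] fun _ => 0 := fun i j => by
    filter_upwards [hnear] with y hy
    have h1 := congrFun (hX.muPart_antiDiag hM hy (fun x => P (μ x)) (X j y)) i
    rw [← hJ' y hy, hangX y hy j] at h1
    simpa [muPart] using h1
  have hμX : ∀ i j, (fun y => dmu μ ξ i y (X j y)) =ᶠ[𝓝 x] fun _ => if i = j then 1 else 0 :=
    fun i j => hnear.mono fun y hy => hX.dmu_X hy i j
  have hder : ∀ i j k, dfun (fun y => P (μ y) i j) x (X k x)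
      = fderiv ℝ (fun y => P y i j) (μ x) (dualVec ξ k) := fun i j k =>
    hX.dfun_comp_moment_X hM hx (f := fun y => P y i j)
      (differentiableAt_of_contDiffOn (hP i j) isOpen_interior hx) k
  have hμs : ∀ i, ContMDiffAt (𝓡 (2 * m)) 𝓘(ℝ, ℝ) ∞ (fun y => μ y (ξ i)) x := fun i =>
    hM.contMDiff_moment_apply (ξ i) x
  have b1 : muPart μ ξ x (VectorField.mlieBracket (𝓡 (2 * m)) (fun y => J' y (X j y))
      (fun y => J' y (X k y)) x) = 0 := by
    funext i
    refine (dfun_mlieBracket (hμs i) (hsJ j) (hsJ k)).trans ?_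
    have h1 := dfun_congr (m := m) (hμJ i k)
    have h2 := dfun_congr (m := m) (hμJ i j)
    simp only [dmu] at h1 h2
    rw [h1, h2, dfun_const]
    simp
  have b2 : muPart μ ξ x (VectorField.mlieBracket (𝓡 (2 * m)) (X j) (X k) x) = 0 := by
    funext i
    refine (dfun_mlieBracket (hμs i) (hsX j) (hsX k)).trans ?_
    have h1 := dfun_congr (m := m) (hμX i k)
    have h2 := dfun_congr (m := m) (hμX i j)
    simp only [dmu] at h1 h2
    rw [h1, h2, dfun_const, dfun_const]
    simp
  have b3 := hbr (fun y => J' y (X j y)) (X k)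
    (fun i => - fderiv ℝ (fun y => P y i j) (μ x) (dualVec ξ k)) (hsJ j) (hsX k) fun i => by
      rw [dfun_congr (hθX i k), dfun_congr (hθJ i j), dfun_const, hder]
      simp
  have b4 := hbr (X j) (fun y => J' y (X k y))
    (fun i => fderiv ℝ (fun y => P y i k) (μ x) (dualVec ξ j)) (hsX j) (hsJ k) fun i => by
      rw [dfun_congr (hθX i j), dfun_congr (hθJ i k), dfun_const, hder]
      simp
  have hsub : ∀ v w : TangentSpace (𝓡 (2 * m)) x,
      muPart μ ξ x (v - w) = muPart μ ξ x v - muPart μ ξ x w := fun v w => by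
    funext i
    exact map_sub _ _ _
  simp only [nijenhuis, hsub, b1, b2]
  rw [hJ' x hx, hX.muPart_antiDiag hM hx, hX.muPart_antiDiag hM hx, b3, b4]
  have h5 : (fun i => fderiv ℝ (fun y => P y i j) (μ x) (dualVec ξ k)
        - fderiv ℝ (fun y => P y i k) (μ x) (dualVec ξ j))
      = - (fun i => - fderiv ℝ (fun y => P y i j) (μ x) (dualVec ξ k))
        - (fun i => fderiv ℝ (fun y => P y i k) (μ x) (dualVec ξ j)) := by
    funext i
    simp
  rw [h5, Matrix.mulVec_sub, Matrix.mulVec_neg]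
  abel

/-- Integrability of an anti-diagonal almost complex structure in terms of its matrix. -/
theorem IsInducedCoord.integrableOn_iff [T2Space M] [CompactSpace M] [ConnectedSpace M]
    (hX : IsInducedCoord μ ξ J X θ) (hM : IsSymplecticToric Ω μ) (hJ : IsDGAK Ω μ univ J)
    {J' : EndField m M} {P : DualLieAlg m → Matrix (Fin m) (Fin m) ℝ}
    (hP : ∀ i j, ContDiffOn ℝ ∞ (fun y => P y i j) (polyInt μ))
    (hdet : ∀ y ∈ polyInt μ, IsUnit (P y).det)
    (hJ' : ∀ x ∈ openPart μ, J' x = antiDiag μ ξ X θ (fun x => P (μ x)) x) :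
    IntegrableOn J' (openPart μ) ↔ ∀ y ∈ polyInt μ, ∀ i j k,
      fderiv ℝ (fun y => P y i j) y (dualVec ξ k) = fderiv ℝ (fun y => P y i k) y (dualVec ξ j) := by
  constructor
  · intro h y hy i j k
    obtain ⟨x, rfl⟩ := interior_subset hy
    have h1 := hX.nijenhuis_X_X hM hJ hy hP hdet hJ' j k
    rw [h x hy _ _ (hX.smoothVFieldAt_X hM hJ hy j) (hX.smoothVFieldAt_X hM hJ hy k)] at h1
    have h0 : muPart μ ξ x (0 : TangentSpace (𝓡 (2 * m)) x) = 0 := funext fun i => map_zero _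
    rw [h0, eq_comm, neg_eq_zero] at h1
    have h2 := congrArg (P (μ x)).mulVec h1
    rw [Matrix.mulVec_mulVec, Matrix.mul_nonsing_inv _ (hdet _ hy), Matrix.one_mulVec,
      Matrix.mulVec_zero] at h2
    exact sub_eq_zero.1 (congrFun h2 i)
  · intro h x hx Y Z hY hZ
    have hnear : ∀ᶠ y in 𝓝 x, y ∈ openPart μ := hM.isOpen_openPart.mem_nhds hx
    have hJs : ∀ W : VField m M, SmoothVFieldAt W x → SmoothVFieldAt (fun y => J' y (W y)) x :=
      fun W hW => (hX.smoothVFieldAt_antiDiag hM hJ hx (Ψ := fun x => P (μ x))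
        (fun i j => hM.contMDiffAt_comp_moment hx (hP i j)) (hdet _ hx) hW).congr
        (hnear.mono fun y hy => by rw [hJ' y hy])
    obtain ⟨t, ht, htθ⟩ := hX.exists_angle hx
    -- Convexity of `Δ°` enters here: the closed rows have primitives `H i`. The functions `H i ∘ μ`
    -- and `t i` are `J'`-conjugate, and their differentials separate vectors, so `N(Y, Z)` vanishes
    -- for arbitrary `Y`, `Z` without an appeal to tensoriality.
    have hprim := fun i => exists_primitive (e := dualVec ξ) (ε := fun i => evalAt (ξ i))
      (sum_apply_smul_dualVec ξ) isOpen_interior (hX.convex_polyInt hM hJ)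
      (p := fun j y => P y i j) (hP i) (fun y hy j k => h y hy i j k)
    choose H hHs hHd using hprim
    set h' : Fin m → M → ℝ := fun i y => H i (μ y) with hh'
    have hh's : ∀ i, ContMDiffAt (𝓡 (2 * m)) 𝓘(ℝ, ℝ) ∞ (h' i) x := fun i =>
      hM.contMDiffAt_comp_moment hx (hHs i)
    have hh'd : ∀ i, ∀ y ∈ openPart μ, ∀ v, dfun (h' i) y v
        = (P (μ y)).mulVec (muPart μ ξ y v) i := by
      intro i y hy v
      refine (hM.dfun_comp_moment (ξ := ξ) (hHd i _ hy).differentiableAt v).trans ?_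
      rw [(hHd i _ hy).fderiv]
      simp only [Matrix.mulVec, dotProduct]
      refine Finset.sum_congr rfl fun k _ => ?_
      rw [mul_comm]
      congr 1
      simp [sum_apply, smul_apply, evalAt_apply, dualVec_apply_basis]
    have hθJ : ∀ i, ∀ᶠ y in 𝓝 x, ∀ v, dfun (t i) y (J' y v) = dfun (h' i) y v := fun i => by
      filter_upwards [hnear, htθ] with y hy hyt v
      rw [hh'd i y hy, ← hyt i, hJ' y hy]
      exact congrFun (hX.anglePart_antiDiag hy (fun x => P (μ x)) v) i
    have hhJ : ∀ i, ∀ᶠ y in 𝓝 x, ∀ v, dfun (h' i) y (J' y v) = - dfun (t i) y v := fun i => by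
      filter_upwards [hnear, htθ] with y hy hyt v
      rw [hh'd i y hy, ← hyt i, hJ' y hy, hX.muPart_antiDiag hM hy, Matrix.mulVec_neg,
        Matrix.mulVec_mulVec, Matrix.mul_nonsing_inv _ (hdet _ hy), Matrix.one_mulVec]
      rfl
    have hn1 : ∀ i, dfun (t i) x (nijenhuis J' Y Z x) = 0 := fun i =>
      dfun_nijenhuis_eq_zero (ht i) (hh's i) (hθJ i) (hhJ i) hY hZ (hJs Y hY) (hJs Z hZ)
    have hn2 : ∀ i, dfun (h' i) x (nijenhuis J' Y Z x) = 0 := fun i => by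
      refine dfun_nijenhuis_eq_zero (g := fun y => - t i y) (hh's i) (ht i).neg ?_ ?_ hY hZ
        (hJs Y hY) (hJs Z hZ)
      · filter_upwards [hhJ i] with y hy v
        rw [hy v, dfun_neg, neg_apply]
      · filter_upwards [hθJ i] with y hy v
        rw [dfun_neg, neg_apply, hy v]
    refine hX.ext hM hx ?_ ?_
    · have h2 : (P (μ x)).mulVec (muPart μ ξ x (nijenhuis J' Y Z x)) = 0 := funext fun i => by
        rw [← hh'd i x hx, hn2 i]
        rfl
      have h3 := congrArg (P (μ x))⁻¹.mulVec h2
      rw [Matrix.mulVec_mulVec, Matrix.nonsing_inv_mul _ (hdet _ hx), Matrix.one_mulVec,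
        Matrix.mulVec_zero] at h3
      rw [h3]
      exact funext fun i => (map_zero _).symm
    · funext i
      simp only [anglePart, map_zero]
      rw [htθ.self_of_nhds i, hn1 i]

end Integrability

/-! ### Symmetry of second and third derivatives. -/

section Hessian

variable {D : Type*} [NormedAddCommGroup D] [NormedSpace ℝ D] {V : Set D}

theorem contDiffOn_fderiv_apply (hV : IsOpen V) {f : D → ℝ} (hf : ContDiffOn ℝ ∞ f V) (v : D) :
    ContDiffOn ℝ ∞ (fun y => fderiv ℝ f y v) V :=
  (hf.fderiv_of_isOpen hV (by simp)).clm_apply contDiffOn_const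

theorem fderiv_fderiv_apply_comm (hV : IsOpen V) {f : D → ℝ} (hf : ContDiffOn ℝ ∞ f V) {y : D}
    (hy : y ∈ V) (v w : D) :
    fderiv ℝ (fun z => fderiv ℝ f z v) y w = fderiv ℝ (fun z => fderiv ℝ f z w) y v := by
  have hd : DifferentiableAt ℝ (fderiv ℝ f) y :=
    ((hf.fderiv_of_isOpen hV (m := ∞) (by simp)).contDiffAt (hV.mem_nhds hy)).differentiableAt
      (by simp)
  have h1 : ∀ a b : D, fderiv ℝ (fun z => fderiv ℝ f z a) y b = fderiv ℝ (fderiv ℝ f) y b a := by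
    intro a b
    rw [(hd.hasFDerivAt.clm_apply (hasFDerivAt_const a y)).fderiv]
    simp
  rw [h1, h1]
  exact ((hf.contDiffAt (hV.mem_nhds hy)).isSymmSndFDerivAt
    (by rw [minSmoothness_of_isRCLikeNormedField]; exact WithTop.coe_le_coe.2 (le_top (a := (2 : ℕ∞))))) w v

variable {m : ℕ} {V : Set (DualLieAlg m)} {τ : DualLieAlg m → ℝ}

theorem contDiffOn_hess (ξ : Module.Basis (Fin m) ℝ (LieAlg m)) (hV : IsOpen V)
    (hτ : ContDiffOn ℝ ∞ τ V) (i j : Fin m) : ContDiffOn ℝ ∞ (fun y => hess ξ τ y i j) V :=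
  contDiffOn_fderiv_apply hV (contDiffOn_fderiv_apply hV hτ _) _

theorem hess_comm (ξ : Module.Basis (Fin m) ℝ (LieAlg m)) (hV : IsOpen V)
    (hτ : ContDiffOn ℝ ∞ τ V) {y : DualLieAlg m} (hy : y ∈ V) (i j : Fin m) :
    hess ξ τ y i j = hess ξ τ y j i :=
  fderiv_fderiv_apply_comm hV hτ hy _ _

theorem fderiv_hess_comm (ξ : Module.Basis (Fin m) ℝ (LieAlg m)) (hV : IsOpen V)
    (hτ : ContDiffOn ℝ ∞ τ V) {y : DualLieAlg m} (hy : y ∈ V) (i j k : Fin m) :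
    fderiv ℝ (fun y => hess ξ τ y i j) y (dualVec ξ k)
      = fderiv ℝ (fun y => hess ξ τ y i k) y (dualVec ξ j) := by
  have h1 : ∀ j, (fun y => hess ξ τ y i j) =ᶠ[𝓝 y]
      fun y => fderiv ℝ (fun z => fderiv ℝ τ z (dualVec ξ i)) y (dualVec ξ j) := fun j => by
    filter_upwards [hV.mem_nhds hy] with z hz
    exact hess_comm ξ hV hτ hz i j
  rw [(h1 j).fderiv_eq, (h1 k).fderiv_eq]
  exact fderiv_fderiv_apply_comm hV (contDiffOn_fderiv_apply hV hτ _) hy _ _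

theorem fderiv_hess_add_const_row (ξ : Module.Basis (Fin m) ℝ (LieAlg m)) (hV : IsOpen V)
    (hτ : ContDiffOn ℝ ∞ τ V) (C : Matrix (Fin m) (Fin m) ℝ) {y : DualLieAlg m} (hy : y ∈ V)
    (i j k : Fin m) : fderiv ℝ (fun y => (hess ξ τ y + C) i j) y (dualVec ξ k)
      = fderiv ℝ (fun y => (hess ξ τ y + C) i k) y (dualVec ξ j) := by
  simp only [Matrix.add_apply, fderiv_add_const]
  exact fderiv_hess_comm ξ hV hτ hy i j k

theorem fderiv_hess_add_const_col (ξ : Module.Basis (Fin m) ℝ (LieAlg m)) (hV : IsOpen V)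
    (hτ : ContDiffOn ℝ ∞ τ V) (C : Matrix (Fin m) (Fin m) ℝ) {y : DualLieAlg m} (hy : y ∈ V)
    (i j k : Fin m) : fderiv ℝ (fun y => (hess ξ τ y + C) j i) y (dualVec ξ k)
      = fderiv ℝ (fun y => (hess ξ τ y + C) k i) y (dualVec ξ j) := by
  simp only [Matrix.add_apply, fderiv_add_const]
  have h1 : ∀ j, (fun y => hess ξ τ y j i) =ᶠ[𝓝 y] fun y => hess ξ τ y i j := fun j => by
    filter_upwards [hV.mem_nhds hy] with z hz
    exact hess_comm ξ hV hτ hz j i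
  rw [(h1 j).fderiv_eq, (h1 k).fderiv_eq]
  exact fderiv_hess_comm ξ hV hτ hy i j k

end Hessian

/-! ### Positivity of non-symmetric matrices. -/

section Matrices

variable {n : Type*} [Fintype n]

theorem dotProduct_mulVec_eq_zero_of_transpose_eq_neg {C : Matrix n n ℝ} (hC : C.transpose = -C)
    (v : n → ℝ) : v ⬝ᵥ C.mulVec v = 0 := by
  have h1 : v ⬝ᵥ C.mulVec v = - (v ⬝ᵥ C.mulVec v) := by
    conv_lhs => rw [Matrix.dotProduct_mulVec, ← Matrix.mulVec_transpose, hC, Matrix.neg_mulVec,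
      neg_dotProduct, dotProduct_comm]
  linarith

theorem dotProduct_add_mulVec_of_transpose_eq_neg {C : Matrix n n ℝ} (hC : C.transpose = -C)
    (H : Matrix n n ℝ) (v : n → ℝ) : v ⬝ᵥ (H + C).mulVec v = v ⬝ᵥ H.mulVec v := by
  rw [Matrix.add_mulVec, dotProduct_add, dotProduct_mulVec_eq_zero_of_transpose_eq_neg hC, add_zero]

variable [DecidableEq n]

theorem isUnit_det_of_dotProduct_mulVec_pos {P : Matrix n n ℝ}
    (hP : ∀ v : n → ℝ, v ≠ 0 → 0 < v ⬝ᵥ P.mulVec v) : IsUnit P.det := by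
  rw [isUnit_iff_ne_zero]
  intro h0
  obtain ⟨v, hv, hPv⟩ := Matrix.exists_mulVec_eq_zero_iff.2 h0
  have := hP v hv
  rw [hPv, dotProduct_zero] at this
  exact lt_irrefl _ this

theorem dotProduct_inv_mulVec_pos {P : Matrix n n ℝ}
    (hP : ∀ v : n → ℝ, v ≠ 0 → 0 < v ⬝ᵥ P.mulVec v) {v : n → ℝ} (hv : v ≠ 0) :
    0 < v ⬝ᵥ P⁻¹.mulVec v := by
  have hv' : P.mulVec (P⁻¹.mulVec v) = v := by
    rw [Matrix.mulVec_mulVec, Matrix.mul_nonsing_inv _ (isUnit_det_of_dotProduct_mulVec_pos hP),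
      Matrix.one_mulVec]
  have h1 := hP (P⁻¹.mulVec v) fun h => hv (by rw [← hv', h, Matrix.mulVec_zero])
  rwa [hv', dotProduct_comm] at h1

end Matrices

/-! ### The matrix of an anti-diagonal element of `DGAK`. -/

section AntiDiagonal

variable {m : ℕ} {M : Type*} [TopologicalSpace M] [ChartedSpace (Model m) M]
  [AddAction (Torus m) M] [IsManifold (𝓡 (2 * m)) ∞ M]
  {μ : M → DualLieAlg m} {J : EndField m M} {Ω : BilinField m M}
  {ξ : Module.Basis (Fin m) ℝ (LieAlg m)} {X : Fin m → VField m M} {θ : Fin m → CovField m M}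
  {x : M} {J' : EndField m M} {Ψ : M → Matrix (Fin m) (Fin m) ℝ}

theorem IsInducedCoord.exists_tangent (hX : IsInducedCoord μ ξ J X θ) (hM : IsSymplecticToric Ω μ)
    (hx : x ∈ openPart μ) (a b : Fin m → ℝ) :
    ∃ v : TangentSpace (𝓡 (2 * m)) x, muPart μ ξ x v = a ∧ anglePart θ x v = b := by
  refine ⟨∑ j, a j • X j x + ∑ j, b j • fundField (ξ j) x, funext fun i => ?_, funext fun i => ?_⟩
  · simp only [muPart, map_add, map_sum, map_smul, hX.dmu_X hx, hM.dmu_fundField]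
    simp
  · simp only [anglePart, map_add, map_sum, map_smul, hX.angle_X hx, hX.angle_fundField hx]
    simp

theorem IsInducedCoord.mem_orbitSpan_iff (hX : IsInducedCoord μ ξ J X θ)
    (hM : IsSymplecticToric Ω μ) (hx : x ∈ openPart μ) {v : TangentSpace (𝓡 (2 * m)) x} :
    v ∈ orbitSpan x ↔ muPart μ ξ x v = 0 := by
  constructor
  · intro hv
    funext i
    have h1 : orbitSpan x ≤ LinearMap.ker (dmu μ ξ i x).toLinearMap := by
      refine Submodule.span_le.2 ?_
      rintro _ ⟨b, rfl⟩
      exact hM.dmu_fundField i b x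
    exact h1 hv
  · intro hv
    rw [hX.expand hM hx v, hv]
    simp only [Pi.zero_apply, zero_smul, Finset.sum_const_zero, zero_add]
    exact Submodule.sum_mem _ fun j _ =>
      Submodule.smul_mem _ _ (Submodule.subset_span ⟨ξ j, rfl⟩)

/-- The image of `𝒦` is the common kernel of the `dtʲ`, whatever the invertible matrix. This makes
the condition `J^{*Ω}𝒦 = J𝒦` automatic for anti-diagonal structures with invertible matrix. -/
theorem IsInducedCoord.mem_map_orbitSpan_iff (hX : IsInducedCoord μ ξ J X θ)
    (hM : IsSymplecticToric Ω μ) (hx : x ∈ openPart μ) (hdet : IsUnit (Ψ x).det)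
    {v : TangentSpace (𝓡 (2 * m)) x} :
    v ∈ (orbitSpan x).map (antiDiag μ ξ X θ Ψ x).toLinearMap ↔ anglePart θ x v = 0 := by
  constructor
  · rintro ⟨w, hw, rfl⟩
    refine (hX.anglePart_antiDiag hx Ψ w).trans ?_
    rw [(hX.mem_orbitSpan_iff hM hx).1 hw, Matrix.mulVec_zero]
  · intro hv
    obtain ⟨w, hw1, hw2⟩ := hX.exists_tangent hM hx 0 (-(Ψ x).mulVec (muPart μ ξ x v))
    refine ⟨w, (hX.mem_orbitSpan_iff hM hx).2 hw1, hX.ext hM hx ?_ ?_⟩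
    · refine (hX.muPart_antiDiag hM hx Ψ w).trans ?_
      rw [hw2, Matrix.mulVec_neg, neg_neg, Matrix.mulVec_mulVec, Matrix.nonsing_inv_mul _ hdet,
        Matrix.one_mulVec]
    · refine (hX.anglePart_antiDiag hx Ψ w).trans ?_
      rw [hw1, hv, Matrix.mulVec_zero]

/-- The inverse of a singular matrix is `0` by convention, so invertibility is not part of the
anti-diagonal form; it follows from `J' ∘ J' = -1` read on the `dμ`-components. -/
theorem IsInducedCoord.isUnit_det (hX : IsInducedCoord μ ξ J X θ) (hM : IsSymplecticToric Ω μ)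
    (hJ' : IsDGAK Ω μ (openPart μ) J') (hx : x ∈ openPart μ)
    (h : J' x = antiDiag μ ξ X θ Ψ x) : IsUnit (Ψ x).det := by
  have h1 : (Ψ x)⁻¹ * Ψ x = 1 := by
    refine Matrix.ext_of_mulVec_single fun j => ?_
    obtain ⟨v, hv, -⟩ := hX.exists_tangent hM hx (Pi.single j 1) 0
    have h2 := congrArg (muPart μ ξ x) (hJ'.sq_eq_neg x hx v)
    rw [h, hX.muPart_antiDiag hM hx, hX.anglePart_antiDiag hx, Matrix.mulVec_mulVec, hv] at h2
    have h3 : muPart μ ξ x (-v) = - muPart μ ξ x v := funext fun i => map_neg _ _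
    rw [h3, hv] at h2
    rw [neg_injective h2, Matrix.one_mulVec]
  exact Matrix.isUnit_det_of_left_inverse h1

/-- The structure and the coframe `dμʲ`, `dtʲ` are all torus invariant, hence so are the matrix
entries. -/
theorem IsInducedCoord.matrix_vadd (hX : IsInducedCoord μ ξ J X θ) (hM : IsSymplecticToric Ω μ)
    (hJ : IsDGAK Ω μ univ J) (hJ' : IsDGAK Ω μ (openPart μ) J')
    (h : ∀ x ∈ openPart μ, J' x = antiDiag μ ξ X θ Ψ x) (hx : x ∈ openPart μ) (g : Torus m) :
    Ψ (g +ᵥ x) = Ψ x := by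
  have hgx : g +ᵥ x ∈ openPart μ := (hM.vadd_mem_openPart g).2 hx
  refine Matrix.ext_of_mulVec_single fun j => ?_
  obtain ⟨v, hv, -⟩ := hX.exists_tangent hM hx (Pi.single j 1) 0
  have h2 := congrArg (anglePart θ (g +ᵥ x)) (hJ'.invariant g x hx v)
  rw [hX.anglePart_actDeriv hM hJ hx, h x hx, h _ hgx, hX.anglePart_antiDiag hx,
    hX.anglePart_antiDiag hgx, hM.muPart_actDeriv, hv] at h2
  exact h2.symm

theorem IsInducedCoord.dotProduct_mulVec_pos (hX : IsInducedCoord μ ξ J X θ)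
    (hM : IsSymplecticToric Ω μ) (hJ : IsDGAK Ω μ univ J) (hJ' : IsDGAK Ω μ (openPart μ) J')
    (hx : x ∈ openPart μ) (h : J' x = antiDiag μ ξ X θ Ψ x) {a : Fin m → ℝ} (ha : a ≠ 0) :
    0 < a ⬝ᵥ (Ψ x).mulVec a := by
  obtain ⟨v, hv, hv'⟩ := hX.exists_tangent hM hx a 0
  have hv0 : v ≠ 0 := by
    rintro rfl
    exact ha (hv.symm.trans (funext fun i => map_zero _))
  have h1 := hJ'.tamed x hx v hv0
  rw [hX.omega_eq hM hJ hx, h, hX.anglePart_antiDiag hx, hv, hv', zero_dotProduct, sub_zero] at h1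
  exact h1

/-- The matrix of an invariant anti-diagonal almost complex structure is a smooth function of the
moment map. -/
theorem IsInducedCoord.exists_matrix_eq_comp_moment [T2Space M] [CompactSpace M] [ConnectedSpace M]
    (hX : IsInducedCoord μ ξ J X θ) (hM : IsSymplecticToric Ω μ)
    (hJ : IsDGAK Ω μ univ J) (hJ' : IsDGAK Ω μ (openPart μ) J')
    (hΨ : ∀ i j, ContMDiffOn (𝓡 (2 * m)) 𝓘(ℝ, ℝ) ∞ (fun x => Ψ x i j) (openPart μ))
    (h : ∀ x ∈ openPart μ, J' x = antiDiag μ ξ X θ Ψ x) :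
    ∃ P : DualLieAlg m → Matrix (Fin m) (Fin m) ℝ,
      (∀ i j, ContDiffOn ℝ ∞ (fun y => P y i j) (polyInt μ)) ∧
      ∀ x ∈ openPart μ, Ψ x = P (μ x) := by
  have hne : Nonempty M := inferInstance
  -- The choice of a preimage is immaterial: fibres over `Δ°` are torus orbits, on which `Ψ` is
  -- constant. Smoothness comes afterwards from smooth local sections of `μ`.
  let P : DualLieAlg m → Matrix (Fin m) (Fin m) ℝ := fun y => Ψ (Function.invFun μ y)
  have hPμ : ∀ x ∈ openPart μ, Ψ x = P (μ x) := by
    intro x hx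
    obtain ⟨g, hg⟩ := hX.exists_eq_vadd hM hJ hx
      (Function.invFun_eq (f := μ) (b := μ x) ⟨x, rfl⟩).symm
    change Ψ x = Ψ (Function.invFun μ (μ x))
    rw [hg, hX.matrix_vadd hM hJ hJ' h hx]
  refine ⟨P, fun i j y hy => ?_, hPμ⟩
  obtain ⟨x, rfl⟩ := interior_subset hy
  obtain ⟨σ, hσx, hσ, hσμ⟩ := hX.exists_local_section hM hJ (x := x) hy
  have h1 : ContMDiffAt 𝓘(ℝ, DualLieAlg m) 𝓘(ℝ, ℝ) ∞ (fun y => Ψ (σ y) i j) (μ x) :=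
    ContMDiffAt.comp_of_eq (g := fun x => Ψ x i j)
      ((hΨ i j).contMDiffAt (hM.isOpen_openPart.mem_nhds hy)) hσ hσx
  refine (h1.contDiffAt.congr_of_eventuallyEq ?_).contDiffWithinAt
  filter_upwards [hσμ, isOpen_interior.mem_nhds hy] with z hz hz'
  have hσz : σ z ∈ openPart μ := by
    change μ (σ z) ∈ polyInt μ
    rwa [hz]
  rw [hPμ _ hσz, hz]

end AntiDiagonal

/-! ### The integrability criteria and the converse construction. -/

section Classification

theorem fderiv_neg_fun_apply {D : Type*} [NormedAddCommGroup D] [NormedSpace ℝ D] (f : D → ℝ)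
    (y v : D) : fderiv ℝ (fun z => - f z) y v = - fderiv ℝ f y v := by
  rw [fderiv_fun_neg, neg_apply]

variable {m : ℕ} {M : Type*} [TopologicalSpace M] [T2Space M] [CompactSpace M] [ConnectedSpace M]
  [ChartedSpace (Model m) M] [AddAction (Torus m) M] [IsManifold (𝓡 (2 * m)) ∞ M]
  {μ : M → DualLieAlg m} {J : EndField m M} {Ω : BilinField m M}
  {ξ : Module.Basis (Fin m) ℝ (LieAlg m)} {X : Fin m → VField m M} {θ : Fin m → CovField m M}
  {J' : EndField m M}

/-- Integrability of the symplectic adjoint of an anti-diagonal almost complex structure in terms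
of the matrix of the latter. -/
theorem IsInducedCoord.integrableOn_sympAdj_iff
    (hX : IsInducedCoord μ ξ J X θ) (hM : IsSymplecticToric Ω μ) (hJ : IsDGAK Ω μ univ J)
    {P : DualLieAlg m → Matrix (Fin m) (Fin m) ℝ}
    (hP : ∀ i j, ContDiffOn ℝ ∞ (fun y => P y i j) (polyInt μ))
    (hdet : ∀ y ∈ polyInt μ, IsUnit (P y).det)
    (hJ' : ∀ x ∈ openPart μ, J' x = antiDiag μ ξ X θ (fun x => P (μ x)) x) :
    IntegrableOn (sympAdj Ω J') (openPart μ) ↔ ∀ y ∈ polyInt μ, ∀ i j k,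
      fderiv ℝ (fun y => P y j i) y (dualVec ξ k) = fderiv ℝ (fun y => P y k i) y (dualVec ξ j) := by
  rw [hX.integrableOn_iff hM hJ (P := fun y => -(P y).transpose) (fun i j => (hP j i).neg)
    (fun y hy => ?_) fun x hx => hX.sympAdj_eq hM hJ hx (hJ' x hx) (hdet _ hx) rfl]
  · refine forall₂_congr fun y hy => forall_congr' fun i => forall₂_congr fun j k => ?_
    have h1 : ∀ (i j : Fin m) (v : DualLieAlg m), fderiv ℝ (fun y => (-(P y).transpose) i j) y v
        = - fderiv ℝ (fun y => P y j i) y v := fun i j v => fderiv_neg_fun_apply _ y v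
    rw [h1, h1, neg_inj]
  · rw [Matrix.det_neg, Matrix.det_transpose]
    exact ((isUnit_one.neg).pow _).mul (hdet y hy)

/-- The criteria for the integrability of an anti-diagonal element of `DGAK` and of its symplectic
adjoint. -/
theorem IsInducedCoord.integrability_criteria
    (hX : IsInducedCoord μ ξ J X θ) (hM : IsSymplecticToric Ω μ) (hJ : IsDGAK Ω μ univ J)
    {Ψ : M → Matrix (Fin m) (Fin m) ℝ} (hJ' : IsDGAK Ω μ (openPart μ) J')
    (hΨ : ∀ i j, ContMDiffOn (𝓡 (2 * m)) 𝓘(ℝ, ℝ) ∞ (fun x => Ψ x i j) (openPart μ))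
    (h : ∀ x ∈ openPart μ, J' x = antiDiag μ ξ X θ Ψ x) :
    (IntegrableOn J' (openPart μ) ↔ ∀ x ∈ openPart μ, ∀ i j k,
      dfun (fun y => Ψ y i j) x (X k x) = dfun (fun y => Ψ y i k) x (X j x)) ∧
    (IntegrableOn (sympAdj Ω J') (openPart μ) ↔ ∀ x ∈ openPart μ, ∀ i j k,
      dfun (fun y => Ψ y j i) x (X k x) = dfun (fun y => Ψ y k i) x (X j x)) ∧
    ((IntegrableOn J' (openPart μ) ∧ IntegrableOn (sympAdj Ω J') (openPart μ)) ↔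
      ∃ (τ : DualLieAlg m → ℝ) (C : Matrix (Fin m) (Fin m) ℝ),
        ContDiffOn ℝ ∞ τ (polyInt μ) ∧ (∀ y ∈ polyInt μ, (hess ξ τ y).PosDef) ∧
        C.transpose = -C ∧ ∀ x ∈ openPart μ, Ψ x = hess ξ τ (μ x) + C) := by
  obtain ⟨P, hP, hΨP⟩ := hX.exists_matrix_eq_comp_moment hM hJ hJ' hΨ h
  have hsurj : ∀ {Q : DualLieAlg m → Prop}, (∀ y ∈ polyInt μ, Q y) ↔ ∀ x ∈ openPart μ, Q (μ x) := by
    refine fun {Q} => ⟨fun hQ x hx => hQ _ hx, fun hQ y hy => ?_⟩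
    obtain ⟨x, rfl⟩ := interior_subset hy
    exact hQ x hy
  have hdet : ∀ y ∈ polyInt μ, IsUnit (P y).det := hsurj.2 fun x hx => by
    rw [← hΨP x hx]
    exact hX.isUnit_det hM hJ' hx (h x hx)
  have hJP : ∀ x ∈ openPart μ, J' x = antiDiag μ ξ X θ (fun x => P (μ x)) x := fun x hx => by
    rw [h x hx]
    simp only [antiDiag, hΨP x hx]
  have hder : ∀ x ∈ openPart μ, ∀ i j k, dfun (fun y => Ψ y i j) x (X k x)
      = fderiv ℝ (fun y => P y i j) (μ x) (dualVec ξ k) := fun x hx i j k => by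
    have h1 : (fun y => Ψ y i j) =ᶠ[𝓝 x] fun y => P (μ y) i j := by
      filter_upwards [hM.isOpen_openPart.mem_nhds hx] with y hy
      rw [hΨP y hy]
    rw [dfun_congr h1]
    exact hX.dfun_comp_moment_X hM hx (f := fun y => P y i j)
      (differentiableAt_of_contDiffOn (hP i j) isOpen_interior hx) k
  have hrow := hX.integrableOn_iff hM hJ hP hdet hJP
  have hcol := hX.integrableOn_sympAdj_iff hM hJ hP hdet hJP
  refine ⟨?_, ?_, ?_⟩
  · rw [hrow, hsurj]
    refine forall₂_congr fun x hx => forall_congr' fun i => forall₂_congr fun j k => ?_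
    rw [hder x hx, hder x hx]
  · rw [hcol, hsurj]
    refine forall₂_congr fun x hx => forall_congr' fun i => forall₂_congr fun j k => ?_
    rw [hder x hx, hder x hx]
  · rw [hrow, hcol]
    constructor
    · rintro ⟨h1, h2⟩
      obtain ⟨τ, C, hτ, hC, hPτ⟩ := exists_hess_add_const ξ isOpen_interior
        (hX.convex_polyInt hM hJ) hP h1 h2
      refine ⟨τ, C, hτ, hsurj.2 fun x hx => ?_, hC, fun x hx => by rw [hΨP x hx, hPτ _ hx]⟩
      -- Taming makes the quadratic form of `Ψ` positive, and the antisymmetric `C` drops out of it.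
      refine Matrix.PosDef.of_dotProduct_mulVec_pos ?_ fun a ha => ?_
      · ext i j
        exact hess_comm ξ isOpen_interior hτ hx j i
      · have h3 := hX.dotProduct_mulVec_pos hM hJ hJ' hx (h x hx) ha
        rw [hΨP x hx, hPτ _ hx, dotProduct_add_mulVec_of_transpose_eq_neg hC] at h3
        exact h3
    · rintro ⟨τ, C, hτ, -, hC, hΨτ⟩
      have hPτ : ∀ y ∈ polyInt μ, P y = hess ξ τ y + C := hsurj.2 fun x hx => by
        rw [← hΨP x hx, hΨτ x hx]
      have h1 : ∀ y ∈ polyInt μ, ∀ i j,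
          (fun y => P y i j) =ᶠ[𝓝 y] fun y => (hess ξ τ y + C) i j := fun y hy i j => by
        filter_upwards [isOpen_interior.mem_nhds hy] with z hz
        rw [hPτ z hz]
      constructor
      · intro y hy i j k
        rw [(h1 y hy i j).fderiv_eq, (h1 y hy i k).fderiv_eq]
        exact fderiv_hess_add_const_row ξ isOpen_interior hτ C hy i j k
      · intro y hy i j k
        rw [(h1 y hy j i).fderiv_eq, (h1 y hy k i).fderiv_eq]
        exact fderiv_hess_add_const_col ξ isOpen_interior hτ C hy i j k

/-- Strictly convex functions on the interior of the moment polytope and antisymmetric matrices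
give elements of `DGK`. -/
theorem IsInducedCoord.isDGK_antiDiag
    (hX : IsInducedCoord μ ξ J X θ) (hM : IsSymplecticToric Ω μ) (hJ : IsDGAK Ω μ univ J)
    {τ : DualLieAlg m → ℝ} {C : Matrix (Fin m) (Fin m) ℝ} (hτ : ContDiffOn ℝ ∞ τ (polyInt μ))
    (hpos : ∀ y ∈ polyInt μ, (hess ξ τ y).PosDef) (hC : C.transpose = -C) :
    IsDGK Ω μ (openPart μ) (antiDiag μ ξ X θ (fun x => hess ξ τ (μ x) + C)) := by
  have hP : ∀ i j, ContDiffOn ℝ ∞ (fun y => (hess ξ τ y + C) i j) (polyInt μ) := fun i j =>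
    (contDiffOn_hess ξ isOpen_interior hτ i j).add contDiffOn_const
  have hPpos : ∀ y ∈ polyInt μ, ∀ v : Fin m → ℝ, v ≠ 0 → 0 < v ⬝ᵥ (hess ξ τ y + C).mulVec v :=
    fun y hy v hv => by
      rw [dotProduct_add_mulVec_of_transpose_eq_neg hC]
      exact (hpos y hy).dotProduct_mulVec_pos hv
  have hdet : ∀ y ∈ polyInt μ, IsUnit (hess ξ τ y + C).det := fun y hy =>
    isUnit_det_of_dotProduct_mulVec_pos (hPpos y hy)
  set Ψ : M → Matrix (Fin m) (Fin m) ℝ := fun x => hess ξ τ (μ x) + C with hΨ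
  refine ⟨⟨?_, ?_, ?_, ?_, ?_⟩, ?_, ?_⟩
  · exact smoothEndOn_of_forall fun x hx Y hY => hX.smoothVFieldAt_antiDiag hM hJ hx
      (fun i j => hM.contMDiffAt_comp_moment hx (hP i j)) (hdet _ hx) hY
  · intro x hx v
    have hneg : muPart μ ξ x (-v) = - muPart μ ξ x v := funext fun i => map_neg _ _
    have hneg' : anglePart θ x (-v) = - anglePart θ x v := funext fun i => map_neg _ _
    refine hX.ext hM hx ?_ ?_
    · rw [hX.muPart_antiDiag hM hx, hX.anglePart_antiDiag hx, Matrix.mulVec_mulVec,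
        Matrix.nonsing_inv_mul _ (hdet _ hx), Matrix.one_mulVec, hneg]
    · rw [hX.anglePart_antiDiag hx, hX.muPart_antiDiag hM hx, Matrix.mulVec_neg,
        Matrix.mulVec_mulVec, Matrix.mul_nonsing_inv _ (hdet _ hx), Matrix.one_mulVec, hneg']
  · intro x hx v hv
    -- With `a` and `α` the `dμ`- and `dt`-components of `v`, this gives `Ω(v, Jv) = aᵀΨa + αᵀΨ⁻¹α`;
    -- both forms are positive definite and `a`, `α` are not both zero.
    rw [hX.omega_eq hM hJ hx, hX.anglePart_antiDiag hx, hX.muPart_antiDiag hM hx, dotProduct_neg,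
      sub_neg_eq_add]
    have hge : ∀ (Q : Matrix (Fin m) (Fin m) ℝ), (∀ a : Fin m → ℝ, a ≠ 0 → 0 < a ⬝ᵥ Q.mulVec a) →
        ∀ a : Fin m → ℝ, 0 ≤ a ⬝ᵥ Q.mulVec a := fun Q hQ a => by
      by_cases ha : a = 0
      · rw [ha, zero_dotProduct]
      · exact (hQ a ha).le
    have hinv : ∀ a : Fin m → ℝ, a ≠ 0 → 0 < a ⬝ᵥ (Ψ x)⁻¹.mulVec a := fun a ha =>
      dotProduct_inv_mulVec_pos (hPpos _ hx) ha
    by_cases hv1 : muPart μ ξ x v = 0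
    · refine add_pos_of_nonneg_of_pos (hge _ (hPpos _ hx) _) (hinv _ fun hv2 => hv ?_)
      exact hX.ext hM hx (hv1.trans (funext fun i => (map_zero _).symm))
        (hv2.trans (funext fun i => (map_zero _).symm))
    · exact add_pos_of_pos_of_nonneg (hPpos _ hx _ hv1) (hge _ hinv _)
  · intro g x hx v
    have hgx : g +ᵥ x ∈ openPart μ := (hM.vadd_mem_openPart g).2 hx
    have hΨg : Ψ (g +ᵥ x) = Ψ x := by simp only [hΨ, hM.invariant_moment]
    refine hX.ext hM hgx ?_ ?_
    · rw [hM.muPart_actDeriv, hX.muPart_antiDiag hM hx, hX.muPart_antiDiag hM hgx,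
        hX.anglePart_actDeriv hM hJ hx, hΨg]
    · rw [hX.anglePart_actDeriv hM hJ hx, hX.anglePart_antiDiag hx, hX.anglePart_antiDiag hgx,
        hM.muPart_actDeriv, hΨg]
  · rintro x ⟨hx, -⟩
    -- The adjoint is again anti-diagonal, so both images of `𝒦` are the common kernel of the `dtʲ`.
    rw [hX.sympAdj_eq hM hJ hx (Ψ := Ψ) (Ψ' := fun x => -(Ψ x).transpose) rfl (hdet _ hx) rfl]
    ext v
    rw [hX.mem_map_orbitSpan_iff hM hx, hX.mem_map_orbitSpan_iff hM hx (hdet _ hx)]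
    rw [Matrix.det_neg, Matrix.det_transpose]
    exact ((isUnit_one.neg).pow _).mul (hdet _ hx)
  · exact (hX.integrableOn_iff hM hJ hP hdet fun x _ => rfl).2 fun y hy i j k =>
      fderiv_hess_add_const_row ξ isOpen_interior hτ C hy i j k
  · exact (hX.integrableOn_sympAdj_iff hM hJ hP hdet fun x _ => rfl).2 fun y hy i j k =>
      fderiv_hess_add_const_col ξ isOpen_interior hτ C hy i j k

end Classification

end ToricGK

end

theorem theorem3p6 {m : ℕ} {M : Type*} [TopologicalSpace M] [T2Space M] [CompactSpace M]
    [ConnectedSpace M] [ChartedSpace (ToricGK.Model m) M] [IsManifold (𝓡 (2 * m)) ∞ M]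
    [AddAction (ToricGK.Torus m) M]
    (Ω : ToricGK.BilinField m M) (μ : M → ToricGK.DualLieAlg m)
    (hM : ToricGK.IsSymplecticToric Ω μ)
    (ξ : Module.Basis (Fin m) ℝ (ToricGK.LieAlg m))
    (X : Fin m → ToricGK.VField m M) (θ : Fin m → ToricGK.CovField m M)
    (hX : ToricGK.IsAdmissibleCoord Ω μ ξ X θ) :
    (∀ (J : ToricGK.EndField m M) (Ψ : M → Matrix (Fin m) (Fin m) ℝ),
      ToricGK.IsDGAK Ω μ (ToricGK.openPart μ) J →
      (∀ i j, ContMDiffOn (𝓡 (2 * m)) 𝓘(ℝ, ℝ) ∞ (fun x => Ψ x i j) (ToricGK.openPart μ)) →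
      (∀ x ∈ ToricGK.openPart μ, J x = ToricGK.antiDiag μ ξ X θ Ψ x) →
        (ToricGK.IntegrableOn J (ToricGK.openPart μ) ↔
          ∀ x ∈ ToricGK.openPart μ, ∀ i j k,
            ToricGK.dfun (fun y => Ψ y i j) x (X k x)
              = ToricGK.dfun (fun y => Ψ y i k) x (X j x)) ∧
        (ToricGK.IntegrableOn (ToricGK.sympAdj Ω J) (ToricGK.openPart μ) ↔
          ∀ x ∈ ToricGK.openPart μ, ∀ i j k,
            ToricGK.dfun (fun y => Ψ y j i) x (X k x)
              = ToricGK.dfun (fun y => Ψ y k i) x (X j x)) ∧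
        ((ToricGK.IntegrableOn J (ToricGK.openPart μ) ∧
            ToricGK.IntegrableOn (ToricGK.sympAdj Ω J) (ToricGK.openPart μ)) ↔
          ∃ (τ : ToricGK.DualLieAlg m → ℝ) (C : Matrix (Fin m) (Fin m) ℝ),
            ContDiffOn ℝ ∞ τ (ToricGK.polyInt μ) ∧
            (∀ y ∈ ToricGK.polyInt μ, (ToricGK.hess ξ τ y).PosDef) ∧
            C.transpose = -C ∧
            ∀ x ∈ ToricGK.openPart μ, Ψ x = ToricGK.hess ξ τ (μ x) + C)) ∧
    (∀ (τ : ToricGK.DualLieAlg m → ℝ) (C : Matrix (Fin m) (Fin m) ℝ),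
      ContDiffOn ℝ ∞ τ (ToricGK.polyInt μ) →
      (∀ y ∈ ToricGK.polyInt μ, (ToricGK.hess ξ τ y).PosDef) →
      C.transpose = -C →
        ToricGK.IsDGK Ω μ (ToricGK.openPart μ)
          (ToricGK.antiDiag μ ξ X θ (fun x => ToricGK.hess ξ τ (μ x) + C))) := by
  obtain ⟨J₀, hJ₀, hX⟩ := hX
  exact ⟨fun _ _ hJ hΨ h => hX.integrability_criteria hM hJ₀.toIsDGAK hJ hΨ h,
    fun _ _ hτ hpos hC => hX.isDGK_antiDiag hM hJ₀.toIsDGAK hτ hpos hC⟩
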